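/- **Setting.** Permutations are permutations of $\{1,2,\dots\}$; $t_{pq}$ is the transposition of $p$ and $q$, $s_m=t_{m,m+1}$, and $t_{pq}\pi$ acts on values. A plactic biword is a word $Q=\binom{b_1\,\cdots\,b_\ell}{k_1\,\cdots\,k_\ell}$ of positive integers with $b_j\le k_j$ for all $j$ and $k_1\ge\dots\ge k_\ell$. For $i,j\ge 0$ let $w(i,j)$ be the biword obtained from $Q$ by removing all biletters $\binom{b_s}{k_s}$ with $b_s\le i$ or $s>j$. A (reduced) bumpless pipe dream is a tiling of $\{1,2,\dots\}^2$ (matrix coordinates, rows from the top) by blank tiles, horizontal and vertical segments, crossings, $r$-turns (joining the bottom and right edges) and $j$-turns (joining the left and top edges), which fit together, agree outside a finite square with the tiling of the identity ($r$-turns on the diagonal, horizontal above it, vertical below it), and form pipes running from the south to the east, any two of which cross at most once. It is a bumpless pipe dream of $\pi$ if the pipe entering from the south in column $\pi(r)$ exits to the east in row $r$, for all $r$. The right insertion (of Huang and Pylyavskyy) of a biletter $\binom bk$ into a bumpless pipe dream starts at the rightmost $r$-turn $(i,j)$ of row $b$ and proceeds as follows. (i) Min-droop: let $i_1>i$ and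 $j_1>j$ be smallest such that the tiles $(i_1,j)$ and $(i,j_1)$ are not crossings, and reroute the pipe of the $r$-turn at $(i,j)$, which runs along the left and top sides of the rectangle with corners $(i,j)$ and $(i_1,j_1)$, so that it runs along its bottom and right sides. (ii) If $(i_1,j_1)$ is now a $j$-turn, go to (i) with $(i,j)$ the nearest $r$-turn to its left in row $i_1$. (iii) Otherwise $(i_1,j_1)$ is now a bump (an $r$-turn and a $j$-turn in the same tile). If its two pipes cross in some tile $(x,y)$, replace the bump by a crossing and that crossing by a bump, and go to (i) with $(i,j)=(x,y)$. If they do not cross and the pipe of the $r$-turn exits from a row $\le k$, go to (i) with $(i,j)=(i_1,j_1)$. Otherwise replace the bump by a crossing and stop. Inserting the biletters of $w(i,j)$ successively, from left to right, starting with the bumpless pipe dream of the identity, is possible (each insertion terminates) and produces a bumpless pipe dream; let $\pi_{i,j}$ be its permutation. The well-defined matrix $(\pi_{i,j})$ is the growth diagram of $Q$. **Theorem.** Let $i,j\ge 1$ with $j\le\ell$, and consider the square with corners $$\pi=\pi_{i,j-1}\ (\text{NW}),\quad \sigma=\pi_{i,j}\ (\text{NE}),\quad \mu=\pi_{i-1,j-1}\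 (\text{SW}),\quad \rho=\pi_{i-1,j}\ (\text{SE})$$ and subscript $k=k_j$. The square contains an $\times$ if $b_j=i$, and no $\times$ otherwise. Then $\rho$ is obtained from $\pi,\mu,\sigma$ and $k$ by the following rules, where $I^C$ denotes $\{1,2,\dots\}\setminus I$. 1. Suppose that there is no $\times$ in the square. (a) If $\pi=\sigma$, then $\rho=\mu$. (b) If $\pi=\mu$, then $\rho=\sigma$. (c) If $\pi\ne\sigma$ and $\pi\neq\mu$, then $\mu=s_{i_c}\cdots s_{i_1}\pi$ for some finite set $I=\{i_c>\dots>i_1\}$ of positive integers, and $\sigma=t_{\alpha\beta}\pi$ for some $\alpha<\beta$ with $\pi^{-1}(\alpha)\le k<\pi^{-1}(\beta)$. For any such $I,\alpha,\beta$, let $A=(I^C\cap[\beta,\infty))\cup\{x\}$ with $x=\min(I^C\cap[\alpha,\beta))$, where $A=I^C\cap[\beta,\infty)$ if $I^C\cap[\alpha,\beta)$ is empty, and write $A=\{j_1<j_2<\cdots\}$. Then there is an index $m$ with $\mu^{-1}(j_m)\le k<\mu^{-1}(j_{m+1})$, and for the smallest such $m$ we have $\rho=t_{j_m,j_{m+1}}\mu$.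 2. Suppose that there is an $\times$ in the square. Then $\pi=\sigma$, and $\mu=s_{i_c}\cdots s_{i_1}\pi$ for some finite set $I=\{i_c>\dots>i_1\}$ of positive integers. For any such $I$, write $I^C=\{j_1<j_2<\cdots\}$. Then there is an index $m$ with $\mu^{-1}(j_m)\le k<\mu^{-1}(j_{m+1})$, and for the smallest such $m$ we have $\rho=t_{j_m,j_{m+1}}\mu$. -/

import Mathlib

namespace PlacticGrowth

open Filter

/-- The tiles of a bumpless pipe dream, together with the tile `bump` that occurs temporarily
during an insertion.
* `horiz`, `vert`, `cross`: straight segments and the crossing of two of them;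
* `rturn`: the pipe joins the bottom edge to the right edge;
* `jturn`: the pipe joins the left edge to the top edge;
* `bump`: an `rturn` and a `jturn` in the same tile. -/
inductive Tile
  | blank
  | horiz
  | vert
  | cross
  | rturn
  | jturn
  | bump

/-- Does a pipe of the tile use its left edge? -/
def Tile.left : Tile → Prop
  | .horiz | .cross | .jturn | .bump => True
  | .blank | .vert | .rturn => False

/-- Does a pipe of the tile use its right edge? -/
def Tile.right : Tile → Prop
  | .horiz | .cross | .rturn | .bump => True
  | .blank | .vert | .jturn => False

/-- Does a pipe of the tile use its bottom edge? -/
def Tile.bottom : Tile → Prop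
  | .vert | .cross | .rturn | .bump => True
  | .blank | .horiz | .jturn => False

/-- Does a pipe of the tile use its top edge? -/
def Tile.top : Tile → Prop
  | .vert | .cross | .jturn | .bump => True
  | .blank | .horiz | .rturn => False

/-- A tiling of the quadrant `{1, 2, …} × {1, 2, …}` in matrix coordinates: `D x y` is the tile in
row `x` (counted from the top) and column `y` (counted from the left). The tiles in row `0` and in
column `0` lie outside the quadrant; they are `blank` in all tilings that are considered. -/
abbrev Grid := ℕ → ℕ → Tile

/-- The pipe dream of the identity: pipe `p` goes up column `p`, turns on the diagonal, and goes
right along row `p`. -/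
def idGrid : Grid := fun x y =>
  if x = 0 ∨ y = 0 then .blank
  else if x = y then .rturn
  else if x < y then .horiz
  else .vert

/-- The side from which a pipe enters a tile. Pipes run from the south to the east, going only
up and to the right. -/
inductive Side
  | bottom
  | left

/-- `(x, y, s)`: a pipe entering the tile in row `x` and column `y` from the side `s`. -/
abbrev Pos := ℕ × ℕ × Side

/-- A pipe that enters the tile `t` from the bottom leaves it through the top or to the right, and
similarly for a pipe that enters from the left. -/
def Tile.goesUp : Tile → Side → Prop
  | .vert, .bottom | .cross, .bottom | .jturn, .left | .bump, .left => True
  | _, _ => False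

open Classical in
/-- Follow a pipe through one tile. -/
noncomputable def next (D : Grid) : Pos → Pos
  | (x, y, s) => if (D x y).goesUp s then (x - 1, y, .bottom) else (x, y + 1, .left)

/-- The pipe at `s` reaches `s'` later on. -/
def Reaches (D : Grid) (s s' : Pos) : Prop := ∃ n : ℕ, (next D)^[n] s = s'

/-- `s` and `s'` lie on the same pipe. -/
def SamePipe (D : Grid) (s s' : Pos) : Prop := Reaches D s s' ∨ Reaches D s' s

/-- The pipe at `s` exits from row `r`, i.e. it eventually runs to the right in row `r`. -/
def ExitsRow (D : Grid) (s : Pos) (r : ℕ) : Prop :=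
  ∀ᶠ n in atTop, ((next D)^[n] s).1 = r

/-- The two pipes that pass through the tile `(x, y)` are the two pipes that pass through the tile
`(x', y')` (for tiles which contain two pipes). -/
def SamePair (D : Grid) (x y x' y' : ℕ) : Prop :=
  (SamePipe D (x, y, .bottom) (x', y', .bottom) ∧ SamePipe D (x, y, .left) (x', y', .left)) ∨
  (SamePipe D (x, y, .bottom) (x', y', .left) ∧ SamePipe D (x, y, .left) (x', y', .bottom))

/-- `D ∈ BPD(π)`: `D` is a (reduced) bumpless pipe dream of the permutation `π` of `{1, 2, …}`.
Permutations of `{1, 2, …}` are permutations of `ℕ` that fix `0`. -/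
structure IsBPD (D : Grid) (π : Equiv.Perm ℕ) : Prop where
  /-- Row `0` and column `0` lie outside the quadrant. -/
  border : ∀ x y, x = 0 ∨ y = 0 → D x y = .blank
  /-- There are no bumps. -/
  no_bump : ∀ x y, D x y ≠ .bump
  /-- Neighbouring tiles fit together, horizontally and vertically. -/
  fit_horiz : ∀ x y, (D x y).right ↔ (D x (y + 1)).left
  fit_vert : ∀ x y, (D x y).bottom ↔ (D (x + 1) y).top
  /-- Outside some finite square the tiling is that of the identity. -/
  finite : ∃ n : ℕ, ∀ x y, n < x ∨ n < y → D x y = idGrid x y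
  /-- Two pipes cross at most once. -/
  reduced : ∀ x y x' y', D x y = .cross → D x' y' = .cross → SamePair D x y x' y' →
    x = x' ∧ y = y'
  /-- The pipe that comes from the south in column `p` exits in the row `r` with `π r = p`. -/
  fix_zero : π 0 = 0
  exits : ∀ p, 1 ≤ p → ∀ᶠ x in atTop, ExitsRow D (x, p, .bottom) (π.symm p)

/-- Replace one tile. -/
def setTile (D : Grid) (x y : ℕ) (t : Tile) : Grid :=
  fun x' y' => if x' = x ∧ y' = y then t else D x' y'

/-- `(i₁, j₁)` is the corner into which the min-droop at `(i, j)` goes: `i₁ > i` and `j₁ > j` are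
smallest such that the tiles `(i₁, j)` and `(i, j₁)` are not crossings. -/
def IsMinDroop (D : Grid) (i j i₁ j₁ : ℕ) : Prop :=
  IsLeast {x | i < x ∧ D x j ≠ .cross} i₁ ∧ IsLeast {y | j < y ∧ D i y ≠ .cross} j₁

/-- Droop the `rturn` at `(i, j)` (possibly the one of a bump) into `(i₁, j₁)`: the pipe that ran
up the left side and along the top side of the rectangle now runs along its bottom side and up
its right side. -/
def droop (D : Grid) (i j i₁ j₁ : ℕ) : Grid := fun x y =>
  if x = i ∧ y = j then
    match D x y with
    | .rturn => .blank
    | .bump => .jturn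
    | t => t
  else if x = i₁ ∧ y = j₁ then
    match D x y with
    | .blank => .jturn
    | .rturn => .bump
    | t => t
  else if x = i₁ ∧ y = j then
    match D x y with
    | .vert => .rturn
    | .jturn => .horiz
    | t => t
  else if x = i ∧ y = j₁ then
    match D x y with
    | .horiz => .rturn
    | .jturn => .vert
    | t => t
  else if y = j ∧ i < x ∧ x < i₁ then .horiz
  else if x = i ∧ j < y ∧ y < j₁ then .vert
  else if (x = i₁ ∧ j < y ∧ y < j₁) ∨ (y = j₁ ∧ i < x ∧ x < i₁) then .cross
  else D x y

/-- The two pipes in the bump `(x, y)` cross in the tile `(x', y')`. -/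
def CrossAt (D : Grid) (x y x' y' : ℕ) : Prop :=
  D x' y' = .cross ∧ SamePair D x y x' y'

/-- The loop of the right insertion algorithm. `Loop k D i j E`: continuing with a min-droop at
`(i, j)` in `D`, the algorithm terminates and returns `E`. -/
inductive Loop (k : ℕ) : Grid → ℕ → ℕ → Grid → Prop
  /-- The min-droop ends in a `jturn`: continue at the next `rturn` to the left. -/
  | jturn {D E D₁ : Grid} {i j i₁ j₁ j₂ : ℕ} (hm : IsMinDroop D i j i₁ j₁)
      (hD : D₁ = droop D i j i₁ j₁) (ht : D₁ i₁ j₁ = .jturn)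
      (hj : IsGreatest {y | y < j₁ ∧ D₁ i₁ y = .rturn} j₂)
      (hE : Loop k D₁ i₁ j₂ E) : Loop k D i j E
  /-- It ends in a bump of two pipes that have already crossed: cross-bump-swap. -/
  | swap {D E D₁ : Grid} {i j i₁ j₁ x y : ℕ} (hm : IsMinDroop D i j i₁ j₁)
      (hD : D₁ = droop D i j i₁ j₁) (ht : D₁ i₁ j₁ = .bump)
      (hc : CrossAt D₁ i₁ j₁ x y)
      (hE : Loop k (setTile (setTile D₁ i₁ j₁ .cross) x y .bump) x y E) : Loop k D i j E
  /-- It ends in a bump of two pipes that have not crossed, and the pipe of the `rturn` exits from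
  a row `r ≤ k`: continue with this pipe. -/
  | bump {D E D₁ : Grid} {i j i₁ j₁ r : ℕ} (hm : IsMinDroop D i j i₁ j₁)
      (hD : D₁ = droop D i j i₁ j₁) (ht : D₁ i₁ j₁ = .bump)
      (hc : ¬ ∃ x y, CrossAt D₁ i₁ j₁ x y)
      (hr : ExitsRow D₁ (i₁, j₁, .bottom) r) (hk : r ≤ k)
      (hE : Loop k D₁ i₁ j₁ E) : Loop k D i j E
  /-- As before, but `r > k`: replace the bump by a crossing and terminate. -/
  | terminate {D D₁ : Grid} {i j i₁ j₁ r : ℕ} (hm : IsMinDroop D i j i₁ j₁)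
      (hD : D₁ = droop D i j i₁ j₁) (ht : D₁ i₁ j₁ = .bump)
      (hc : ¬ ∃ x y, CrossAt D₁ i₁ j₁ x y)
      (hr : ExitsRow D₁ (i₁, j₁, .bottom) r) (hk : k < r) :
      Loop k D i j (setTile D₁ i₁ j₁ .cross)

/-- `E = (D ← (b, k))`, the right insertion of the biletter `(b, k)` into `D`: it starts at the
rightmost `rturn` of row `b`. -/
def RightInsert (D : Grid) (b k : ℕ) (E : Grid) : Prop :=
  ∃ j, IsGreatest {y | D b y = .rturn} j ∧ Loop k D b j E

/-- Insert the biletters of a biword, from left to right. -/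
def InsertWord : Grid → List (ℕ × ℕ) → Grid → Prop
  | D, [], E => E = D
  | D, (b, k) :: w, E => ∃ D', RightInsert D b k D' ∧ InsertWord D' w E

/-- Biwords are lists of biletters `(a, k)`. A plactic biword has `1 ≤ a ≤ k` for each biletter,
and the `k`'s are weakly decreasing. -/
def IsPlactic (Q : List (ℕ × ℕ)) : Prop :=
  (∀ p ∈ Q, 1 ≤ p.1 ∧ p.1 ≤ p.2) ∧ Q.Pairwise fun p q => q.2 ≤ p.2

/-- The biword `w(i, j)`: the first `j` biletters of `Q`, without those whose top entry is `≤ i`. -/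
def subword (Q : List (ℕ × ℕ)) (i j : ℕ) : List (ℕ × ℕ) :=
  (Q.take j).filter fun p => i < p.1

/-- `π` is the growth diagram of `Q`: `π i j` is the permutation of the bumpless pipe dream
obtained by inserting `w(i, j)`. (The indices are not bounded from above here: `w(i, j)` is empty
when `i` is at least the maximal letter, and `w(i, j) = w(i, ℓ)` when `j` is at least the length
`ℓ` of `Q`.) -/
def IsGrowthDiagram (Q : List (ℕ × ℕ)) (π : ℕ → ℕ → Equiv.Perm ℕ) : Prop :=
  ∀ i j, ∃ D, InsertWord idGrid (subword Q i j) D ∧ IsBPD D (π i j)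

/-- For `I = {i₁ < ⋯ < i_c}`, the product `s_{i_c} ⋯ s_{i₁}` of simple transpositions. -/
def simpleProd (I : Finset ℕ) : Equiv.Perm ℕ :=
  ((I.sort (· ≥ ·)).map fun m => Equiv.swap m (m + 1)).prod

/-- For an infinite set `A = {j₀ < j₁ < ⋯}`: `ρ = t_{j_ℓ, j_{ℓ+1}} μ`, where `ℓ` is the smallest
index such that `μ⁻¹(j_ℓ) ≤ k < μ⁻¹(j_{ℓ+1})` (in particular there is such an `ℓ`). -/
def FirstSwap (A : Set ℕ) (k : ℕ) (μ ρ : Equiv.Perm ℕ) : Prop :=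
  ∃ l, IsLeast {l | μ.symm (Nat.nth (· ∈ A) l) ≤ k ∧ k < μ.symm (Nat.nth (· ∈ A) (l + 1))} l ∧
    ρ = Equiv.swap (Nat.nth (· ∈ A) l) (Nat.nth (· ∈ A) (l + 1)) * μ

/-- The set `(Iᶜ ∩ [β, ∞)) ∪ {x}` with `x = min (Iᶜ ∩ [α, β))`; if `Iᶜ ∩ [α, β)` is empty there is
no `x`, and the set is `Iᶜ ∩ [β, ∞)`. -/
def ruleSet (I : Finset ℕ) (α β : ℕ) : Set ℕ :=
  {m | m ∉ I ∧ β ≤ m} ∪ {x | IsLeast {m | m ∉ I ∧ α ≤ m ∧ m < β} x}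

end PlacticGrowth

namespace PlacticGrowth

/-! Label each edge of a bumpless pipe dream by the exit row of its pipe, with `0` for no pipe. The
pipe dream becomes a sequence of words, one on each horizontal line, and reducedness becomes local:
in every crossing the larger label runs horizontally. Far down, the word is the inverse permutation.
Because the subscripts decrease weakly, pipes with labels `≤ k` never cross when a biletter with
subscript `k` is inserted (`LPD.Inc`).

Under this invariant the insertion of `(b, k)` exchanges two entries in each word from row `b` on
(`Hop`): a label `≤ k` with the hole to its right while that pipe is being drooped, or with a label
`> k` farther right while the two pipes are merely renamed. `Hop.next` shows that such an exchange
passes through every row, and `InsPath.rightInsert_iff` that the algorithm computes exactly the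
result. Successive droops that move the hop into a hole take place in strictly lower rows, and below
some row no holes are left to droop into; hence termination. At the bottom the exchange multiplies
the permutation by a transposition of values `c < d` whose positions are separated by `k`.

Next, compare the words that keep the letters `> i` with those that also keep the letters `i`.
Inserting `i` into a pipe dream whose word in row `i` is still `1 … i` exchanges two adjacent
columns in every word below (`InsPath.coupling`). Two pipe dreams that are coupled in this way
remain coupled when the same biletter is inserted into both (`Coupling.insert`); this is the
combinatorial heart. So the lower pipe dream arises from the upper one by a chain of couplings, one
for each letter `i`, whose columns increase along the chain (`Coupling.lt`). At the bottom this
reads `μ = s_{i_c} ⋯ s_{i_1} π`.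

Finally, `HopsRel` says how the last transposition changes across one coupling. Composing these
elementary rules along the chain gives the first swap in `ruleSet I α β` for a letter `> i`
(`RuleState.step`) and in the complement of `I` for a letter `i` (`IsFirst.step`). As `I` is
determined by `simpleProd I`, and `α`, `β` by their transposition, the rule holds for any admissible
choice of them. -/

/-! ### Labelled rows and exchanges in words -/

/-- The labels on the top, right, bottom and left edge of a tile, if every edge carries the label of
its pipe (and `0` if there is no pipe), and if in a crossing the pipe with the larger label runs
from left to right. -/
def TileOK (t b v l : ℕ) : Prop :=
  (v = t ∧ l = b ∧ (t = 0 ∨ b = 0 ∨ t < b)) ∨ (t = 0 ∧ b ≠ 0 ∧ v = b ∧ l = 0) ∨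
    (t ≠ 0 ∧ b = 0 ∧ v = 0 ∧ l = t)

/-- The labels on the horizontal edges between two rows. -/
structure IsWord (n : ℕ) (u : ℕ → ℕ) : Prop where
  zero : u 0 = 0
  le : ∀ c, u c ≤ n
  inj : ∀ c d, u c = u d → u c ≠ 0 → c = d

/-- The row `x` of a labelled pipe dream, with labels `u` at the top, `v` at the bottom, and
`h c` on the right edge of the tile in column `c`. -/
structure IsRow (x : ℕ) (u v h : ℕ → ℕ) : Prop where
  zero : h 0 = 0
  tile : ∀ c, TileOK (u (c + 1)) (h (c + 1)) (v (c + 1)) (h c)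
  far : ∃ N, ∀ c, N ≤ c → h c = x

/-- The labels `≤ k` occur in increasing order. -/
def SmallInc (k : ℕ) (u : ℕ → ℕ) : Prop :=
  ∀ c d, c < d → u c ≠ 0 → u d ≠ 0 → u c ≤ k → u d ≤ k → u c < u d

/-- The label `≤ k` in column `a` can be exchanged with what is in column `b`. -/
structure Hop (k : ℕ) (u : ℕ → ℕ) (a b : ℕ) : Prop where
  lt : a < b
  pos : u a ≠ 0
  small : u a ≤ k
  big : (u b = 0 ∧ b = a + 1) ∨ (k < u b ∧ ∀ c, a < c → c < b → u c = 0 ∨ u b < u c)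

/-- Exchange two entries of a word. -/
def swp (u : ℕ → ℕ) (a b : ℕ) : ℕ → ℕ :=
  fun c => if c = a then u b else if c = b then u a else u c

/-- Change one entry of a word. -/
def upd (h : ℕ → ℕ) (a q : ℕ) : ℕ → ℕ := fun c => if c = a then q else h c

section rows
variable {x k : ℕ} {u v h : ℕ → ℕ}

/-- Followed to the left, the pipe cannot come from the border, so it enters the row through an
`rturn`; its column is `d + 1`. -/
theorem IsRow.carry_left (hr : IsRow x u v h) {c q : ℕ} (hc : h c = q) (hq : q ≠ 0) :
    ∃ d, d + 1 ≤ c ∧ v (d + 1) = q ∧ u (d + 1) = 0 ∧ h d = 0 ∧ ∀ e, d < e → e ≤ c → h e = q := by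
  induction c with
  | zero => exact absurd (hc.symm.trans hr.zero) hq
  | succ c ih =>
    have ht := hr.tile c
    by_cases h0 : h c = q
    · obtain ⟨d, h1, h2, h3, h4, h5⟩ := ih h0
      refine ⟨d, by omega, h2, h3, h4, fun e he he' => ?_⟩
      rcases Nat.lt_or_ge c e with h6 | h6
      · rw [show e = c + 1 by omega]; exact hc
      · exact h5 e he h6
    · unfold TileOK at ht
      refine ⟨c, le_rfl, by omega, by omega, by omega, fun e he he' => ?_⟩
      rw [show e = c + 1 by omega]; exact hc

/-- Followed to the right, the pipe either leaves the row through a `jturn` in column `d` or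
survives to the region where every right edge has the label `x`. -/
theorem IsRow.carry_right (hr : IsRow x u v h) {c q : ℕ} (hc : h c = q) (hq : q ≠ 0) :
    (q = x ∧ ∀ e, c ≤ e → h e = q) ∨
      ∃ d, c < d ∧ u d = q ∧ v d = 0 ∧ h d = 0 ∧ ∀ e, c ≤ e → e < d → h e = q := by
  obtain ⟨N, hN⟩ := hr.far
  have key : ∀ n, (∀ e, c ≤ e → e ≤ c + n → h e = q) ∨
      ∃ d, c < d ∧ u d = q ∧ v d = 0 ∧ h d = 0 ∧ ∀ e, c ≤ e → e < d → h e = q := by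
    intro n
    induction n with
    | zero => left; intro e h1 h2; rw [show e = c by omega]; exact hc
    | succ n ih =>
      rcases ih with ih | ih
      · have ht := hr.tile (c + n)
        have h1 := ih (c + n) (by omega) le_rfl
        by_cases h2 : h (c + n + 1) = q
        · left; intro e h3 h4
          rcases Nat.lt_or_ge (c + n) e with h6 | h6
          · rw [show e = c + n + 1 by omega]; exact h2
          · exact ih e h3 h6
        · right
          unfold TileOK at ht
          exact ⟨c + n + 1, by omega, by omega, by omega, by omega,
            fun e h3 h4 => ih e h3 (by omega)⟩
      · exact Or.inr ih
  rcases key N with h1 | h1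
  · left
    have hx : q = x := by rw [← h1 (c + N) (by omega) le_rfl]; exact hN _ (by omega)
    refine ⟨hx, fun e he => ?_⟩
    rcases Nat.lt_or_ge (c + N) e with h6 | h6
    · rw [hx]; exact hN _ (by omega)
    · exact h1 e he h6
  · exact Or.inr h1

theorem IsRow.pass (hr : IsRow x u v h) {c : ℕ} (h1 : h c ≠ 0) (h2 : h (c + 1) ≠ 0) :
    u (c + 1) = v (c + 1) ∧ h c = h (c + 1) ∧ (u (c + 1) = 0 ∨ u (c + 1) < h c) := by
  have ht := hr.tile c
  unfold TileOK at ht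
  omega

/-- A label of the upper word moves to the left. -/
theorem IsRow.move (hr : IsRow x u v h) (hu : u 0 = 0) {c q : ℕ} (hc : u c = q) (hq : q ≠ 0) :
    (v c = q ∧ h c = h (c - 1)) ∨ ∃ d, d < c ∧ v d = q ∧ u d = 0 ∧ v c = 0 ∧ h c = 0 ∧ d ≠ 0 ∧
      h (d - 1) = 0 ∧ ∀ e, d ≤ e → e < c → h e = q := by
  obtain _ | c := c
  · omega
  have ht := hr.tile c
  have hs : c + 1 - 1 = c := rfl
  by_cases h1 : v (c + 1) = q
  · left; rw [hs]; unfold TileOK at ht; omega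
  · right
    have h2 : h c = q ∧ v (c + 1) = 0 ∧ h (c + 1) = 0 := by unfold TileOK at ht; omega
    obtain ⟨d, h3, h4, h5, h6, h7⟩ := hr.carry_left h2.1 hq
    exact ⟨d + 1, by omega, h4, h5, h2.2.1, h2.2.2, by omega, h6,
      fun e h8 h9 => h7 e (by omega) (by omega)⟩

theorem IsRow.move_to (hr : IsRow x u v h) (hu : u 0 = 0) (hv : IsWord x v) {c d q : ℕ}
    (hc : u c = q) (hd : v d = q) (hq : q ≠ 0) :
    (d = c ∧ h c = h (c - 1)) ∨ (d < c ∧ u d = 0 ∧ v c = 0 ∧ h c = 0 ∧ d ≠ 0 ∧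
      h (d - 1) = 0 ∧ ∀ e, d ≤ e → e < c → h e = q) := by
  rcases hr.move hu hc hq with h1 | ⟨d', h1, h2, h3⟩
  · left; exact ⟨hv.inj _ _ (hd.trans h1.1.symm) (by omega), h1.2⟩
  · right
    have : d = d' := hv.inj _ _ (hd.trans h2.symm) (by omega)
    subst this
    exact ⟨h1, h3⟩

theorem IsRow.move_le (hr : IsRow x u v h) (hu : u 0 = 0) (hv : IsWord x v) {c d q : ℕ}
    (hc : u c = q) (hd : v d = q) (hq : q ≠ 0) : d ≤ c := by
  rcases hr.move_to hu hv hc hd hq with h1 | h1 <;> omega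

/-- A label of the lower word comes from the upper word, or it is the new one. -/
theorem IsRow.origin (hr : IsRow x u v h) (hv : v 0 = 0) {d q : ℕ} (hd : v d = q) (hq : q ≠ 0) :
    (∃ c, d ≤ c ∧ u c = q) ∨ (q = x ∧ u d = 0 ∧ ∀ e, d ≤ e → h e = q) := by
  obtain _ | d := d
  · omega
  have ht := hr.tile d
  by_cases h1 : u (d + 1) = q
  · exact Or.inl ⟨d + 1, le_rfl, h1⟩
  · have h2 : u (d + 1) = 0 ∧ h (d + 1) = q := by unfold TileOK at ht; omega
    rcases hr.carry_right h2.2 hq with h3 | ⟨c, h3, h4, _⟩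
    · exact Or.inr ⟨h3.1, h2.1, h3.2⟩
    · exact Or.inl ⟨c, by omega, h4⟩

/-- Small pipes that run to the right cross no other pipe. -/
theorem IsRow.small_pass (hr : IsRow x u v h) (hs : SmallInc k v) {c : ℕ} (h0 : h c ≠ 0)
    (h1 : h (c + 1) ≠ 0) (hk : h c ≤ k) : u (c + 1) = 0 ∧ v (c + 1) = 0 := by
  have hp := hr.pass h0 h1
  obtain ⟨d, h3, h4, _⟩ := hr.carry_left rfl h0
  by_contra h5
  have := hs (d + 1) (c + 1) (by omega) (by omega) (by omega) (by omega) (by omega)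
  omega

/-- Pipes that have crossed do not cross again. -/
theorem IsRow.order_mono (hr : IsRow x u v h) (hu : u 0 = 0) (hv : IsWord x v) {b t cb ct db dt : ℕ}
    (h1 : u cb = b) (h2 : u ct = t) (h3 : v db = b) (h4 : v dt = t) (ht : t ≠ 0) (htb : t < b)
    (hlt : cb < ct) : db < dt := by
  have hb := hr.move_le hu hv h1 h3 (by omega)
  rcases hr.move_to hu hv h2 h4 ht with h5 | h5
  · omega
  by_contra h6
  have h7 : db ≠ dt := by rintro rfl; omega
  obtain _ | cb := cb
  · omega
  have h8 := h5.2.2.2.2.2.2 cb (by omega) (by omega)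
  have h9 := h5.2.2.2.2.2.2 (cb + 1) (by omega) (by omega)
  have := hr.pass (c := cb) (by omega) (by omega)
  omega

theorem swp_left (u : ℕ → ℕ) (a b : ℕ) : swp u a b a = u b := by simp [swp]
theorem swp_right (u : ℕ → ℕ) (a b : ℕ) : swp u a b b = u a := by
  unfold swp; split_ifs with e <;> simp_all
theorem swp_of_ne (u : ℕ → ℕ) {a b c : ℕ} (h1 : c ≠ a) (h2 : c ≠ b) : swp u a b c = u c := by
  simp [swp, h1, h2]

theorem IsWord.exchange (hu : IsWord x u) {a b : ℕ} (ha : a ≠ 0) (hb : b ≠ 0) :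
    IsWord x (swp u a b) where
  zero := by rw [swp_of_ne _ ha.symm hb.symm]; exact hu.zero
  le c := by unfold swp; split_ifs <;> exact hu.le _
  inj c d h1 h2 := by
    unfold swp at h1 h2
    split_ifs at h1 h2 <;> have := hu.inj _ _ h1 h2 <;> omega

theorem Hop.pos_left {a b : ℕ} (hh : Hop k u a b) (hu : u 0 = 0) : a ≠ 0 := by
  rintro rfl; exact hh.pos hu

theorem Hop.mid {a b : ℕ} (hh : Hop k u a b) {c : ℕ} (h1 : a < c) (h2 : c < b) :
    u c = 0 ∨ (k < u c ∧ u b < u c) := by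
  rcases hh.big with h | ⟨h3, h⟩
  · omega
  · rcases h c h1 h2 with h | h <;> omega

/-- The small label that moves passes only holes and labels `> k`, so it overtakes no other small
label. -/
theorem SmallInc.exchange (hs : SmallInc k u) {a b : ℕ} (hh : Hop k u a b) :
    SmallInc k (swp u a b) := by
  have hb : u b = 0 ∨ k < u b := by rcases hh.big with h | h <;> omega
  have hab := hh.lt
  have hp := hh.pos
  have hsm := hh.small
  intro c d hcd h1 h2 h3 h4
  unfold swp at *
  split_ifs at * with e1 e2 e3 e4 e5 e6 e7 e8 <;> try omega
  · exact hs _ _ (by omega) h1 h2 h3 h4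
  · rcases Nat.lt_or_ge c a with h5 | h5
    · exact hs _ _ h5 h1 h2 h3 h4
    · have := hh.mid (c := c) (by omega) (by omega)
      omega
  · exact hs _ _ hcd h1 h2 h3 h4

end rows

/-! ### Passing an exchange through one row -/

/-- How an insertion passes through a row: if the labels at `a`, `b` are exchanged at the top of the
row, then those at `c`, `d` are exchanged at its bottom, and `h'` are the new labels of the vertical
edges. -/
inductive RowHop (k : ℕ) (u v h : ℕ → ℕ) : ℕ → ℕ → ℕ → ℕ → (ℕ → ℕ) → Prop
  | straight {a : ℕ} (hb : u (a + 1) = 0) (hq : v (a + 1) = 0) (hv : v a = u a) :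
      RowHop k u v h a (a + 1) a (a + 1) h
  | turn {a c : ℕ} (hb : u (a + 1) = 0) (hq : v (a + 1) = 0) (hv : v c = u a) (hc : c < a) :
      RowHop k u v h a (a + 1) c (c + 1) (upd (upd h a (u a)) c 0)
  | bumpSmall {a : ℕ} (hb : u (a + 1) = 0) (hq : v (a + 1) ≠ 0) (hk : v (a + 1) ≤ k) :
      RowHop k u v h a (a + 1) (a + 1) (a + 2) (upd (upd h a (u a)) (a + 1) 0)
  | bumpLarge {a c : ℕ} (hb : u (a + 1) = 0) (hk : k < v (a + 1)) (hv : v c = u a) :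
      RowHop k u v h a (a + 1) c (a + 1) (fun e => if c ≤ e ∧ e ≤ a then v (a + 1) else h e)
  | keep {a b c d : ℕ} (hb : u b ≠ 0) (hc : v c = u a) (hd : v d = u b) (hcd : c < d) :
      RowHop k u v h a b c d
        (fun e => if h e = u a then u b else if h e = u b then u a else h e)
  | cross {a b e : ℕ} (hb : u b ≠ 0) (he : v e = u b) (hea : e < a) (hv : v a = u a)
      (hq : v (a + 1) = 0) :
      RowHop k u v h a b a (a + 1) (fun e => if e = a then 0 else if a < e ∧ e < b then u a else h e)

section
variable {x k : ℕ} {u v h : ℕ → ℕ}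

/-- A small pipe that runs to the right runs through empty columns. -/
theorem IsRow.small_carry (hr : IsRow x u v h) (hs : SmallInc k v) {c d q : ℕ} (hq : q ≠ 0)
    (hk : q ≤ k) (hh : ∀ e, c ≤ e → e < d → h e = q) {e : ℕ} (h1 : c < e) (h2 : e < d) :
    u e = 0 ∧ v e = 0 := by
  obtain _ | e := e
  · omega
  have h3 := hh e (by omega) (by omega)
  have h4 := hh (e + 1) (by omega) (by omega)
  exact hr.small_pass hs (by omega) (by omega) (by omega)

/-- Every hop at the top of a row continues to its bottom. -/
theorem Hop.next (hr : IsRow x u v h) (hu : IsWord (x - 1) u) (hv : IsWord x v)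
    (hs : SmallInc k v) {a b : ℕ} (hh : Hop k u a b) :
    ∃ c d h', RowHop k u v h a b c d h' ∧ Hop k v c d := by
  have ha0 := hh.pos_left hu.zero
  have hpos := hh.pos
  have hsm := hh.small
  have hlt := hh.lt
  -- With a hole on the right the pipe is being drooped, and the tile at the bottom of column `a +
  -- 1` decides what happens: nothing there (go on straight, or turn left along the pipe), a small
  -- label (continue with that pipe), or a large one (a crossing is created).
  rcases hh.big with ⟨hb, rfl⟩ | ⟨hkb, hbt⟩
  · have ht := hr.tile a
    by_cases hq : v (a + 1) = 0
    · rcases hr.move hu.zero rfl hpos with h1 | ⟨c, h1, h2, h3, h4, h5, h6, h7, h8⟩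
      · exact ⟨_, _, _, .straight hb hq h1.1, ⟨by omega, by omega, by omega, .inl ⟨hq, rfl⟩⟩⟩
      · refine ⟨_, _, _, .turn hb hq h2 h1, ⟨by omega, by omega, by omega, .inl ⟨?_, rfl⟩⟩⟩
        rcases Nat.lt_or_ge (c + 1) a with h9 | h9
        · exact (hr.small_carry hs hpos hsm h8 (by omega) h9).2
        · rw [show c + 1 = a by omega]; exact h4
    · by_cases hk : v (a + 1) ≤ k
      · refine ⟨_, _, _, .bumpSmall hb hq hk, ⟨by omega, hq, hk, .inl ⟨?_, rfl⟩⟩⟩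
        have ht' := hr.tile (a + 1)
        have h1 : h (a + 1) = v (a + 1) := by unfold TileOK at ht; omega
        by_cases h2 : h (a + 2) = 0
        · unfold TileOK at ht'; simp only [add_assoc] at ht'; norm_num at ht'; omega
        · exact (hr.small_pass hs (c := a + 1) (by omega) h2 (by omega)).2
      · obtain ⟨c, hc⟩ : ∃ c, c ≤ a ∧ v c = u a ∧ ∀ e, c ≤ e → e < a → h e = u a := by
          rcases hr.move hu.zero rfl hpos with h1 | ⟨c, h1, h2, h3, h4, h5, h6, h7, h8⟩
          · exact ⟨a, le_rfl, h1.1, fun e h2 h3 => by omega⟩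
          · exact ⟨c, h1.le, h2, h8⟩
        refine ⟨_, _, _, .bumpLarge hb (by omega) hc.2.1,
          ⟨by omega, by omega, by omega, .inr ⟨by omega, fun e h1 h2 => .inl ?_⟩⟩⟩
        rcases Nat.lt_or_ge e a with h3 | h3
        · exact (hr.small_carry hs hpos hsm hc.2.2 h1 h3).2
        · rcases hr.move_to hu.zero hv rfl hc.2.1 hpos with h4 | h4
          · omega
          · rw [show e = a by omega]; exact h4.2.2.1
  · obtain ⟨c, hca, hc⟩ : ∃ c, c ≤ a ∧ v c = u a := by
      rcases hr.move hu.zero rfl hpos with h1 | ⟨c, h1, h2, _⟩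
      exacts [⟨a, le_rfl, h1.1⟩, ⟨c, h1.le, h2⟩]
    obtain ⟨d, hdb, hd⟩ : ∃ d, d ≤ b ∧ v d = u b := by
      rcases hr.move hu.zero (c := b) rfl (by omega) with h1 | ⟨c, h1, h2, _⟩
      exacts [⟨b, le_rfl, h1.1⟩, ⟨c, h1.le, h2⟩]
    have hcm := hr.move_to hu.zero hv rfl hc hpos
    have hdm := hr.move_to hu.zero hv rfl hd (by omega)
    -- The two renamed pipes keep their order, or they cross in this row. In the second case the
    -- crossing is the one that cross-bump-swap removes, and a new droop starts there.
    rcases lt_trichotomy c d with hcd | rfl | hcd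
    · refine ⟨_, _, _, .keep (by omega) hc hd hcd, ⟨hcd, by omega, by omega, .inr ⟨by omega, ?_⟩⟩⟩
      intro e h1 h2
      by_contra h3
      have he : v e ≠ 0 := by omega
      have hle : v e ≠ u b := fun h4 => by
        have := hv.inj _ _ (h4.trans hd.symm) he; omega
      -- An offending entry between the new columns is traced back to the upper word. To the left of
      -- `a` or to the right of `b` its pipe or one of the two renamed ones would have to pass
      -- through a tile in an impossible way; between `a` and `b` the condition of the hop applies.
      rcases hr.origin hv.zero rfl he with ⟨e', h4, h5⟩ | h4
      · have hne1 : e' ≠ a := by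
          rintro rfl; have := hv.inj _ _ (h5.symm.trans hc.symm) he; omega
        have hne2 : e' ≠ b := by
          rintro rfl; omega
        have hem := hr.move_to hu.zero hv h5 rfl he
        rcases Nat.lt_or_ge e' a with h6 | h6
        · rcases Nat.lt_or_ge e' e with h7 | h7
          · omega
          · have h8 : c < a := by omega
            have h9 := hr.small_carry hs hpos hsm (c := c) (d := a) (by
              intro e1 h10 h11; exact (hcm.resolve_left (by omega)).2.2.2.2.2.2 e1 h10 h11) h1
              (by omega)
            omega
        · rcases Nat.lt_or_ge e' b with h7 | h7
          · have := hbt e' (by omega) h7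
            omega
          · have h8 := (hem.resolve_left (by omega)).2.2.2.2.2.2
            obtain _ | b := b
            · omega
            have h9 := h8 b (by omega) (by omega)
            have h10 := h8 (b + 1) (by omega) (by omega)
            have h11 := hr.pass (c := b) (by omega) (by omega)
            omega
      -- The pipe that exits in this very row has the label `x`, which exceeds all labels of the
      -- upper word.
      · have := hu.le b
        omega
    · have := hu.inj _ _ (hc.symm.trans hd) (by omega)
      omega
    · have h1 := (hdm.resolve_left (by omega)).2.2.2.2.2.2
      -- The pipe of `u b` runs horizontally through column `c`, so the small pipe cannot turn
      -- there.
      have hca' : c = a := by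
        by_contra h2
        have h3 := (hcm.resolve_left (by omega))
        obtain _ | c := c
        · omega
        have h4 := h1 c (by omega) (by omega)
        have h5 := h1 (c + 1) (by omega) (by omega)
        have h6 := hr.pass (c := c) (by omega) (by omega)
        omega
      subst hca'
      have h2 : v (c + 1) = 0 := by
        rcases Nat.lt_or_ge (c + 1) b with h3 | h3
        · have h4 := h1 c (by omega) (by omega)
          have h5 := h1 (c + 1) (by omega) (by omega)
          have h6 := hr.pass (c := c) (by omega) (by omega)
          have h7 := hbt (c + 1) (by omega) (by omega)
          omega
        · have h4 : c + 1 = b := by omega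
          rw [h4]; omega
      exact ⟨_, _, _, .cross (by omega) hd (by omega) hc h2,
        ⟨by omega, by omega, by omega, .inl ⟨h2, rfl⟩⟩⟩

end

section
variable {x k : ℕ} {u v h : ℕ → ℕ}

/-- Labels are distinct, so exchanging two columns is exchanging two values. In this form it can be
matched with the renaming of the labels `h`. -/
theorem IsWord.swp_eq (hu : IsWord x u) {a b : ℕ} (ha : u a ≠ 0) (hb : u b ≠ 0) (e : ℕ) :
    swp u a b e = if u e = u a then u b else if u e = u b then u a else u e := by
  unfold swp
  by_cases h1 : e = a
  · subst h1; simp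
  by_cases h2 : e = b
  · subst h2; simp [h1]; intro h; exact h.symm
  have h3 : u e ≠ u a := fun h => h1 (hu.inj _ _ h (by omega))
  have h4 : u e ≠ u b := fun h => h2 (hu.inj _ _ h (by omega))
  simp [h1, h2, h3, h4]

theorem RowHop.isRow_keep (hr : IsRow x u v h) (hu : IsWord (x - 1) u) (hv : IsWord x v)
    (hs : SmallInc k v) {a b c d : ℕ} (hh : Hop k u a b) (hb : u b ≠ 0) (hc : v c = u a)
    (hd : v d = u b) (hcd : c < d) :
    IsRow x (swp u a b) (swp v c d)
      (fun e => if h e = u a then u b else if h e = u b then u a else h e) := by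
  have hpos := hh.pos
  have hsm := hh.small
  have hbig : k < u b ∧ ∀ c, a < c → c < b → u c = 0 ∨ u b < u c := by
    rcases hh.big with h1 | h1
    · omega
    · exact h1
  have hla := hu.le a
  have hlb := hu.le b
  have hcm := hr.move_to hu.zero hv rfl hc hpos
  have hdm := hr.move_to hu.zero hv rfl hd hb
  refine ⟨?_, fun e => ?_, ?_⟩
  · simp only [hr.zero]; rw [if_neg (by omega), if_neg (by omega)]
  · rw [hu.swp_eq hpos hb, hv.swp_eq (by omega) (by omega), hc, hd]
    have ht := hr.tile e
    -- Renaming can only spoil the order in a crossing: when the vertical label `u a` becomes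
    -- larger, or when the horizontal label `u b` becomes smaller. A horizontal `u a` meets no
    -- crossing at all.
    have key : u (e + 1) ≠ 0 → h e ≠ 0 → h (e + 1) ≠ 0 →
        h e ≠ u a ∧ (u (e + 1) = u a → u b < h e) ∧ (h e = u b → u (e + 1) < u a) := by
      intro h1 h2 h3
      have hp := hr.pass h2 h3
      refine ⟨fun h4 => ?_, fun h4 => ?_, fun h4 => ?_⟩
      · have := hr.small_pass hs h2 h3 (by omega)
        omega
      · have hea : e + 1 = a := hu.inj _ _ h4 h1
        subst hea
        rcases hr.carry_right rfl h3 with h5 | ⟨e', h5, h6, h7, h8, h9⟩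
        · omega
        rcases lt_trichotomy e' b with h10 | h10 | h10
        · have := hbig.2 e' h5 h10
          omega
        · obtain ⟨d', h10', h11, _⟩ := hr.carry_left rfl h2
          have h12 : d = d' + 1 := hv.inj _ _ (by rw [hd, h11, hp.2.1, ← h10, h6]) (by omega)
          have h13 : c = e + 1 := hv.inj _ _ (by omega) (by omega)
          omega
        · obtain _ | b := b
          · have := hh.lt
            omega
          have h11 := h9 b (by have := hh.lt; omega) (by omega)
          have h12 := h9 (b + 1) (by have := hh.lt; omega) h10
          have := hr.pass (c := b) (by omega) (by omega)
          omega
      · rw [h4] at hp h2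
        have h5 := hr.carry_right (c := e + 1) (q := u b) (by omega) hb
        rcases h5 with h5 | ⟨e', h5, h6, h7, h8, h9⟩
        · omega
        have : e' = b := hu.inj _ _ h6 (by omega)
        subst this
        obtain ⟨d', h10, h11, h12, h13, h14⟩ := hr.carry_left h4 hb
        have : d = d' + 1 := hv.inj _ _ (hd.trans h11.symm) (by omega)
        subst this
        rcases lt_trichotomy (e + 1) a with h15 | h15 | h15
        · have h16 := (hcm.resolve_left (by omega)).2.2.2.2.2.2
          have := hr.small_carry hs hpos hsm h16 (e := e + 1) (by omega) h15
          omega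
        · subst h15
          have := hcm
          omega
        · have := hbig.2 (e + 1) h15 h5
          omega
    unfold TileOK at ht ⊢
    rcases ht with ⟨h1, h2, h3⟩ | ⟨h1, h2, h3, h4⟩ | ⟨h1, h2, h3, h4⟩
    · left
      rw [h1, h2]
      rw [h2] at key
      refine ⟨rfl, rfl, ?_⟩
      by_cases h4 : u (e + 1) = 0
      · left; rw [h4, if_neg (by omega), if_neg (by omega)]
      by_cases h5 : h (e + 1) = 0
      · right; left; rw [h5, if_neg (by omega), if_neg (by omega)]
      have := key h4 h5 h5
      split_ifs <;> omega
    · right; left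
      rw [h1, h3, h4, if_neg (by omega : ¬ 0 = u a), if_neg (by omega : ¬ 0 = u b)]
      refine ⟨rfl, ?_, rfl, rfl⟩
      split_ifs <;> omega
    · right; right
      rw [h2, h3, h4, if_neg (by omega : ¬ 0 = u a), if_neg (by omega : ¬ 0 = u b)]
      refine ⟨?_, rfl, rfl, rfl⟩
      split_ifs <;> omega
  · obtain ⟨N, hN⟩ := hr.far
    refine ⟨N, fun e he => ?_⟩
    have := hN e he
    simp only [this]
    rw [if_neg (by omega), if_neg (by omega)]

theorem RowHop.isRow_straight (hr : IsRow x u v h) (hu : IsWord (x - 1) u)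
    {a : ℕ} (hh : Hop k u a (a + 1)) (hb : u (a + 1) = 0) (hq : v (a + 1) = 0)
    (hvv : v a = u a) :
    IsRow x (swp u a (a + 1)) (swp v a (a + 1)) h := by
  have ha0 := hh.pos_left hu.zero
  have hpos := hh.pos
  have hsm := hh.small
  have hlt := hh.lt
  obtain ⟨N, hN⟩ := hr.far
  have hz := hr.zero
  obtain _ | a := a
  · omega
  refine ⟨hr.zero, fun e => ?_, hr.far⟩
  have ht := hr.tile e
  have ht1 := hr.tile a
  have ht2 := hr.tile (a + 1)
  rcases (by omega : e = a ∨ e = a + 1 ∨ (e ≠ a ∧ e ≠ a + 1)) with rfl | rfl | h1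
  all_goals
    unfold TileOK swp at *
    split_ifs <;> omega

theorem RowHop.isRow_turn (hr : IsRow x u v h) (hu : IsWord (x - 1) u) (hv : IsWord x v)
    (hs : SmallInc k v) {a c : ℕ} (hh : Hop k u a (a + 1)) (hb : u (a + 1) = 0) (hq : v (a + 1) = 0)
    (hvv : v c = u a) (hc : c < a) :
    IsRow x (swp u a (a + 1)) (swp v c (c + 1))
      (upd (upd h a (u a)) c 0) := by
  have ha0 := hh.pos_left hu.zero
  have hpos := hh.pos
  have hsm := hh.small
  have hlt := hh.lt
  obtain ⟨N, hN⟩ := hr.far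
  have hz := hr.zero
  obtain _ | a := a
  · omega
  have hm := (hr.move_to hu.zero hv rfl hvv hpos).resolve_left (by omega)
  obtain ⟨h1, h2, h3, h4, h5, h6, h7⟩ := hm
  obtain _ | c := c
  · omega
  simp only [Nat.add_sub_cancel] at h6
  have ht1 := hr.tile (a + 1)
  refine ⟨?_, fun e => ?_, max N (a + 2), fun e he => ?_⟩
  · simp [upd, hz]
  · have ht := hr.tile e
    by_cases hca : a = c + 1
    · subst hca
      have he4 := h7 (c + 1) (by omega) (by omega)
      rcases (by omega : e = c ∨ e = c + 1 ∨ e = c + 2 ∨ (e ≠ c ∧ e ≠ c + 1 ∧ e ≠ c + 2))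
        with rfl | rfl | rfl | h8
      all_goals
        simp (disch := omega) only [swp, upd, if_neg, if_true]
        unfold TileOK at *
        simp only [add_assoc, Nat.reduceAdd, and_true, true_and] at *
        omega
    · have he1 := h7 (c + 1) (by omega) (by omega)
      have he2 := h7 (c + 2) (by omega) (by omega)
      have he3 := hr.small_carry hs hpos hsm h7 (e := c + 2) (by omega) (by omega)
      have he4 := h7 a (by omega) (by omega)
      clear h7
      rcases (by omega : e = c ∨ e = c + 1 ∨ e = a ∨ e = a + 1 ∨
        (e ≠ c ∧ e ≠ c + 1 ∧ e ≠ a ∧ e ≠ a + 1)) with rfl | rfl | rfl | rfl | h8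
      all_goals
        simp (disch := omega) only [swp, upd, if_neg, if_true]
        unfold TileOK at *
        simp only [add_assoc, Nat.reduceAdd, and_true, true_and] at *
        omega
  · have := hN e (by omega)
    unfold upd
    rw [if_neg (by omega), if_neg (by omega), this]

theorem RowHop.isRow_bumpSmall (hr : IsRow x u v h) (hu : IsWord (x - 1) u)
    (hs : SmallInc k v) {a : ℕ} (hh : Hop k u a (a + 1)) (hb : u (a + 1) = 0) (hq : v (a + 1) ≠ 0)
    (hk : v (a + 1) ≤ k) :
    IsRow x (swp u a (a + 1)) (swp v (a + 1) (a + 2))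
      (upd (upd h a (u a)) (a + 1) 0) := by
  have ha0 := hh.pos_left hu.zero
  have hpos := hh.pos
  have hsm := hh.small
  have hlt := hh.lt
  obtain ⟨N, hN⟩ := hr.far
  have hz := hr.zero
  obtain _ | a := a
  · omega
  have ht1 := hr.tile a
  have ht2 := hr.tile (a + 1)
  have ht3 := hr.tile (a + 2)
  have hp3 := hr.small_pass hs (c := a + 2)
  refine ⟨?_, fun e => ?_, max N (a + 3), fun e he => ?_⟩
  · simp [upd, hz]
  · have ht := hr.tile e
    rcases (by omega : e = a ∨ e = a + 1 ∨ e = a + 2 ∨ (e ≠ a ∧ e ≠ a + 1 ∧ e ≠ a + 2))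
      with rfl | rfl | rfl | h8
    all_goals
      simp (disch := omega) only [swp, upd, if_neg, if_true]
      unfold TileOK at *
      try simp only [add_assoc, Nat.reduceAdd, and_true, true_and] at *
      omega
  · have := hN e (by omega)
    unfold upd
    rw [if_neg (by omega), if_neg (by omega), this]

/-- The label `v (a + 1)` takes over the way of the small pipe between the columns `c` and `a`,
while the small pipe goes straight up in column `a + 1`; the tile there becomes a crossing,
correctly ordered because the small label is `≤ k`. -/
theorem RowHop.isRow_bumpLarge (hr : IsRow x u v h) (hu : IsWord (x - 1) u) (hv : IsWord x v)
    (hs : SmallInc k v) {a c : ℕ} (hh : Hop k u a (a + 1)) (hb : u (a + 1) = 0) (hk : k < v (a + 1))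
    (hvv : v c = u a) :
    IsRow x (swp u a (a + 1)) (swp v c (a + 1))
      (fun e => if c ≤ e ∧ e ≤ a then v (a + 1) else h e) := by
  have ha0 := hh.pos_left hu.zero
  have hpos := hh.pos
  have hsm := hh.small
  have hlt := hh.lt
  obtain ⟨N, hN⟩ := hr.far
  have hz := hr.zero
  obtain _ | a := a
  · omega
  have hm := hr.move_to hu.zero hv rfl hvv hpos
  have ht1 := hr.tile a
  have ht2 := hr.tile (a + 1)
  have hc0 : c ≠ 0 := by rintro rfl; have := hv.zero; omega
  refine ⟨?_, fun e => ?_, max N (a + 2), fun e he => ?_⟩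
  · simp only [hz]; split_ifs <;> omega
  · obtain _ | c := c
    · omega
    have ht := hr.tile e
    have hsc : ∀ e, c + 1 < e → e < a + 1 → u e = 0 ∧ v e = 0 ∧ h e = u (a + 1) := by
      intro e h1 h2
      have h3 := (hm.resolve_left (by omega)).2.2.2.2.2.2
      have h4 := hr.small_carry hs hpos hsm h3 h1 h2
      exact ⟨h4.1, h4.2, h3 e (by omega) h2⟩
    have h8 := hsc (e + 1)
    rcases hm with ⟨h9, h10⟩ | ⟨h1, h2, h3, h4, h5, h6, h7⟩
    · have : c = a := by omega
      subst this
      have h10' : h (c + 1) = h c := h10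
      clear hsc h8
      rcases (by omega : e = c ∨ e = c + 1 ∨ (e ≠ c ∧ e ≠ c + 1)) with rfl | rfl | h8
      all_goals
        simp (disch := omega) only [swp, if_neg, if_true, if_pos]
        unfold TileOK at *
        omega
    · have h6' : h c = 0 := h6
      have h11 := h7 (c + 1) (by omega) (by omega)
      have h14 := h7 a (by omega) (by omega)
      rcases (by omega : e = a ∨ e = a + 1 ∨ e = c ∨ (c < e ∧ e < a) ∨ (e < c ∨ a + 1 < e))
        with rfl | rfl | rfl | h15 | h15
      on_goal 4 =>
        have h13 := h7 e (by omega) (by omega)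
        have h12 := hsc (e + 1) (by omega) (by omega)
      all_goals
        clear h8 h7 hsc
        simp (disch := omega) only [swp, if_neg, if_true, if_pos]
        unfold TileOK at *
        omega
  · have := hN e (by omega)
    rw [if_neg (by omega), this]

/-- In place of the crossing in column `a` the larger pipe turns up. The smaller pipe enters the row
in column `a + 1` and takes over the way of the larger one to column `b`. -/
theorem RowHop.isRow_cross (hr : IsRow x u v h) (hu : IsWord (x - 1) u) (hv : IsWord x v)
    {a b e₀ : ℕ} (hh : Hop k u a b) (hb : u b ≠ 0) (he : v e₀ = u b)
    (hea : e₀ < a) (hvv : v a = u a) (hq : v (a + 1) = 0) :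
    IsRow x (swp u a b) (swp v a (a + 1))
      (fun e => if e = a then 0 else if a < e ∧ e < b then u a else h e) := by
  have ha0 := hh.pos_left hu.zero
  have hpos := hh.pos
  have hsm := hh.small
  have hlt := hh.lt
  obtain ⟨N, hN⟩ := hr.far
  have hz := hr.zero
  obtain _ | a := a
  · omega
  have hbig : k < u b ∧ ∀ c, a + 1 < c → c < b → u c = 0 ∨ u b < u c := by
    rcases hh.big with h1 | h1
    · omega
    · exact h1
  obtain ⟨h1, h2, h3, h4, h5, h6, h7⟩ :=
    (hr.move_to hu.zero hv rfl he hb).resolve_left (by omega)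
  have hin : ∀ e, a + 1 < e → e < b → u e = 0 ∧ v e = 0 := by
    intro e h8 h9
    obtain _ | e := e
    · omega
    have h10 := hr.pass (c := e) (by rw [h7 e (by omega) (by omega)]; exact hb)
      (by rw [h7 (e + 1) (by omega) (by omega)]; exact hb)
    have h11 := hbig.2 (e + 1) h8 h9
    have h12 := h7 e (by omega) (by omega)
    omega
  refine ⟨?_, fun e => ?_, max N (b + 2), fun e he => ?_⟩
  · simp [hz]
  · have ht := hr.tile e
    have hi := hin (e + 1)
    have hl := h7 e
    have hl' := h7 (e + 1)
    obtain _ | b := b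
    · omega
    have hla := h7 a (by omega) (by omega)
    have hlb := h7 b (by omega) (by omega)
    have hea := h7 (a + 1) (by omega) (by omega)
    clear hbig hl hl'
    by_cases hba : b = a + 1
    · subst hba
      clear hi hin h7
      rcases (by omega : e = a ∨ e = a + 1 ∨ (e ≠ a ∧ e ≠ a + 1)) with rfl | rfl | h8
      all_goals
        simp (disch := omega) only [swp, if_neg, if_true]
        unfold TileOK at *
        simp only [add_assoc, Nat.reduceAdd, and_true, true_and] at *
        omega
    · rcases (by omega : e = a ∨ e = a + 1 ∨ e = b ∨ (a + 1 < e ∧ e < b) ∨ (e < a ∨ b < e))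
        with rfl | rfl | rfl | h8 | h8
      on_goal 4 =>
        have h9 := hin (e + 1) (by omega) (by omega)
      on_goal 2 =>
        have h9 := hin (a + 2) (by omega) (by omega)
      all_goals
        clear hi hin h7
        simp (disch := omega) only [swp, if_neg, if_true, if_pos]
        unfold TileOK at *
        simp only [add_assoc, Nat.reduceAdd, and_true, true_and] at *
        omega
  · have := hN e (by omega)
    rw [if_neg (by omega), if_neg (by omega), this]

theorem RowHop.isRow (hr : IsRow x u v h) (hu : IsWord (x - 1) u) (hv : IsWord x v)
    (hs : SmallInc k v) {a b c d : ℕ} {h' : ℕ → ℕ} (hh : Hop k u a b)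
    (hrh : RowHop k u v h a b c d h') : IsRow x (swp u a b) (swp v c d) h' := by
  cases hrh with
  | straight hb hq hvv => exact isRow_straight hr hu hh hb hq hvv
  | turn hb hq hvv hc => exact isRow_turn hr hu hv hs hh hb hq hvv hc
  | bumpSmall hb hq hk => exact isRow_bumpSmall hr hu hs hh hb hq hk
  | bumpLarge hb hk hvv => exact isRow_bumpLarge hr hu hv hs hh hb hk hvv
  | keep hb hc hd hcd => exact isRow_keep hr hu hv hs hh hb hc hd hcd
  | cross hb he hea hvv hq => exact isRow_cross hr hu hv hh hb he hea hvv hq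

end

/-! ### Labelled pipe dreams and insertion into them -/

/-- The tiling given by the words `V x` is that of the identity outside the square of size `n`. -/
def FinAt (V : ℕ → ℕ → ℕ) (n : ℕ) : Prop :=
  (∀ x, n ≤ x → ∀ c, V x c ≠ 0 ↔ 1 ≤ c ∧ c ≤ x) ∧ ∀ x, x < n → ∀ c, n < c → V x c = 0

/-- A bumpless pipe dream with labelled edges: `V x c` and `H x c` are the labels of the bottom edge
and of the right edge of the tile `(x, c)`. -/
structure LPD where
  V : ℕ → ℕ → ℕ
  H : ℕ → ℕ → ℕ
  H_zero : ∀ c, H 0 c = 0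
  word : ∀ x, IsWord x (V x)
  row : ∀ x, IsRow (x + 1) (V x) (V (x + 1)) (H (x + 1))
  fin : ∃ n, FinAt V n

/-- The pipes that exit from the rows `≤ k` do not cross. -/
def LPD.Inc (L : LPD) (k : ℕ) : Prop := ∀ x, SmallInc k (L.V x)

/-- The labelled pipe dream has the permutation `π`. -/
def LPD.HasPerm (L : LPD) (π : Equiv.Perm ℕ) : Prop :=
  π 0 = 0 ∧ ∃ n, ∀ x, n ≤ x → ∀ c, 1 ≤ c → c ≤ x → L.V x c = π.symm c

theorem FinAt.mono {V : ℕ → ℕ → ℕ} {n m : ℕ} (h : FinAt V n) (hm : n ≤ m) : FinAt V m := by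
  refine ⟨fun x hx => h.1 x (by omega), fun x hx c hc => ?_⟩
  rcases Nat.lt_or_ge x n with h1 | h1
  · exact h.2 x h1 c (by omega)
  · by_contra h2
    have := (h.1 x h1 c).1 h2
    omega

def LPD.id : LPD where
  V x c := if 1 ≤ c ∧ c ≤ x then c else 0
  H x c := if x ≤ c then x else 0
  H_zero c := by simp
  word x := by
    refine ⟨by simp, fun c => by split_ifs <;> omega, fun c d h1 h2 => ?_⟩
    split_ifs at h1 h2 <;> omega
  row x := by
    refine ⟨by simp, fun c => ?_, x + 1, fun c hc => by simp [hc]⟩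
    unfold TileOK
    split_ifs <;> omega
  fin := ⟨0, fun x _ c => by dsimp only; split_ifs <;> omega, fun x hx => by omega⟩

theorem LPD.id_inc (k : ℕ) : LPD.id.Inc k := by
  intro x c d h1 h2 h3 h4 h5
  simp only [LPD.id] at *
  split_ifs at * <;> omega

theorem LPD.id_hasPerm : LPD.id.HasPerm 1 :=
  ⟨rfl, 0, fun _ _ _ h1 h2 => if_pos ⟨h1, h2⟩⟩

theorem LPD.V_zero (L : LPD) (c : ℕ) : L.V 0 c = 0 := by
  have := (L.word 0).le c
  omega

/-- The course of an insertion: in the words `V x` with `x ≥ b` the entries `α x` and `β x` are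
exchanged. -/
structure InsPath (k b : ℕ) (L L' : LPD) (α β : ℕ → ℕ) : Prop where
  lo : ∀ x, x < b → L'.V x = L.V x ∧ L'.H x = L.H x
  start : L.V b (α b) = b ∧ β b = α b + 1 ∧ L'.H b = upd (L.H b) (α b) 0
  hop : ∀ x, b ≤ x → Hop k (L.V x) (α x) (β x)
  word : ∀ x, b ≤ x → L'.V x = swp (L.V x) (α x) (β x)
  rule : ∀ x, b ≤ x → RowHop k (L.V x) (L.V (x + 1)) (L.H (x + 1)) (α x) (β x) (α (x + 1))
    (β (x + 1)) (L'.H (x + 1))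

/-- The pipe that exits from row `b` runs to the right from its `rturn` for ever. Being small it
crosses nothing, so the column after the `rturn` is a hole, and the insertion begins by moving the
`rturn` there. -/
theorem IsRow.start {k b : ℕ} {u v h : ℕ → ℕ} (hr : IsRow b u v h) (hb : b ≠ 0) (hk : b ≤ k)
    (hs : SmallInc k v) :
    ∃ c, v c = b ∧ Hop k v c (c + 1) ∧ IsRow b u (swp v c (c + 1)) (upd h c 0) := by
  obtain ⟨N, hN⟩ := hr.far
  obtain ⟨d, h1, h2, h3, h4, h5⟩ := hr.carry_left (hN N le_rfl) hb
  have h6 : ∀ e, d < e → h e = b := fun e he => by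
    rcases le_total e N with h7 | h7
    · exact h5 e he h7
    · exact hN e h7
  have h7 : u (d + 2) = 0 ∧ v (d + 2) = 0 :=
    hr.small_pass hs (c := d + 1) (by rw [h6 _ (by omega)]; exact hb)
      (by rw [h6 _ (by omega)]; exact hb) (by rw [h6 _ (by omega)]; exact hk)
  refine ⟨d + 1, h2, ⟨by omega, by omega, by omega, .inl ⟨h7.2, rfl⟩⟩, ?_, fun e => ?_,
    N + d + 2, fun e he => ?_⟩
  · simp [upd, hr.zero]
  · have ht := hr.tile e
    have h8 := h6 (d + 1) (by omega)
    have h9 := h6 (d + 2) (by omega)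
    rcases (by omega : e = d ∨ e = d + 1 ∨ (e ≠ d ∧ e ≠ d + 1)) with rfl | rfl | h10
    all_goals
      simp (disch := omega) only [swp, upd, if_neg, if_true]
      unfold TileOK at *
      try simp only [add_assoc, Nat.reduceAdd, and_true, true_and] at *
      omega
  · unfold upd
    rw [if_neg (by omega)]
    exact hN e (by omega)

theorem exists_chain {α : Type*} (P : ℕ → α → Prop) (R : ℕ → α → α → Prop) (a₀ : α) (h₀ : P 0 a₀)
    (hs : ∀ n a, P n a → ∃ a', P (n + 1) a' ∧ R n a a') :
    ∃ f : ℕ → α, f 0 = a₀ ∧ ∀ n, P n (f n) ∧ R n (f n) (f (n + 1)) := by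
  choose g hg using hs
  let F : ∀ n, {a // P n a} := fun n =>
    Nat.rec ⟨a₀, h₀⟩ (fun n p => ⟨g n p.1 p.2, (hg n p.1 p.2).1⟩) n
  exact ⟨fun n => (F n).1, rfl, fun n => ⟨(F n).2, (hg n (F n).1 (F n).2).2⟩⟩

section fin
variable {L : LPD} {n k : ℕ}

/-- Below the finite square the first `x` columns of the word in row `x` are filled, so no rule that
leaves a hole in column `a + 1` applies. The rule `bumpSmall` would need a label `≤ k` in a newly
filled column, but there the new label is `x + 1 > k`. -/
theorem LPD.rule_final (hf : FinAt L.V n) (hk : k ≤ n) {x a b c d : ℕ} {h' : ℕ → ℕ} (hx : n ≤ x)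
    (hh : Hop k (L.V x) a b)
    (hr : RowHop k (L.V x) (L.V (x + 1)) (L.H (x + 1)) a b c d h') :
    L.V (x + 1) d ≠ 0 ∧ (L.V x b ≠ 0 → L.V (x + 1) c = L.V x a ∧ L.V (x + 1) d = L.V x b) := by
  have h1 := hf.1 x hx
  have h2 := hf.1 (x + 1) (by omega)
  have ha := (h1 a).1 hh.pos
  have ha2 := (h2 (a + 1)).2 ⟨by omega, by omega⟩
  cases hr with
  | straight hb hq hv => exact absurd hq ha2
  | turn hb hq hv hc => exact absurd hq ha2
  | bumpSmall hb hq hkk =>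
    exfalso
    have ht := (L.row x).tile a
    have h3 : L.H (x + 1) (a + 1) = L.V (x + 1) (a + 1) := by unfold TileOK at ht; omega
    rcases (L.row x).carry_right h3 hq with h4 | ⟨e, h4, h5, _⟩
    · omega
    · have h6 := (h1 e).1 (by omega)
      have h7 := (h1 (a + 1)).2 ⟨by omega, by omega⟩
      omega
  | bumpLarge hb hkk hv => exact ⟨ha2, fun h => absurd hb h⟩
  | keep hb hc hd hcd => exact ⟨by omega, fun _ => ⟨hc, hd⟩⟩
  | cross hb he hea hv hq => exact absurd hq ha2

end fin

/-- Insertion of a biletter `(b, k)` into a labelled pipe dream. -/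
theorem LPD.exists_insPath (L : LPD) {b k : ℕ} (hb : 1 ≤ b) (hk : b ≤ k) (hs : L.Inc k) :
    ∃ L' α β, InsPath k b L L' α β := by
  obtain ⟨b, rfl⟩ : ∃ b', b = b' + 1 := ⟨b - 1, by omega⟩
  obtain ⟨c₀, hc₀, hh₀, hr₀⟩ := (L.row b).start (by omega) hk (hs (b + 1))
  obtain ⟨f, hf0, hf⟩ := exists_chain
    (fun n (p : ℕ × ℕ × (ℕ → ℕ)) => Hop k (L.V (b + 1 + n)) p.1 p.2.1)
    (fun n p q => RowHop k (L.V (b + 1 + n)) (L.V (b + 1 + n + 1)) (L.H (b + 1 + n + 1)) p.1 p.2.1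
      q.1 q.2.1 q.2.2) (c₀, c₀ + 1, upd (L.H (b + 1)) c₀ 0) hh₀ (fun n p hp => by
        obtain ⟨c, d, h', h1, h2⟩ := hp.next (L.row _) (L.word _) (L.word _) (hs _)
        exact ⟨(c, d, h'), h2, h1⟩)
  let α : ℕ → ℕ := fun x => (f (x - (b + 1))).1
  let β : ℕ → ℕ := fun x => (f (x - (b + 1))).2.1
  let V' : ℕ → ℕ → ℕ := fun x => if x < b + 1 then L.V x else swp (L.V x) (α x) (β x)
  let H' : ℕ → ℕ → ℕ := fun x => if x < b + 1 then L.H x else (f (x - (b + 1))).2.2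
  have hV1 : ∀ x, x < b + 1 → V' x = L.V x := fun x hx => if_pos hx
  have hV2 : ∀ x, b + 1 ≤ x → V' x = swp (L.V x) (α x) (β x) := fun x hx => if_neg (by omega)
  have hH1 : ∀ x, x < b + 1 → H' x = L.H x := fun x hx => if_pos hx
  have hH2 : ∀ x, b + 1 ≤ x → H' x = (f (x - (b + 1))).2.2 := fun x hx => if_neg (by omega)
  have hhop : ∀ x, b + 1 ≤ x → Hop k (L.V x) (α x) (β x) := fun x hx => by
    have := (hf (x - (b + 1))).1
    rwa [show b + 1 + (x - (b + 1)) = x by omega] at this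
  have hrule : ∀ x, b + 1 ≤ x → RowHop k (L.V x) (L.V (x + 1)) (L.H (x + 1)) (α x) (β x)
      (α (x + 1)) (β (x + 1)) (H' (x + 1)) := fun x hx => by
    have := (hf (x - (b + 1))).2
    rw [show b + 1 + (x - (b + 1)) = x by omega,
      show x - (b + 1) + 1 = x + 1 - (b + 1) by omega] at this
    rw [hH2 (x + 1) (by omega)]
    exact this
  have hword : ∀ x, IsWord x (V' x) := fun x => by
    rcases Nat.lt_or_ge x (b + 1) with hx | hx
    · rw [hV1 x hx]; exact L.word x
    · rw [hV2 x hx]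
      have := (hhop x hx).pos_left (L.word x).zero
      exact (L.word x).exchange this (by have := (hhop x hx).lt; omega)
  have hrow : ∀ x, IsRow (x + 1) (V' x) (V' (x + 1)) (H' (x + 1)) := fun x => by
    rcases Nat.lt_or_ge (x + 1) (b + 1) with hx | hx
    · rw [hV1 x (by omega), hV1 _ hx, hH1 _ hx]; exact L.row x
    · rcases Nat.lt_or_ge x (b + 1) with hx' | hx'
      · have : x = b := by omega
        subst this
        rw [hV1 x hx', hV2 _ le_rfl, hH2 _ le_rfl]
        simp only [α, β, Nat.sub_self, hf0]
        exact hr₀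
      · rw [hV2 x hx', hV2 _ hx]
        exact (hrule x hx').isRow (L.row x) (L.word x) (L.word _) (hs _) (hhop x hx')
  have hfin : ∃ n, FinAt V' n := by
    obtain ⟨n, hn⟩ := L.fin
    have hn' := hn.mono (le_max_left n k)
    set m := max n k
    have hkm : k ≤ m := le_max_right _ _
    -- The enlargement by one is needed because a label may move into the hole in column `m + 1`,
    -- and because `rule_final` speaks of the row below the given one.
    refine ⟨m + 1, fun x hx c => ?_, fun x hx c hc => ?_⟩
    · rw [hV2 x (by omega)]
      have h1 := hn'.1 x (by omega)
      obtain ⟨x, rfl⟩ : ∃ y, x = y + 1 := ⟨x - 1, by omega⟩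
      have h2 := (L.rule_final hn' hkm (x := x) (by omega) (hhop x (by omega))
        (hrule x (by omega))).1
      have h3 := (hhop (x + 1) (by omega)).pos
      have h4 := h1 (α (x + 1))
      have h5 := h1 (β (x + 1))
      have h6 := h1 c
      unfold swp
      split_ifs with h7 h8
      · subst h7; tauto
      · subst h8; tauto
      · exact h6
    · have hz : ∀ e, m < e → L.V x e = 0 := fun e he => by
        rcases Nat.lt_or_ge x m with h1 | h1
        · exact hn'.2 x h1 e he
        · by_contra h2
          have := (hn'.1 x h1 e).1 h2
          omega
      rcases Nat.lt_or_ge x (b + 1) with hx' | hx'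
      · rw [hV1 x hx']; exact hz c (by omega)
      · rw [hV2 x hx']
        have hp := hhop x hx'
        have h1 : α x ≤ m := by
          by_contra h2
          exact hp.pos (hz _ (by omega))
        have h2 : β x ≤ m + 1 := by
          rcases hp.big with h3 | h3
          · omega
          · by_contra h4
            have := hz (β x) (by omega)
            omega
        rw [swp_of_ne _ (by omega) (by omega)]
        exact hz c (by omega)
  refine ⟨⟨V', H', fun c => ?_, hword, hrow, hfin⟩, α, β, fun x hx => ⟨hV1 x hx, hH1 x hx⟩,
    ⟨?_, ?_, ?_⟩, hhop, hV2, hrule⟩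
  · rw [hH1 0 (by omega)]; exact L.H_zero c
  · simp only [α, Nat.sub_self, hf0]; exact hc₀
  · simp only [α, β, Nat.sub_self, hf0]
  · change H' (b + 1) = _
    rw [hH2 _ le_rfl]
    simp only [α, Nat.sub_self, hf0]

section path
variable {k b : ℕ} {L L' : LPD} {α β : ℕ → ℕ}

theorem InsPath.inc (hp : InsPath k b L L' α β) (hs : L.Inc k) : L'.Inc k := fun x => by
  rcases Nat.lt_or_ge x b with hx | hx
  · rw [(hp.lo x hx).1]; exact hs x
  · rw [hp.word x hx]; exact (hs x).exchange (hp.hop x hx)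

theorem LPD.Inc.mono {m : ℕ} (h : L.Inc k) (hm : m ≤ k) : L.Inc m :=
  fun x c d h1 h2 h3 h4 h5 => h x c d h1 h2 h3 (by omega) (by omega)

/-- Eventually the path is constant, and it exchanges two values of the permutation. -/
theorem InsPath.hasPerm (hp : InsPath k b L L' α β) {π : Equiv.Perm ℕ} (hπ : L.HasPerm π) :
    ∃ A B n, A < B ∧ A ≠ 0 ∧ (∀ x, n ≤ x → α x = A ∧ β x = B ∧ B ≤ x) ∧
      L'.HasPerm (Equiv.swap A B * π) ∧ π.symm A ≤ k ∧ k < π.symm B := by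
  obtain ⟨n, hn⟩ := L.fin
  obtain ⟨h0, n', hn'⟩ := hπ
  let m := max (max n k) (max n' b) + 1
  have hf : FinAt L.V (m - 1) := hn.mono (by omega)
  have hne : ∀ x, m ≤ x → L.V x (β x) ≠ 0 := fun x hx => by
    obtain ⟨x, rfl⟩ : ∃ y, x = y + 1 := ⟨x - 1, by omega⟩
    exact (L.rule_final hf (by omega) (x := x) (by omega) (hp.hop x (by omega))
        (hp.rule x (by omega))).1
  have hle : ∀ x, m ≤ x → 1 ≤ α x ∧ α x < β x ∧ β x ≤ x := fun x hx => by
    have h1 := (hp.hop x (by omega)).pos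
    have h2 := (hf.1 x (by omega) _).1 h1
    have h3 := (hf.1 x (by omega) _).1 (hne x hx)
    exact ⟨h2.1, (hp.hop x (by omega)).lt, h3.2⟩
  -- Only renaming remains, so the exchanged labels are constant; as the words are given by `π⁻¹`,
  -- the columns are constant too.
  have hconst : ∀ d, α (m + d) = α m ∧ β (m + d) = β m := by
    intro d
    induction d with
    | zero => exact ⟨rfl, rfl⟩
    | succ d ih =>
      have h1 := (L.rule_final hf (by omega) (x := m + d) (by omega) (hp.hop _ (by omega))
        (hp.rule _ (by omega))).2 (hne _ (by omega))
      have h2 := hle (m + d) (by omega)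
      have h3 := hle (m + (d + 1)) (by omega)
      rw [hn' (m + d) (by omega) _ (by omega) (by omega),
        hn' (m + d) (by omega) _ (by omega) (by omega),
        hn' (m + d + 1) (by omega) _ (by simp only [add_assoc]; omega)
          (by simp only [add_assoc]; omega),
        hn' (m + d + 1) (by omega) _ (by simp only [add_assoc]; omega)
          (by simp only [add_assoc]; omega)] at h1
      have h4 := π.symm.injective h1.1
      have h5 := π.symm.injective h1.2
      simp only [add_assoc] at h4 h5
      omega
  have hc : ∀ x, m ≤ x → α x = α m ∧ β x = β m := fun x hx => by
    have := hconst (x - m)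
    rwa [show m + (x - m) = x by omega] at this
  have hm := hle m le_rfl
  refine ⟨α m, β m, m, by omega, by omega, fun x hx => ⟨(hc x hx).1, (hc x hx).2, by omega⟩,
    ⟨?_, m, fun x hx c h1 h2 => ?_⟩, ?_⟩
  · rw [Equiv.Perm.mul_apply, h0, Equiv.swap_apply_of_ne_of_ne] <;> omega
  · rw [hp.word x (by omega), (hc x hx).1, (hc x hx).2]
    have h3 : (Equiv.swap (α m) (β m) * π).symm c = π.symm (Equiv.swap (α m) (β m) c) := rfl
    rw [h3]
    unfold swp
    split_ifs with h4 h5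
    · subst h4; rw [Equiv.swap_apply_left]; exact hn' x (by omega) _ (by omega) (by omega)
    · subst h5; rw [Equiv.swap_apply_right]; exact hn' x (by omega) _ (by omega) (by omega)
    · rw [Equiv.swap_apply_of_ne_of_ne h4 h5]; exact hn' x (by omega) _ (by omega) (by omega)
  · have h1 := hp.hop m (by omega)
    have h2 := hne m le_rfl
    rw [← hn' m (by omega) _ (by omega) (by omega), ← hn' m (by omega) _ (by omega) (by omega)]
    refine ⟨h1.small, ?_⟩
    rcases h1.big with h3 | h3 <;> omega

end path

/-! ### From labels to tilings: tracing pipes -/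

/-- The tile whose top, right, bottom and left edges have the labels `t`, `b`, `v`, `l`. -/
def tileOf (t b v : ℕ) : Tile :=
  if v = 0 then (if b = 0 then (if t = 0 then .blank else .jturn) else .horiz)
  else if b = 0 then .vert
  else if v = b then (if t = 0 then .rturn else .bump) else .cross

/-- The tiling with the given labels. -/
def gridOf (V H : ℕ → ℕ → ℕ) : Grid := fun x y =>
  if x = 0 ∨ y = 0 then .blank else tileOf (V (x - 1) y) (H x y) (V x y)

/-- The labels of a bump. -/
def BumpOK (t b v l : ℕ) : Prop := t ≠ 0 ∧ b ≠ 0 ∧ v = b ∧ l = t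

/-- A labelling of the edges of a tiling, where bumps are allowed. -/
structure IsCfg (V H : ℕ → ℕ → ℕ) : Prop where
  top : ∀ c, V 0 c = 0
  V_left : ∀ x, V x 0 = 0
  H_top : ∀ c, H 0 c = 0
  H_left : ∀ x, H x 0 = 0
  tile : ∀ x c, TileOK (V x (c + 1)) (H (x + 1) (c + 1)) (V (x + 1) (c + 1)) (H (x + 1) c) ∨
    BumpOK (V x (c + 1)) (H (x + 1) (c + 1)) (V (x + 1) (c + 1)) (H (x + 1) c)
  far : ∀ x, 1 ≤ x → ∃ N, ∀ c, N ≤ c → H x c = x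

/-- The label of the edge through which a position is entered. -/
def lab (V H : ℕ → ℕ → ℕ) : Pos → ℕ
  | (x, y, .bottom) => V x y
  | (x, y, .left) => H x (y - 1)

theorem gridOf_succ (V H : ℕ → ℕ → ℕ) (x y : ℕ) :
    gridOf V H (x + 1) (y + 1) = tileOf (V x (y + 1)) (H (x + 1) (y + 1)) (V (x + 1) (y + 1)) := by
  simp [gridOf]

section tiles
variable {t b v l : ℕ}

theorem goesUp_bottom (h : TileOK t b v l ∨ BumpOK t b v l) (hv : v ≠ 0) :
    ((tileOf t b v).goesUp .bottom ∧ t = v ∧ (l ≠ 0 → ¬ (tileOf t b v).goesUp .left ∧ b = l)) ∨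
    (¬ (tileOf t b v).goesUp .bottom ∧ b = v ∧ (l ≠ 0 → (tileOf t b v).goesUp .left ∧ t = l)) := by
  unfold tileOf
  unfold TileOK BumpOK at h
  split_ifs with h1 h2 h3 <;> simp [Tile.goesUp] <;> omega

theorem goesUp_left (h : TileOK t b v l ∨ BumpOK t b v l) (hl : l ≠ 0) :
    ((tileOf t b v).goesUp .left ∧ t = l) ∨ (¬ (tileOf t b v).goesUp .left ∧ b = l) := by
  unfold tileOf
  unfold TileOK BumpOK at h
  split_ifs with h1 h2 h3 <;> simp [Tile.goesUp] <;> omega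

end tiles

section trace
variable {V H : ℕ → ℕ → ℕ}

theorem next_of_goesUp {D : Grid} {x y : ℕ} {s : Side} (h : (D x y).goesUp s) :
    next D (x, y, s) = (x - 1, y, .bottom) := if_pos h

theorem next_of_not_goesUp {D : Grid} {x y : ℕ} {s : Side} (h : ¬ (D x y).goesUp s) :
    next D (x, y, s) = (x, y + 1, .left) := if_neg h

theorem IsCfg.pos (hc : IsCfg V H) {x y : ℕ} {s : Side} (hq : lab V H (x, y, s) ≠ 0) :
    x ≠ 0 ∧ y ≠ 0 := by
  constructor
  · rintro rfl
    cases s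
    exacts [hq (hc.top y), hq (hc.H_top _)]
  · rintro rfl
    cases s
    exacts [hq (hc.V_left x), hq (hc.H_left x)]

theorem IsCfg.next_cases (hc : IsCfg V H) {x y : ℕ} {s : Side} (hq : lab V H (x, y, s) ≠ 0) :
    ((gridOf V H x y).goesUp s ∧ next (gridOf V H) (x, y, s) = (x - 1, y, .bottom) ∧
        V (x - 1) y = lab V H (x, y, s)) ∨
      (¬ (gridOf V H x y).goesUp s ∧ next (gridOf V H) (x, y, s) = (x, y + 1, .left) ∧
        H x y = lab V H (x, y, s)) := by
  obtain ⟨hx, hy⟩ := hc.pos hq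
  obtain ⟨x, rfl⟩ : ∃ x', x = x' + 1 := ⟨x - 1, by omega⟩
  obtain ⟨y, rfl⟩ : ∃ x', y = x' + 1 := ⟨y - 1, by omega⟩
  have ht := hc.tile x y
  cases s
  · rcases goesUp_bottom ht hq with h | h
    · rw [← gridOf_succ] at h
      exact .inl ⟨h.1, next_of_goesUp h.1, h.2.1⟩
    · rw [← gridOf_succ] at h
      exact .inr ⟨h.1, next_of_not_goesUp h.1, h.2.1⟩
  · rcases goesUp_left ht hq with h | h
    · rw [← gridOf_succ] at h
      exact .inl ⟨h.1, next_of_goesUp h.1, h.2⟩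
    · rw [← gridOf_succ] at h
      exact .inr ⟨h.1, next_of_not_goesUp h.1, h.2⟩

/-- A pipe keeps its label. -/
theorem IsCfg.next_lab (hc : IsCfg V H) {p : Pos} (hq : lab V H p ≠ 0) :
    lab V H (next (gridOf V H) p) = lab V H p ∧
      ((next (gridOf V H) p).2.1 : ℤ) - (next (gridOf V H) p).1 = p.2.1 - p.1 + 1 ∧
      (next (gridOf V H) p).1 ≤ p.1 ∧
      ((next (gridOf V H) p).1 = p.1 → (next (gridOf V H) p).2.2 = .left) := by
  obtain ⟨x, y, s⟩ := p
  have := (hc.pos hq).1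
  rcases hc.next_cases hq with h | h <;> rw [h.2.1]
  · exact ⟨h.2.2, by push_cast [Nat.cast_sub (Nat.one_le_iff_ne_zero.2 this)]; ring,
      by simp, fun h' => by simp only at h'; omega⟩
  · exact ⟨h.2.2, by push_cast; ring, le_rfl, fun _ => rfl⟩

theorem IsCfg.iterate_lab (hc : IsCfg V H) {p : Pos} (hq : lab V H p ≠ 0) (n : ℕ) :
    lab V H ((next (gridOf V H))^[n] p) = lab V H p ∧
      (((next (gridOf V H))^[n] p).2.1 : ℤ) - ((next (gridOf V H))^[n] p).1 = p.2.1 - p.1 + n ∧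
      ((next (gridOf V H))^[n] p).1 ≤ p.1 := by
  induction n with
  | zero => simp
  | succ n ih =>
    rw [Function.iterate_succ_apply']
    have h := hc.next_lab (p := (next (gridOf V H))^[n] p) (by rw [ih.1]; exact hq)
    refine ⟨h.1.trans ih.1, ?_, h.2.2.1.trans ih.2.2⟩
    rw [h.2.1, ih.2.1]; push_cast; ring

/-- A pipe can also be traced backwards: if both entrances of a tile are used, exactly one of the
two pipes goes up (`key`), so the exit determines the entrance. -/
theorem IsCfg.next_inj (hc : IsCfg V H) {p p' : Pos} (hq : lab V H p ≠ 0)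
    (he : lab V H p = lab V H p') (hn : next (gridOf V H) p = next (gridOf V H) p') : p = p' := by
  obtain ⟨x, y, s⟩ := p
  obtain ⟨x', y', s'⟩ := p'
  have h1 := hc.pos hq
  have hq' : lab V H (x', y', s') ≠ 0 := by rwa [← he]
  have h2 := hc.pos hq'
  have key : ∀ x y, lab V H (x, y, .bottom) ≠ 0 → lab V H (x, y, .left) ≠ 0 →
      ((gridOf V H x y).goesUp .bottom ↔ ¬ (gridOf V H x y).goesUp .left) := by
    intro x y h3 h4
    obtain ⟨hx, hy⟩ := hc.pos h3
    obtain ⟨x, rfl⟩ : ∃ x', x = x' + 1 := ⟨x - 1, by omega⟩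
    obtain ⟨y, rfl⟩ : ∃ x', y = x' + 1 := ⟨y - 1, by omega⟩
    rw [gridOf_succ]
    have := goesUp_bottom (hc.tile x y) h3
    have h4' : H (x + 1) y ≠ 0 := h4
    tauto
  rcases hc.next_cases hq with h | h <;> rcases hc.next_cases hq' with h' | h' <;>
    rw [h.2.1, h'.2.1] at hn <;> simp only [Prod.mk.injEq, reduceCtorEq, and_false] at hn
  · have hx : x = x' := by omega
    obtain rfl := hx
    obtain rfl := hn.2.1
    have h3 := key x y
    cases s <;> cases s' <;> tauto
  · obtain rfl := hn.1
    have hy : y = y' := by omega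
    obtain rfl := hy
    have h3 := key x y
    cases s <;> cases s' <;> tauto

/-- Rows never increase along a pipe. Once the row is constant the pipe moves right for ever, and
far to the right the label of an edge is its row. -/
theorem IsCfg.eventually_row (hc : IsCfg V H) : ∀ {p : Pos}, lab V H p ≠ 0 → ∃ N, ∀ n, N ≤ n →
    ((next (gridOf V H))^[n] p).1 = lab V H p ∧ ((next (gridOf V H))^[n] p).2.2 = .left := by
  suffices h : ∀ x, ∀ p : Pos, p.1 = x → lab V H p ≠ 0 → ∃ N, ∀ n, N ≤ n →
      ((next (gridOf V H))^[n] p).1 = lab V H p ∧ ((next (gridOf V H))^[n] p).2.2 = .left from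
    fun {p} => h _ p rfl
  intro x
  induction x using Nat.strong_induction_on with
  | _ x ih =>
  intro p hx hq
  by_cases hlt : ∃ m, ((next (gridOf V H))^[m] p).1 < x
  · obtain ⟨m, hm⟩ := hlt
    have hl := (hc.iterate_lab hq m).1
    obtain ⟨N, hN⟩ := ih _ hm _ rfl (by rw [hl]; exact hq)
    refine ⟨N + m, fun n hn => ?_⟩
    have := hN (n - m) (by omega)
    rwa [← Function.iterate_add_apply, Nat.sub_add_cancel (by omega), hl] at this
  · push Not at hlt
    have hrow : ∀ n, ((next (gridOf V H))^[n] p).1 = x := fun n =>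
      le_antisymm (hx ▸ (hc.iterate_lab hq n).2.2) (hlt n)
    have hleft : ∀ n, ((next (gridOf V H))^[n + 1] p).2.2 = .left := fun n => by
      have h1 := hrow (n + 1)
      rw [Function.iterate_succ_apply'] at h1 ⊢
      exact (hc.next_lab (by rw [(hc.iterate_lab hq n).1]; exact hq)).2.2.2
        (by rw [h1, hrow])
    have hx0 : x ≠ 0 := by
      have := (hc.pos (x := p.1) (y := p.2.1) (s := p.2.2) hq).1
      omega
    obtain ⟨N, hN⟩ := hc.far x (by omega)
    have hqx : lab V H p = x := by
      have h1 := hc.iterate_lab hq (N + x + 1)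
      have h2 := hrow (N + x + 1)
      have h3 := hleft (N + x)
      generalize hP : (next (gridOf V H))^[N + x + 1] p = P at *
      obtain ⟨a, y, s⟩ := P
      simp only at h2 h3
      subst h2 h3
      rw [← h1.1]
      have h4 := h1.2.1
      simp only at h4
      push_cast at h4
      exact hN _ (by omega)
    refine ⟨1, fun n hn => ⟨by rw [hrow, hqx], ?_⟩⟩
    have := hleft (n - 1)
    rwa [Nat.sub_add_cancel hn] at this

theorem IsCfg.exitsRow_iff (hc : IsCfg V H) {p : Pos} (hq : lab V H p ≠ 0) {r : ℕ} :
    ExitsRow (gridOf V H) p r ↔ r = lab V H p := by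
  obtain ⟨N, hN⟩ := hc.eventually_row hq
  unfold ExitsRow
  rw [Filter.eventually_atTop]
  constructor
  · rintro ⟨M, hM⟩
    rw [← (hN (N + M) (by omega)).1, hM (N + M) (by omega)]
  · rintro rfl
    exact ⟨N, fun n hn => (hN n hn).1⟩

theorem IsCfg.iterate_inj (hc : IsCfg V H) (n : ℕ) : ∀ {p p' : Pos}, lab V H p ≠ 0 →
    lab V H p = lab V H p' → (next (gridOf V H))^[n] p = (next (gridOf V H))^[n] p' → p = p' := by
  induction n with
  | zero => exact fun _ _ h => h
  | succ n ih =>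
    intro p p' hq he h
    rw [Function.iterate_succ_apply, Function.iterate_succ_apply] at h
    refine hc.next_inj hq he (ih ?_ ?_ h)
    · rw [(hc.next_lab hq).1]; exact hq
    · rw [(hc.next_lab hq).1, (hc.next_lab (he ▸ hq)).1, he]

/-- Each step increases (column − row) by one, which fixes the number `m` of steps. After a further
long time both positions are in the row given by the label and on the same diagonal, hence equal;
`IsCfg.iterate_inj` pulls this equality back. -/
theorem IsCfg.reaches (hc : IsCfg V H) {p p' : Pos} (hq : lab V H p ≠ 0)
    (he : lab V H p = lab V H p') (hd : (p.2.1 : ℤ) - p.1 ≤ p'.2.1 - p'.1) :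
    Reaches (gridOf V H) p p' := by
  obtain ⟨m, hm⟩ := Int.eq_ofNat_of_zero_le (sub_nonneg.2 hd)
  refine ⟨m, ?_⟩
  have h1 := hc.iterate_lab hq m
  have hq1 : lab V H ((next (gridOf V H))^[m] p) ≠ 0 := by rw [h1.1]; exact hq
  obtain ⟨N, hN⟩ := hc.eventually_row hq1
  obtain ⟨N', hN'⟩ := hc.eventually_row (p := p') (he ▸ hq)
  have h2 := hN (N + N') (by omega)
  have h3 := hN' (N + N') (by omega)
  have h4 := (hc.iterate_lab hq1 (N + N')).2.1
  have h5 := (hc.iterate_lab (p := p') (he ▸ hq) (N + N')).2.1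
  refine hc.iterate_inj (N + N') hq1 (h1.1.trans he) (Prod.ext ?_ (Prod.ext ?_ ?_))
  · rw [h2.1, h3.1, h1.1, he]
  · rw [h2.1] at h4
    rw [h3.1] at h5
    rw [h1.1] at h4
    rw [he] at h4
    have h6 := h1.2.1
    omega
  · rw [h2.2, h3.2]

theorem IsCfg.samePipe_iff (hc : IsCfg V H) {p p' : Pos} (hq : lab V H p ≠ 0)
    (hq' : lab V H p' ≠ 0) : SamePipe (gridOf V H) p p' ↔ lab V H p = lab V H p' := by
  constructor
  · rintro (⟨n, h⟩ | ⟨n, h⟩)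
    · rw [← h, (hc.iterate_lab hq n).1]
    · rw [← h, (hc.iterate_lab hq' n).1]
  · intro he
    rcases le_total ((p.2.1 : ℤ) - p.1) (p'.2.1 - p'.1) with h | h
    · exact .inl (hc.reaches hq he h)
    · exact .inr (hc.reaches hq' he.symm h)

theorem IsCfg.samePair_iff (hc : IsCfg V H) {x y x' y' : ℕ} (h1 : V x y ≠ 0) (h2 : H x (y - 1) ≠ 0)
    (h3 : V x' y' ≠ 0) (h4 : H x' (y' - 1) ≠ 0) : SamePair (gridOf V H) x y x' y' ↔
      (V x y = V x' y' ∧ H x (y - 1) = H x' (y' - 1)) ∨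
      (V x y = H x' (y' - 1) ∧ H x (y - 1) = V x' y') := by
  unfold SamePair
  rw [hc.samePipe_iff (p := (x, y, .bottom)) h1 (p' := (x', y', .bottom)) h3,
    hc.samePipe_iff (p := (x, y, .bottom)) h1 (p' := (x', y', .left)) h4,
    hc.samePipe_iff (p := (x, y, .left)) h2 (p' := (x', y', .bottom)) h3,
    hc.samePipe_iff (p := (x, y, .left)) h2 (p' := (x', y', .left)) h4]
  rfl

end trace

section tiles
variable {t b v l : ℕ}

theorem tileOf_right : (tileOf t b v).right ↔ b ≠ 0 := by
  unfold tileOf; split_ifs <;> simp_all [Tile.right]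

theorem tileOf_bottom : (tileOf t b v).bottom ↔ v ≠ 0 := by
  unfold tileOf; split_ifs <;> simp_all [Tile.bottom]

theorem tileOf_left (h : TileOK t b v l) : (tileOf t b v).left ↔ l ≠ 0 := by
  unfold TileOK at h
  unfold tileOf; split_ifs <;> simp only [Tile.left] <;> simp <;> omega

theorem tileOf_top (h : TileOK t b v l) : (tileOf t b v).top ↔ t ≠ 0 := by
  unfold TileOK at h
  unfold tileOf; split_ifs <;> simp only [Tile.top] <;> simp <;> omega

theorem tileOf_eq_cross : tileOf t b v = .cross ↔ v ≠ 0 ∧ b ≠ 0 ∧ v ≠ b := by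
  unfold tileOf; split_ifs <;> simp_all

theorem tileOf_eq_rturn : tileOf t b v = .rturn ↔ v ≠ 0 ∧ v = b ∧ t = 0 := by
  unfold tileOf; split_ifs <;> simp_all

theorem tileOf_eq_bump : tileOf t b v = .bump ↔ v ≠ 0 ∧ v = b ∧ t ≠ 0 := by
  unfold tileOf; split_ifs <;> simp_all

end tiles

/-! ### Labelled pipe dreams are reduced bumpless pipe dreams -/

namespace LPD
variable (L : LPD)

/-- The bumpless pipe dream without labels. -/
def grid : Grid := gridOf L.V L.H

theorem H_left (x : ℕ) : L.H x 0 = 0 := by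
  obtain _ | x := x
  · exact L.H_zero 0
  · exact (L.row x).zero

theorem isCfg : IsCfg L.V L.H where
  top := L.V_zero
  V_left x := (L.word x).zero
  H_top := L.H_zero
  H_left := L.H_left
  tile x c := .inl ((L.row x).tile c)
  far x hx := by
    obtain ⟨x, rfl⟩ : ∃ y, x = y + 1 := ⟨x - 1, by omega⟩
    exact (L.row x).far

variable {L}

theorem H_ne_zero {x c m : ℕ} (hz : ∀ e, m < e → L.V (x + 1) e = 0) (hc : m ≤ c) :
    L.H (x + 1) c ≠ 0 := by
  intro h0
  obtain ⟨N, hN⟩ := (L.row x).far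
  obtain ⟨d, h1, h2, h3, h4, h5⟩ := (L.row x).carry_left (hN (N + c) (by omega)) (by omega)
  have h6 : c ≤ d := by
    by_contra h6
    have := h5 c (by omega) (by omega)
    omega
  have := hz (d + 1) (by omega)
  omega

theorem H_eq_zero {n x c : ℕ} (hf : FinAt L.V n) (hx : n ≤ x) (hc : c ≤ x) : L.H (x + 1) c = 0 := by
  by_contra h0
  obtain ⟨d, h1, h2, h3, h4, h5⟩ := (L.row x).carry_left rfl h0
  have h6 := (hf.1 x hx (d + 1)).2 ⟨by omega, by omega⟩
  omega

theorem cross_spec {x y : ℕ} (h : L.grid (x + 1) (y + 1) = .cross) :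
    L.V (x + 1) (y + 1) = L.V x (y + 1) ∧ L.H (x + 1) y = L.H (x + 1) (y + 1) ∧
      L.V x (y + 1) ≠ 0 ∧ L.V x (y + 1) < L.H (x + 1) y := by
  unfold grid at h
  rw [gridOf_succ, tileOf_eq_cross] at h
  have ht := (L.row x).tile y
  unfold TileOK at ht
  omega

theorem cross_iff {x y : ℕ} : L.grid (x + 1) (y + 1) = .cross ↔ L.H (x + 1) y ≠ 0 ∧
    L.H (x + 1) (y + 1) ≠ 0 ∧ L.V (x + 1) (y + 1) ≠ 0 := by
  unfold grid
  rw [gridOf_succ, tileOf_eq_cross]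
  have ht := (L.row x).tile y
  unfold TileOK at ht
  omega

/-- Below a crossing the pipe with the larger label is to the left. -/
theorem cross_below {x y : ℕ} (h : L.grid (x + 1) (y + 1) = .cross) :
    ∃ c, c < y + 1 ∧ L.V (x + 1) c = L.H (x + 1) y := by
  have h1 := cross_spec h
  obtain ⟨d, h2, h3, _⟩ := (L.row x).carry_left (c := y) rfl (by omega)
  exact ⟨d + 1, by omega, h3⟩

/-- Above a crossing the pipe with the smaller label is to the left. -/
theorem cross_above {x y c : ℕ} (h : L.grid (x + 1) (y + 1) = .cross)
    (hc : L.V x c = L.H (x + 1) y) : y + 1 < c := by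
  have h1 := cross_spec h
  rcases (L.row x).carry_right (c := y + 1) rfl (by omega) with h2 | ⟨d, h2, h3, _⟩
  · have := (L.word x).le c
    omega
  · have := (L.word x).inj c d (by omega) (by omega)
    omega

/-- An inversion persists in the rows below. -/
theorem inversion_mono {x m b t cb ct : ℕ} (hb : L.V x cb = b) (ht : L.V x ct = t) (ht0 : t ≠ 0)
    (htb : t < b) (hlt : cb < ct) (hm : x ≤ m) :
    ∃ cb' ct', L.V m cb' = b ∧ L.V m ct' = t ∧ cb' < ct' := by
  induction m, hm using Nat.le_induction with
  | base => exact ⟨cb, ct, hb, ht, hlt⟩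
  | succ m hm ih =>
    obtain ⟨cb', ct', h1, h2, h3⟩ := ih
    obtain ⟨db, h4⟩ : ∃ d, L.V (m + 1) d = b := by
      rcases (L.row m).move (L.word m).zero h1 (by omega) with h | ⟨d, _, h, _⟩
      exacts [⟨_, h.1⟩, ⟨_, h⟩]
    obtain ⟨dt, h5⟩ : ∃ d, L.V (m + 1) d = t := by
      rcases (L.row m).move (L.word m).zero h2 ht0 with h | ⟨d, _, h, _⟩
      exacts [⟨_, h.1⟩, ⟨_, h⟩]
    exact ⟨db, dt, h4, h5,
      (L.row m).order_mono (L.word m).zero (L.word (m + 1)) h1 h2 h4 h5 ht0 htb h3⟩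

/-- A crossing of two pipes cannot be in a row below an inversion of these pipes. -/
theorem not_cross_of_inversion {x m y cb ct : ℕ} (hlt : cb < ct) (hm : x ≤ m)
    (h : L.grid (m + 1) (y + 1) = .cross) (hb : L.V x cb = L.H (m + 1) y)
    (ht : L.V x ct = L.V (m + 1) (y + 1)) : False := by
  have h1 := cross_spec h
  obtain ⟨cb', ct', h2, h3, h4⟩ := inversion_mono (m := m) hb ht (by omega) (by omega) hlt hm
  have h5 := cross_above h h2
  have := (L.word m).inj ct' (y + 1) (by omega) (by omega)
  omega

/-- A crossing leaves an inversion in the word below it, and below an inversion the same two pipes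
cannot cross. -/
theorem cross_unique {x y x' y' : ℕ} (h : L.grid (x + 1) (y + 1) = .cross)
    (h' : L.grid (x' + 1) (y' + 1) = .cross) (hb : L.H (x + 1) y = L.H (x' + 1) y')
    (ht : L.V (x + 1) (y + 1) = L.V (x' + 1) (y' + 1)) : x = x' ∧ y = y' := by
  have key : ∀ {x y x' y' : ℕ}, L.grid (x + 1) (y + 1) = .cross →
      L.grid (x' + 1) (y' + 1) = .cross → L.H (x + 1) y = L.H (x' + 1) y' →
      L.V (x + 1) (y + 1) = L.V (x' + 1) (y' + 1) → ¬ x < x' := by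
    intro x y x' y' h h' hb ht hlt
    obtain ⟨c, h1, h2⟩ := cross_below h
    exact not_cross_of_inversion h1 (by omega : x + 1 ≤ x') h' (h2.trans hb) ht
  have hx : x = x' := le_antisymm (not_lt.1 (key h' h hb.symm ht.symm)) (not_lt.1 (key h h' hb ht))
  subst hx
  have h1 := cross_spec h
  have := (L.word (x + 1)).inj _ _ ht (by omega)
  exact ⟨rfl, by omega⟩

/-- All conditions but one are local or asymptotic. Reducedness follows from `cross_unique`, because
a pipe is identified by its label. -/
theorem isBPD {π : Equiv.Perm ℕ} (hπ : L.HasPerm π) : IsBPD L.grid π where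
  border x y h := by unfold grid gridOf; rw [if_pos h]
  no_bump x y := by
    unfold grid
    obtain _ | x := x
    · simp [gridOf]
    obtain _ | y := y
    · simp [gridOf]
    rw [gridOf_succ, Ne, tileOf_eq_bump]
    have ht := (L.row x).tile y
    unfold TileOK at ht
    omega
  fit_horiz x y := by
    unfold grid
    obtain _ | x := x
    · simp [gridOf, Tile.left, Tile.right]
    rw [gridOf_succ, tileOf_left ((L.row x).tile y)]
    obtain _ | y := y
    · simp [gridOf, Tile.right, L.H_left]
    rw [gridOf_succ, tileOf_right]
  fit_vert x y := by
    unfold grid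
    obtain _ | y := y
    · simp [gridOf, Tile.top, Tile.bottom]
    rw [gridOf_succ, tileOf_top ((L.row x).tile y)]
    obtain _ | x := x
    · simp [gridOf, Tile.bottom, L.V_zero]
    rw [gridOf_succ, tileOf_bottom]
  finite := by
    obtain ⟨n, hn⟩ := L.fin
    refine ⟨n, fun x y hxy => ?_⟩
    unfold grid idGrid
    obtain _ | x := x
    · simp [gridOf]
    obtain _ | y := y
    · simp [gridOf]
    have ht := (L.row x).tile y
    rw [gridOf_succ, if_neg (by omega)]
    unfold TileOK at ht
    rcases Nat.lt_or_ge x n with hx | hx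
    · have hz : ∀ m, m ≤ n → ∀ e, n < e → L.V m e = 0 := fun m hm e he => by
        rcases hm.lt_or_eq with hm | rfl
        · exact hn.2 m hm e he
        · by_contra h
          have := (hn.1 m le_rfl e).1 h
          omega
      have h1 := hz x (by omega) (y + 1) (by omega)
      have h2 := hz (x + 1) (by omega) (y + 1) (by omega)
      have h3 := H_ne_zero (hz (x + 1) (by omega)) (c := y + 1) (by omega)
      rw [if_neg (by omega), if_pos (by omega)]
      unfold tileOf
      rw [if_pos h2, if_neg h3]
    · have h1 := hn.1 x hx (y + 1)
      have h2 := hn.1 (x + 1) (by omega) (y + 1)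
      have h3 : y < x → L.H (x + 1) (y + 1) = 0 := fun h => H_eq_zero hn hx (by omega)
      have h4 : x ≤ y → L.H (x + 1) (y + 1) ≠ 0 := fun h =>
        H_ne_zero (m := x + 1) (fun e he => by
          by_contra h
          have := (hn.1 (x + 1) (by omega) e).1 h
          omega) (by omega)
      unfold tileOf
      split_ifs <;> first | rfl | omega
  reduced x y x' y' h h' hp := by
    have hne : ∀ {x y}, L.grid x y = .cross → ∃ x' y', x = x' + 1 ∧ y = y' + 1 := fun {x y} h => by
      obtain _ | x := x
      · simp [grid, gridOf] at h
      obtain _ | y := y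
      · simp [grid, gridOf] at h
      exact ⟨x, y, rfl, rfl⟩
    obtain ⟨x, y, rfl, rfl⟩ := hne h
    obtain ⟨x', y', rfl, rfl⟩ := hne h'
    have h1 := cross_spec h
    have h2 := cross_spec h'
    rw [grid, L.isCfg.samePair_iff (by omega) (by simp only [Nat.add_sub_cancel]; omega) (by omega)
      (by simp only [Nat.add_sub_cancel]; omega)] at hp
    simp only [Nat.add_sub_cancel] at hp
    have := cross_unique h h' (by omega) (by omega)
    omega
  fix_zero := hπ.1
  exits p hp := by
    obtain ⟨_, n, hn⟩ := hπ
    obtain ⟨m, hm⟩ := L.fin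
    rw [Filter.eventually_atTop]
    refine ⟨max (max n m) p, fun x hx => ?_⟩
    have h1 := hn x (by omega) p hp (by omega)
    have h2 := (hm.1 x (by omega) p).2 ⟨hp, by omega⟩
    rw [grid, L.isCfg.exitsRow_iff (p := (x, p, .bottom)) h2]
    exact h1.symm

end LPD

theorem IsBPD.perm_unique {D : Grid} {π π' : Equiv.Perm ℕ} (h : IsBPD D π) (h' : IsBPD D π') :
    π = π' := by
  suffices hs : π.symm = π'.symm by rw [← π.symm_symm, hs, π'.symm_symm]
  ext p
  rcases Nat.eq_zero_or_pos p with rfl | hp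
  · rw [(Equiv.symm_apply_eq π).2 h.fix_zero.symm, (Equiv.symm_apply_eq π').2 h'.fix_zero.symm]
  · obtain ⟨x, h1, h2⟩ := ((h.exits p hp).and (h'.exits p hp)).exists
    obtain ⟨n, h3, h4⟩ := (h1.and h2).exists
    exact h3.symm.trans h4

/-! ### Determinism of the insertion algorithm -/

section loop
variable {k : ℕ} {D E D₁ : Grid} {i j i₁ j₁ : ℕ}

theorem IsMinDroop.unique {i₂ j₂ : ℕ} (h : IsMinDroop D i j i₁ j₁) (h' : IsMinDroop D i j i₂ j₂) :
    i₂ = i₁ ∧ j₂ = j₁ := ⟨h'.1.unique h.1, h'.2.unique h.2⟩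

/-- The constructors of `Loop` exclude each other: the corner tile, the existence of a crossing and
the exit row decide. So each step is an equivalence, which gives both existence and uniqueness of
the result. -/
theorem loop_iff_of_jturn (hm : IsMinDroop D i j i₁ j₁) (hD : D₁ = droop D i j i₁ j₁)
    (ht : D₁ i₁ j₁ = .jturn) {j₂ : ℕ} (hj : IsGreatest {y | y < j₁ ∧ D₁ i₁ y = .rturn} j₂) :
    Loop k D i j E ↔ Loop k D₁ i₁ j₂ E := by
  refine ⟨fun h => ?_, fun h => .jturn hm hD ht hj h⟩
  subst hD
  cases h with
  | jturn hm' hD' ht' hj' hE' =>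
    obtain ⟨rfl, rfl⟩ := hm.unique hm'
    subst hD'
    rwa [hj.unique hj']
  | swap hm' hD' ht' =>
    obtain ⟨rfl, rfl⟩ := hm.unique hm'
    subst hD'
    simp [ht] at ht'
  | bump hm' hD' ht' =>
    obtain ⟨rfl, rfl⟩ := hm.unique hm'
    subst hD'
    simp [ht] at ht'
  | terminate hm' hD' ht' =>
    obtain ⟨rfl, rfl⟩ := hm.unique hm'
    subst hD'
    simp [ht] at ht'

/-- The crossing must be known to be unique, since the constructor leaves its position free. -/
theorem loop_iff_of_swap (hm : IsMinDroop D i j i₁ j₁) (hD : D₁ = droop D i j i₁ j₁)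
    (ht : D₁ i₁ j₁ = .bump) {x y : ℕ} (hc : ∀ x' y', CrossAt D₁ i₁ j₁ x' y' ↔ x' = x ∧ y' = y) :
    Loop k D i j E ↔ Loop k (setTile (setTile D₁ i₁ j₁ .cross) x y .bump) x y E := by
  refine ⟨fun h => ?_, fun h => .swap hm hD ht ((hc x y).2 ⟨rfl, rfl⟩) h⟩
  subst hD
  cases h with
  | jturn hm' hD' ht' =>
    obtain ⟨rfl, rfl⟩ := hm.unique hm'
    subst hD'
    simp [ht] at ht'
  | swap hm' hD' ht' hc' hE' =>
    obtain ⟨rfl, rfl⟩ := hm.unique hm'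
    subst hD'
    obtain ⟨rfl, rfl⟩ := (hc _ _).1 hc'
    exact hE'
  | bump hm' hD' ht' hc' =>
    obtain ⟨rfl, rfl⟩ := hm.unique hm'
    subst hD'
    exact absurd ⟨x, y, (hc x y).2 ⟨rfl, rfl⟩⟩ hc'
  | terminate hm' hD' ht' hc' =>
    obtain ⟨rfl, rfl⟩ := hm.unique hm'
    subst hD'
    exact absurd ⟨x, y, (hc x y).2 ⟨rfl, rfl⟩⟩ hc'

theorem loop_iff_of_bump (hm : IsMinDroop D i j i₁ j₁) (hD : D₁ = droop D i j i₁ j₁)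
    (ht : D₁ i₁ j₁ = .bump) (hc : ¬ ∃ x y, CrossAt D₁ i₁ j₁ x y) {r : ℕ}
    (hr : ∀ r', ExitsRow D₁ (i₁, j₁, .bottom) r' ↔ r' = r) (hk : r ≤ k) :
    Loop k D i j E ↔ Loop k D₁ i₁ j₁ E := by
  refine ⟨fun h => ?_, fun h => .bump hm hD ht hc ((hr r).2 rfl) hk h⟩
  subst hD
  cases h with
  | jturn hm' hD' ht' =>
    obtain ⟨rfl, rfl⟩ := hm.unique hm'
    subst hD'
    simp [ht] at ht'
  | swap hm' hD' ht' hc' hE' =>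
    obtain ⟨rfl, rfl⟩ := hm.unique hm'
    subst hD'
    exact absurd ⟨_, _, hc'⟩ hc
  | bump hm' hD' ht' hc' hr' hk' hE' =>
    obtain ⟨rfl, rfl⟩ := hm.unique hm'
    subst hD'
    exact hE'
  | terminate hm' hD' ht' hc' hr' hk' =>
    obtain ⟨rfl, rfl⟩ := hm.unique hm'
    subst hD'
    have := (hr _).1 hr'
    omega

theorem loop_iff_of_terminate (hm : IsMinDroop D i j i₁ j₁) (hD : D₁ = droop D i j i₁ j₁)
    (ht : D₁ i₁ j₁ = .bump) (hc : ¬ ∃ x y, CrossAt D₁ i₁ j₁ x y) {r : ℕ}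
    (hr : ∀ r', ExitsRow D₁ (i₁, j₁, .bottom) r' ↔ r' = r) (hk : k < r) :
    Loop k D i j E ↔ E = setTile D₁ i₁ j₁ .cross := by
  constructor
  swap
  · rintro rfl
    exact .terminate hm hD ht hc ((hr r).2 rfl) hk
  intro h
  subst hD
  cases h with
  | jturn hm' hD' ht' =>
    obtain ⟨rfl, rfl⟩ := hm.unique hm'
    subst hD'
    simp [ht] at ht'
  | swap hm' hD' ht' hc' hE' =>
    obtain ⟨rfl, rfl⟩ := hm.unique hm'
    subst hD'
    exact absurd ⟨_, _, hc'⟩ hc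
  | bump hm' hD' ht' hc' hr' hk' hE' =>
    obtain ⟨rfl, rfl⟩ := hm.unique hm'
    subst hD'
    have := (hr _).1 hr'
    omega
  | terminate hm' hD' ht' hc' hr' hk' =>
    obtain ⟨rfl, rfl⟩ := hm.unique hm'
    subst hD'
    rfl

end loop

/-- A tile only sees which edges are used and whether its bottom and right edge belong to the same
pipe. Hence injective renaming of pipes does not change the tiling. -/
theorem tileOf_congr {t b v t' b' v' : ℕ} (h1 : t = 0 ↔ t' = 0) (h2 : b = 0 ↔ b' = 0)
    (h3 : v = 0 ↔ v' = 0) (h4 : v = b ↔ v' = b') : tileOf t b v = tileOf t' b' v' := by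
  unfold tileOf
  simp only [h1, h2, h3, h4]

/-! ### Intermediate tilings and droops -/

/-- The labels during an insertion that transforms `L` into `L'`: the rows above the row `i` are
those of `L'`, the rows below it are those of `L`, and `g` gives the row `i`. -/
def stV (L L' : LPD) (i : ℕ) : ℕ → ℕ → ℕ := fun x => if x < i then L'.V x else L.V x

/-- See `stV`. -/
def stH (L L' : LPD) (i : ℕ) (g : ℕ → ℕ) : ℕ → ℕ → ℕ :=
  fun x => if x < i then L'.H x else if x = i then g else L.H x

/-- See `stV`. -/
def stGrid (L L' : LPD) (i : ℕ) (g : ℕ → ℕ) : Grid := gridOf (stV L L' i) (stH L L' i g)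

section st
variable {L L' : LPD} {i : ℕ} {g : ℕ → ℕ}

theorem stGrid_lt {x y : ℕ} (h : x < i) : stGrid L L' i g x y = L'.grid x y := by
  simp only [stGrid, LPD.grid, gridOf, stV, stH, if_pos h, if_pos (show x - 1 < i by omega)]

theorem stGrid_gt {x y : ℕ} (h : i < x) : stGrid L L' i g x y = L.grid x y := by
  simp only [stGrid, LPD.grid, gridOf, stV, stH, if_neg (show ¬ x < i by omega),
    if_neg (show ¬ x - 1 < i by omega), if_neg (show ¬ x = i by omega)]

theorem stGrid_eq {y : ℕ} : stGrid L L' (i + 1) g (i + 1) (y + 1) =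
    tileOf (L'.V i (y + 1)) (g (y + 1)) (L.V (i + 1) (y + 1)) := by
  rw [stGrid, gridOf_succ]
  simp [stV, stH]

theorem grid_zero_left {y : ℕ} {V H : ℕ → ℕ → ℕ} : gridOf V H 0 y = .blank := by simp [gridOf]
theorem grid_zero_right {x : ℕ} {V H : ℕ → ℕ → ℕ} : gridOf V H x 0 = .blank := by simp [gridOf]

/-- The labels form a configuration. -/
theorem isCfg_st (h0 : g 0 = 0) (hg : ∀ c,
      TileOK (L'.V i (c + 1)) (g (c + 1)) (L.V (i + 1) (c + 1)) (g c) ∨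
      BumpOK (L'.V i (c + 1)) (g (c + 1)) (L.V (i + 1) (c + 1)) (g c))
    (hf : ∃ N, ∀ c, N ≤ c → g c = i + 1) : IsCfg (stV L L' (i + 1)) (stH L L' (i + 1) g) where
  top c := by simp [stV, L'.V_zero]
  V_left x := by unfold stV; split_ifs; exacts [(L'.word x).zero, (L.word x).zero]
  H_top c := by simp [stH, L'.H_zero]
  H_left x := by unfold stH; split_ifs; exacts [L'.H_left x, h0, L.H_left x]
  tile x c := by
    rcases lt_trichotomy x i with h | h | h
    · have := L'.isCfg.tile x c
      simpa only [stV, stH, if_pos (show x < i + 1 by omega), if_pos (show x + 1 < i + 1 by omega)]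
    · subst h
      simpa [stV, stH] using hg c
    · have := L.isCfg.tile x c
      simpa only [stV, stH, if_neg (show ¬ x < i + 1 by omega),
        if_neg (show ¬ x + 1 < i + 1 by omega), if_neg (show ¬ x + 1 = i + 1 by omega)]
  far x hx := by
    unfold stH
    split_ifs with h1 h2
    · exact L'.isCfg.far x hx
    · subst h2; exact hf
    · exact L.isCfg.far x hx

end st

theorem upd_same (h : ℕ → ℕ) (a q : ℕ) : upd h a q a = q := by simp [upd]
theorem upd_of_ne (h : ℕ → ℕ) {a q c : ℕ} (hc : c ≠ a) : upd h a q c = h c := by simp [upd, hc]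

/-- A hop into a hole runs straight down through a crossing. -/
theorem RowHop.of_cross {k x a c d : ℕ} {u v h h' : ℕ → ℕ} (hr : IsRow x u v h) (hv : IsWord x v)
    (hu : u 0 = 0) (hrule : RowHop k u v h a (a + 1) c d h') (h0 : u (a + 1) = 0) (ha : u a ≠ 0)
    (hh : h a ≠ 0) :
    c = a ∧ d = a + 1 ∧ v a = u a ∧ v (a + 1) = 0 ∧ h' = h ∧ h (a - 1) ≠ 0 ∧ h (a + 1) ≠ 0 := by
  obtain _ | a := a
  · exact absurd hu ha
  have h1 := hr.tile a
  have h2 := hr.tile (a + 1)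
  have h3 : v (a + 1) = u (a + 1) ∧ h a = h (a + 1) := by unfold TileOK at h1; omega
  have h4 : v (a + 1 + 1) = 0 ∧ h (a + 1 + 1) = h (a + 1) := by unfold TileOK at h2; omega
  simp only [Nat.add_sub_cancel]
  generalize hb' : a + 1 + 1 = b' at *
  cases hrule with
  | straight hb hq hv => exact ⟨rfl, rfl, hv, h4.1, rfl, by omega, by omega⟩
  | turn hb hq hvc hc =>
    have := hv.inj _ _ (hvc.trans h3.1.symm) (by omega)
    omega
  | bumpSmall hb hq => omega
  | bumpLarge hb hq => omega
  | keep hb => omega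
  | cross hb => omega

section path
variable {k b : ℕ} {L L' : LPD} {α β : ℕ → ℕ}

/-- In the row `i` the insertion exchanges a label with an adjacent hole: there the algorithm
executes a droop. -/
structure DroopAt (b : ℕ) (L L' : LPD) (α β : ℕ → ℕ) (i : ℕ) : Prop where
  ge : b ≤ i
  beta : β i = α i + 1
  hole : L.V i (α i + 1) = 0
  halt : L'.H i (α i) = 0

/-- The tiling before the droop in the row `i`. -/
def droopGrid (L L' : LPD) (α : ℕ → ℕ) (i : ℕ) : Grid :=
  stGrid L L' i (upd (L'.H i) (α i) (L.V i (α i)))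

/-- The tiling after a droop in the column `j` that ends in the row `i`. -/
def landGrid (L L' : LPD) (i j r : ℕ) : Grid := stGrid L L' i (upd (L.H i) j r)

/-- The path runs straight down in the column `j` from the row `i` to the row `i₁ - 1`. -/
structure Shaft (L L' : LPD) (α β : ℕ → ℕ) (i i₁ j r : ℕ) : Prop where
  lt : i < i₁
  pos : j ≠ 0
  ne : r ≠ 0
  stay : ∀ x, i ≤ x → x < i₁ → α x = j ∧ β x = j + 1 ∧ L.V x j = r ∧ L.V x (j + 1) = 0
  horiz : ∀ x, i < x → x < i₁ → L'.H x = L.H x ∧ L.H x (j - 1) ≠ 0 ∧ L.H x j ≠ 0 ∧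
    L.H x (j + 1) ≠ 0
  foot : L.H i₁ j = 0
  head : L'.H i j = 0

theorem InsPath.exists_shaft (hp : InsPath k b L L' α β) {i : ℕ}
    (hi : DroopAt b L L' α β i) : ∃ i₁, Shaft L L' α β i i₁ (α i) (L.V i (α i)) := by
  have hbi := hi.ge
  have hpos := (hp.hop i hbi).pos
  have hj := (hp.hop i hbi).pos_left (L.word i).zero
  -- The shaft ends in the first row where the right edge in this column is unused. Such a row
  -- exists, since below the finite square no pipe runs to the right before the diagonal. Above that
  -- row the pipe goes straight up through crossings, so `RowHop.of_cross` applies.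
  have hex : ∃ x, i < x ∧ L.H x (α i) = 0 := by
    obtain ⟨n, hn⟩ := L.fin
    exact ⟨n + i + α i + 1, by omega, LPD.H_eq_zero hn (by omega) (by omega)⟩
  classical
  obtain ⟨h1, h2⟩ := Nat.find_spec hex
  have hmin : ∀ x, i < x → x < Nat.find hex → L.H x (α i) ≠ 0 := fun x h3 h4 h5 =>
    Nat.find_min hex h4 ⟨h3, h5⟩
  have key : ∀ x, i ≤ x → x < Nat.find hex →
      (α x = α i ∧ β x = α i + 1 ∧ L.V x (α i) = L.V i (α i) ∧ L.V x (α i + 1) = 0) ∧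
      (i < x → L'.H x = L.H x ∧ L.H x (α i - 1) ≠ 0 ∧ L.H x (α i) ≠ 0 ∧
        L.H x (α i + 1) ≠ 0) := by
    intro x hx
    induction x, hx using Nat.le_induction with
    | base => exact fun _ => ⟨⟨rfl, hi.beta, rfl, hi.hole⟩, fun h => absurd h (lt_irrefl _)⟩
    | succ x hx ih =>
      intro hlt
      obtain ⟨⟨ha, hb, hc, hd⟩, _⟩ := ih (by omega)
      have hrule := hp.rule x (by omega)
      rw [ha, hb] at hrule
      have h3 := hmin (x + 1) (by omega) hlt
      obtain ⟨e1, e2, e3, e4, e5, e6, e7⟩ := hrule.of_cross (L.row x) (L.word _) (L.word x).zero hd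
        (by rw [hc]; exact hpos) h3
      exact ⟨⟨e1, e2, e3.trans hc, e4⟩, fun _ => ⟨e5, e6, h3, e7⟩⟩
  exact ⟨Nat.find hex, h1, hj, hpos, fun x h3 h4 => (key x h3 h4).1,
    fun x h3 h4 => (key x (by omega) h4).2 h3, h2, hi.halt⟩

/-- Column `j + 1` is a hole below row `i`, so the tile to the right of the corner is no crossing
and the rectangle of the droop is always one column wide. -/
theorem Shaft.isMinDroop {i i₁ j r : ℕ} (hs : Shaft L L' α β i i₁ j r) (hi : 1 ≤ i) :
    IsMinDroop (droopGrid L L' α i) i j i₁ (j + 1) := by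
  obtain ⟨i, rfl⟩ : ∃ m, i = m + 1 := ⟨i - 1, by omega⟩
  obtain ⟨i₁, rfl⟩ : ∃ m, i₁ = m + 1 := ⟨i₁ - 1, by have := hs.lt; omega⟩
  obtain ⟨j, rfl⟩ : ∃ m, j = m + 1 := ⟨j - 1, by have := hs.pos; omega⟩
  refine ⟨⟨⟨hs.lt, ?_⟩, fun x hx => ?_⟩, ⟨⟨by omega, ?_⟩, fun y hy => hy.1⟩⟩
  · rw [droopGrid, stGrid_gt hs.lt, Ne, LPD.cross_iff]
    have := hs.foot
    tauto
  · by_contra hlt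
    refine hx.2 ?_
    have hx1 : i + 1 < x := hx.1
    rw [droopGrid, stGrid_gt hx.1]
    have h1 := hs.horiz x hx.1 (by omega)
    have h2 := (hs.stay x (by omega) (by omega)).2.2.1
    have := hs.ne
    obtain ⟨x, rfl⟩ : ∃ m, x = m + 1 := ⟨x - 1, by omega⟩
    rw [LPD.cross_iff]
    exact ⟨h1.2.1, h1.2.2.1, by omega⟩
  · have h2 := (hs.stay (i + 1) (by omega) hs.lt).2.2.2
    rw [droopGrid, stGrid_eq, Ne, tileOf_eq_cross]
    tauto

theorem grid_succ (L : LPD) (x y : ℕ) :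
    L.grid (x + 1) (y + 1) = tileOf (L.V x (y + 1)) (L.H (x + 1) (y + 1)) (L.V (x + 1) (y + 1)) :=
  gridOf_succ ..

section droop
variable {D : Grid} {i j i₁ x y : ℕ}

theorem droop_nw : droop D i j i₁ (j + 1) i j =
    match D i j with
    | .rturn => .blank
    | .bump => .jturn
    | t => t := by
  unfold droop
  rw [if_pos ⟨rfl, rfl⟩]

theorem droop_ne (h : i < i₁) : droop D i j i₁ (j + 1) i (j + 1) =
    match D i (j + 1) with
    | .horiz => .rturn
    | .jturn => .vert
    | t => t := by
  unfold droop
  rw [if_neg (by omega), if_neg (by omega), if_neg (by omega), if_pos ⟨rfl, rfl⟩]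

theorem droop_sw (h : i < i₁) : droop D i j i₁ (j + 1) i₁ j =
    match D i₁ j with
    | .vert => .rturn
    | .jturn => .horiz
    | t => t := by
  unfold droop
  rw [if_neg (by omega), if_neg (by omega), if_pos ⟨rfl, rfl⟩]

theorem droop_se (h : i < i₁) : droop D i j i₁ (j + 1) i₁ (j + 1) =
    match D i₁ (j + 1) with
    | .blank => .jturn
    | .rturn => .bump
    | t => t := by
  unfold droop
  rw [if_neg (by omega), if_pos ⟨rfl, rfl⟩]

theorem droop_left (h : i < x) (h' : x < i₁) : droop D i j i₁ (j + 1) x j = .horiz := by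
  unfold droop
  rw [if_neg (by omega), if_neg (by omega), if_neg (by omega), if_neg (by omega),
    if_pos ⟨rfl, h, h'⟩]

theorem droop_right (h : i < x) (h' : x < i₁) :
    droop D i j i₁ (j + 1) x (j + 1) = .cross := by
  unfold droop
  rw [if_neg (by omega), if_neg (by omega), if_neg (by omega), if_neg (by omega),
    if_neg (by omega), if_neg (by omega), if_pos (.inr ⟨rfl, h, h'⟩)]

theorem droop_outside (h : x < i ∨ i₁ < x ∨ (y ≠ j ∧ y ≠ j + 1)) (h' : i < i₁) :
    droop D i j i₁ (j + 1) x y = D x y := by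
  unfold droop
  rw [if_neg (by omega), if_neg (by omega), if_neg (by omega), if_neg (by omega),
    if_neg (by omega), if_neg (by omega), if_neg (by omega)]

end droop

/-- Along the shaft the words of `L'` are those of `L` with the columns `j` and `j + 1` exchanged,
which is what rerouting the pipe by one column does. Only these two columns need to be compared: at
the four corners and on the sides. -/
theorem Shaft.droop_eq (hp : InsPath k b L L' α β) {i i₁ j r : ℕ}
    (hs : Shaft L L' α β i i₁ j r) (hb : 1 ≤ b) (hi : b ≤ i) :
    landGrid L L' i₁ j r = droop (droopGrid L L' α i) i j i₁ (j + 1) := by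
  have hlt := hs.lt
  have hne := hs.ne
  have hw : ∀ x, i ≤ x → x < i₁ → L'.V x = swp (L.V x) j (j + 1) := fun x h1 h2 => by
    rw [hp.word x (by omega), (hs.stay x h1 h2).1, (hs.stay x h1 h2).2.1]
  obtain ⟨i, rfl⟩ : ∃ m, i = m + 1 := ⟨i - 1, by omega⟩
  obtain ⟨i₁, rfl⟩ : ∃ m, i₁ = m + 1 := ⟨i₁ - 1, by omega⟩
  obtain ⟨j, rfl⟩ : ∃ m, j = m + 1 := ⟨j - 1, by have := hs.pos; omega⟩
  have hi0 := hs.stay (i + 1) le_rfl hlt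
  have hi1 := hs.stay i₁ (by omega) (by omega)
  funext x y
  by_cases hout : x < i + 1 ∨ i₁ + 1 < x ∨ (y ≠ j + 1 ∧ y ≠ j + 1 + 1)
  · rw [droop_outside hout hlt]
    obtain _ | y := y
    · simp only [landGrid, droopGrid, stGrid, grid_zero_right]
    rcases lt_trichotomy x (i + 1) with hx | rfl | hx
    · rw [landGrid, droopGrid, stGrid_lt hx, stGrid_lt (by omega)]
    · rw [landGrid, stGrid_lt hlt, droopGrid, stGrid_eq, hi0.1, upd_of_ne _ (by omega), grid_succ,
        hw _ le_rfl hlt, swp_of_ne _ (by omega) (by omega)]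
    rcases lt_trichotomy x (i₁ + 1) with hx1 | rfl | hx1
    · obtain ⟨x, rfl⟩ : ∃ m, x = m + 1 := ⟨x - 1, by omega⟩
      rw [landGrid, stGrid_lt hx1, grid_succ, (hs.horiz (x + 1) (by omega) (by omega)).1,
        hw _ (by omega) (by omega), hw _ (by omega) hx1, droopGrid, stGrid_gt hx, grid_succ,
        swp_of_ne _ (by omega) (by omega), swp_of_ne _ (by omega) (by omega)]
    · rw [landGrid, stGrid_eq, hw i₁ (by omega) (by omega), droopGrid, stGrid_gt hx, grid_succ,
        swp_of_ne _ (by omega) (by omega), upd_of_ne _ (by omega)]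
    · rw [landGrid, droopGrid, stGrid_gt hx1, stGrid_gt hx]
  have hy : y = j + 1 ∨ y = j + 1 + 1 := by omega
  rcases (by omega : x = i + 1 ∨ x = i₁ + 1 ∨ (i + 1 < x ∧ x < i₁ + 1)) with rfl | rfl | hx
  · have hw0 := hw (i + 1) le_rfl hlt
    have hh := hs.head
    have ht := (L'.row i).tile j
    have ht' := (L'.row i).tile (j + 1)
    rw [hw0, swp_left, hi0.2.2.2] at ht
    rw [hw0, swp_right, hi0.2.2.1] at ht'
    unfold TileOK at ht ht'
    rw [landGrid, stGrid_lt hlt]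
    rcases hy with rfl | rfl
    · rw [droop_nw, droopGrid, stGrid_eq, hi0.1, upd_same, hi0.2.2.1, grid_succ, hw0, swp_left,
        hi0.2.2.2]
      unfold tileOf
      split_ifs <;> first | rfl | omega
    · rw [droop_ne hlt, droopGrid, stGrid_eq, hi0.1, upd_of_ne _ (by omega), hi0.2.2.2, grid_succ,
        hw0, swp_right, hi0.2.2.1]
      unfold tileOf
      split_ifs <;> first | rfl | omega
  · have hf := hs.foot
    have ht := (L.row i₁).tile j
    have ht' := (L.row i₁).tile (j + 1)
    rw [hi1.2.2.1] at ht
    rw [hi1.2.2.2] at ht'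
    unfold TileOK at ht ht'
    rcases hy with rfl | rfl
    · rw [landGrid, stGrid_eq, hw i₁ (by omega) (by omega), droop_sw hlt, droopGrid,
        stGrid_gt hlt, grid_succ, swp_left, upd_same, hi1.2.2.1,
        hi1.2.2.2]
      unfold tileOf
      split_ifs <;> first | rfl | omega
    · rw [landGrid, stGrid_eq, hw i₁ (by omega) (by omega), droop_se hlt, droopGrid,
        stGrid_gt hlt, grid_succ, swp_right, upd_of_ne _ (by omega),
        hi1.2.2.1, hi1.2.2.2]
      unfold tileOf
      split_ifs <;> rfl
  · obtain ⟨x, rfl⟩ : ∃ m, x = m + 1 := ⟨x - 1, by omega⟩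
    have hx0 := hs.stay x (by omega) (by omega)
    have hx2 := hs.stay (x + 1) (by omega) (by omega)
    have hx3 := hs.horiz (x + 1) (by omega) (by omega)
    have ht := (L.row x).tile j
    have ht' := (L.row x).tile (j + 1)
    rw [hx0.2.2.1] at ht
    rw [hx0.2.2.2] at ht'
    unfold TileOK at ht ht'
    rw [landGrid, stGrid_lt hx.2]
    have hw1 := hw x (by omega) (by omega)
    have hw2 := hw (x + 1) (by omega) hx.2
    rcases hy with rfl | rfl
    · rw [grid_succ, hx3.1, hw1, hw2, droop_left hx.1 hx.2, swp_left, swp_left, hx0.2.2.2,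
        hx2.2.2.2]
      unfold tileOf
      split_ifs <;> first | rfl | omega
    · rw [grid_succ, hx3.1, hw1, hw2, droop_right hx.1 hx.2, swp_right, swp_right, hx0.2.2.1,
        hx2.2.2.1]
      unfold tileOf
      split_ifs <;> first | rfl | omega

end path

theorem RowHop.of_hole {k a b c d : ℕ} {u v h h' : ℕ → ℕ} (hr : RowHop k u v h a b c d h')
    (h0 : u b = 0) : b = a + 1 ∧
    ((v (a + 1) = 0 ∧ v a = u a ∧ c = a ∧ d = a + 1 ∧ h' = h) ∨
    (v (a + 1) = 0 ∧ v c = u a ∧ c < a ∧ d = c + 1 ∧ h' = upd (upd h a (u a)) c 0) ∨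
    (v (a + 1) ≠ 0 ∧ v (a + 1) ≤ k ∧ c = a + 1 ∧ d = a + 2 ∧
      h' = upd (upd h a (u a)) (a + 1) 0) ∨
    (k < v (a + 1) ∧ v c = u a ∧ d = a + 1 ∧
      h' = fun e => if c ≤ e ∧ e ≤ a then v (a + 1) else h e)) := by
  cases hr with
  | straight hb hq hv => tauto
  | turn hb hq hv hc => tauto
  | bumpSmall hb hq hk => tauto
  | bumpLarge hb hk hv => tauto
  | keep hb => exact absurd h0 hb
  | cross hb => exact absurd h0 hb

theorem RowHop.of_label {k a b c d : ℕ} {u v h h' : ℕ → ℕ} (hr : RowHop k u v h a b c d h')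
    (h0 : u b ≠ 0) :
    (v c = u a ∧ v d = u b ∧ c < d ∧
      h' = fun e => if h e = u a then u b else if h e = u b then u a else h e) ∨
    ∃ e, v e = u b ∧ e < a ∧ v a = u a ∧ v (a + 1) = 0 ∧ c = a ∧ d = a + 1 ∧
      h' = fun e => if e = a then 0 else if a < e ∧ e < b then u a else h e := by
  cases hr with
  | straight hb => exact absurd hb h0
  | turn hb => exact absurd hb h0
  | bumpSmall hb => exact absurd hb h0
  | bumpLarge hb => exact absurd hb h0
  | keep hb hc hd hcd => exact .inl ⟨hc, hd, hcd, rfl⟩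
  | cross hb he hea hv hq => exact .inr ⟨_, he, hea, hv, hq, rfl, rfl, rfl⟩

/-- Pipes with labels `≤ k` do not cross. -/
theorem LPD.Inc.cross {L : LPD} {k x y : ℕ} (h : L.Inc k)
    (hc : L.grid (x + 1) (y + 1) = .cross) : k < L.H (x + 1) y := by
  have h1 := LPD.cross_spec hc
  by_contra h2
  have := (L.row x).small_pass (h (x + 1)) (c := y) (by omega) (by omega) (by omega)
  omega

section path
variable {k b : ℕ} {L L' : LPD} {α β : ℕ → ℕ} {i m j r : ℕ}

theorem Shaft.top_eq (hp : InsPath k b L L' α β) (hs : Shaft L L' α β i (m + 1) j r)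
    (hi : b ≤ i) : L'.V m = swp (L.V m) j (j + 1) := by
  have hlt := hs.lt
  have := hs.stay m (by omega) (by omega)
  rw [hp.word m (by omega), this.1, this.2.1]

/-- What is known about the row in which a droop ends. -/
theorem Shaft.base (hs : Shaft L L' α β i (m + 1) j r) :
    L.V m j = r ∧ L.V m (j + 1) = 0 ∧ (L.V (m + 1) j = r ∨ L.V (m + 1) j = 0) ∧
      L.V (m + 1) (j + 1) = L.H (m + 1) (j + 1) := by
  have hlt := hs.lt
  have hm := hs.stay m (by omega) (by omega)
  have hf := hs.foot
  have h0 := hs.pos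
  obtain ⟨j, rfl⟩ : ∃ m, j = m + 1 := ⟨j - 1, by omega⟩
  have ht := (L.row m).tile j
  have ht' := (L.row m).tile (j + 1)
  unfold TileOK at ht ht'
  omega

theorem Shaft.isCfg (hp : InsPath k b L L' α β) (hs : Shaft L L' α β i (m + 1) j r)
    (hi : b ≤ i) : IsCfg (stV L L' (m + 1)) (stH L L' (m + 1) (upd (L.H (m + 1)) j r)) := by
  have hw := hs.top_eq hp hi
  have hm := hs.base
  have hf := hs.foot
  have h0 := hs.pos
  have hne := hs.ne
  obtain ⟨j, rfl⟩ : ∃ m, j = m + 1 := ⟨j - 1, by omega⟩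
  refine isCfg_st ?_ (fun c => ?_) ?_
  · rw [upd_of_ne _ (by omega)]; exact L.H_left _
  · have ht := (L.row m).tile c
    rw [hw]
    unfold TileOK at ht
    rcases (by omega : c = j ∨ c = j + 1 ∨ (c ≠ j ∧ c ≠ j + 1)) with rfl | rfl | hc
    · left
      rw [swp_left, upd_same, upd_of_ne _ (by omega)]
      unfold TileOK
      omega
    · rw [swp_right, upd_same, upd_of_ne _ (by omega)]
      unfold TileOK BumpOK
      omega
    · left
      rw [swp_of_ne _ (by omega) (by omega), upd_of_ne _ (by omega), upd_of_ne _ (by omega)]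
      exact ht
  · obtain ⟨N, hN⟩ := (L.row m).far
    exact ⟨N + j + 2, fun c hc => by rw [upd_of_ne _ (by omega)]; exact hN c (by omega)⟩

theorem Shaft.land_cross (hs : Shaft L L' α β i (m + 1) j r) {x y : ℕ}
    (hc : landGrid L L' (m + 1) j r x y = .cross) :
    ∃ x' y', x = x' + 1 ∧ y = y' + 1 ∧
      ((x' < m ∧ L'.grid x y = .cross ∧ stV L L' (m + 1) x y = L'.V x y ∧
        stH L L' (m + 1) (upd (L.H (m + 1)) j r) x y' = L'.H x y') ∨
      (m ≤ x' ∧ L.grid x y = .cross ∧ stV L L' (m + 1) x y = L.V x y ∧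
        stH L L' (m + 1) (upd (L.H (m + 1)) j r) x y' = L.H x y')) := by
  obtain _ | x := x
  · simp [landGrid, stGrid, grid_zero_left] at hc
  obtain _ | y := y
  · simp [landGrid, stGrid, grid_zero_right] at hc
  refine ⟨x, y, rfl, rfl, ?_⟩
  rcases lt_trichotomy x m with hx | rfl | hx
  · left
    rw [landGrid, stGrid_lt (by omega)] at hc
    exact ⟨hx, hc, by rw [stV, if_pos (by omega)], by rw [stH, if_pos (by omega)]⟩
  · right
    have hm := hs.base
    rw [landGrid, stGrid_eq, tileOf_eq_cross] at hc
    have h1 : y + 1 ≠ j := by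
      rintro rfl
      rw [upd_same] at hc
      omega
    rw [upd_of_ne _ h1] at hc
    have h2 : y ≠ j := by
      rintro rfl
      omega
    refine ⟨le_rfl, ?_, by rw [stV, if_neg (by omega)], ?_⟩
    · rw [grid_succ, tileOf_eq_cross]; exact hc
    · rw [stH, if_neg (by omega), if_pos rfl, upd_of_ne _ h2]
  · right
    rw [landGrid, stGrid_gt (by omega)] at hc
    exact ⟨hx.le, hc, by rw [stV, if_neg (by omega)],
      by rw [stH, if_neg (by omega), if_neg (by omega)]⟩

/-- Labels identify pipes, so a crossing of the two pipes of the bump is a crossing with the labels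
`q` and `r`: of `L'` above the landing row, of `L` in it or below. -/
theorem Shaft.crossAt (hp : InsPath k b L L' α β) (hs : Shaft L L' α β i (m + 1) j r)
    (hi : b ≤ i) {q : ℕ} (hq : L.V (m + 1) (j + 1) = q) (hq0 : q ≠ 0) {x y : ℕ}
    (hc : CrossAt (landGrid L L' (m + 1) j r) (m + 1) (j + 1) x y) :
    ∃ x' y', x = x' + 1 ∧ y = y' + 1 ∧
      ((x' < m ∧ L'.grid x y = .cross ∧ ((L'.V x y = q ∧ L'.H x y' = r) ∨
        (L'.V x y = r ∧ L'.H x y' = q))) ∨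
      (m ≤ x' ∧ L.grid x y = .cross ∧ ((L.V x y = q ∧ L.H x y' = r) ∨
        (L.V x y = r ∧ L.H x y' = q)))) := by
  obtain ⟨x', y', rfl, rfl, h⟩ := hs.land_cross hc.1
  refine ⟨x', y', rfl, rfl, ?_⟩
  have hp2 := hc.2
  have hv : stV L L' (m + 1) (m + 1) (j + 1) = q := by rw [stV, if_neg (by omega), hq]
  have hh : stH L L' (m + 1) (upd (L.H (m + 1)) j r) (m + 1) j = r := by
    rw [stH, if_neg (by omega), if_pos rfl, upd_same]
  have hne := hs.ne
  rcases h with ⟨h1, h2, h3, h4⟩ | ⟨h1, h2, h3, h4⟩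
  all_goals
    have h5 := LPD.cross_spec h2
    rw [landGrid, stGrid, (hs.isCfg hp hi).samePair_iff (by omega)
      (by simp only [Nat.add_sub_cancel]; omega) (by omega)
      (by simp only [Nat.add_sub_cancel]; omega)] at hp2
    simp only [Nat.add_sub_cancel] at hp2
    rw [h3, h4, hv, hh] at hp2
  · left; refine ⟨h1, h2, ?_⟩; omega
  · right; refine ⟨h1, h2, ?_⟩; omega

theorem Shaft.crossAt_of (hp : InsPath k b L L' α β) (hs : Shaft L L' α β i (m + 1) j r)
    (hi : b ≤ i) {q : ℕ} (hq : L.V (m + 1) (j + 1) = q) (hq0 : q ≠ 0) {x y : ℕ} (hx : m < x)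
    (hc : L.grid (x + 1) (y + 1) = .cross) (hv : L.V (x + 1) (y + 1) = r)
    (hh : L.H (x + 1) y = q) :
    CrossAt (landGrid L L' (m + 1) j r) (m + 1) (j + 1) (x + 1) (y + 1) := by
  have hne := hs.ne
  have hv' : stV L L' (m + 1) (m + 1) (j + 1) = q := by rw [stV, if_neg (by omega), hq]
  have hh' : stH L L' (m + 1) (upd (L.H (m + 1)) j r) (m + 1) j = r := by
    rw [stH, if_neg (by omega), if_pos rfl, upd_same]
  have h3 : stV L L' (m + 1) (x + 1) (y + 1) = r := by rw [stV, if_neg (by omega), hv]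
  have h4 : stH L L' (m + 1) (upd (L.H (m + 1)) j r) (x + 1) y = q := by
    rw [stH, if_neg (by omega), if_neg (by omega), hh]
  refine ⟨by rw [landGrid, stGrid_gt (by omega)]; exact hc, ?_⟩
  rw [landGrid, stGrid, (hs.isCfg hp hi).samePair_iff (by omega)
      (by simp only [Nat.add_sub_cancel]; omega) (by omega)
      (by simp only [Nat.add_sub_cancel]; omega)]
  simp only [Nat.add_sub_cancel]
  omega

theorem Shaft.exitsRow (hp : InsPath k b L L' α β) (hs : Shaft L L' α β i (m + 1) j r)
    (hi : b ≤ i) {q : ℕ} (hq : L.V (m + 1) (j + 1) = q) (hq0 : q ≠ 0) (r' : ℕ) :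
    ExitsRow (landGrid L L' (m + 1) j r) (m + 1, j + 1, .bottom) r' ↔ r' = q := by
  have hv' : lab (stV L L' (m + 1)) (stH L L' (m + 1) (upd (L.H (m + 1)) j r))
      (m + 1, j + 1, .bottom) = q := by
    change stV L L' (m + 1) (m + 1) (j + 1) = q
    rw [stV, if_neg (by omega), hq]
  rw [landGrid, stGrid, (hs.isCfg hp hi).exitsRow_iff (by rw [hv']; exact hq0), hv']

/-- The tile in the corner into which a droop goes. -/
theorem Shaft.land_corner (hp : InsPath k b L L' α β) (hs : Shaft L L' α β i (m + 1) j r)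
    (hi : b ≤ i) : landGrid L L' (m + 1) j r (m + 1) (j + 1) =
      if L.V (m + 1) (j + 1) = 0 then .jturn else .bump := by
  have hm := hs.base
  have hne := hs.ne
  rw [landGrid, stGrid_eq, hs.top_eq hp hi, swp_right, upd_of_ne _ (by omega), hm.1]
  unfold tileOf
  split_ifs <;> first | rfl | omega

/-- The tile `(m + 1, j)` was vertical and the droop makes it an `rturn`. It is adjacent to the new
`jturn`, so the next droop starts there. -/
theorem Shaft.loop_straight (hp : InsPath k b L L' α β) (hs : Shaft L L' α β i (m + 1) j r)
    (hb : 1 ≤ b) (hi : b ≤ i) (h0 : L.V (m + 1) (j + 1) = 0) (hj : L.V (m + 1) j = r)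
    (ha : α (m + 1) = j) (hH : L'.H (m + 1) = L.H (m + 1)) (E : Grid) :
    Loop k (droopGrid L L' α i) i j E ↔ Loop k (droopGrid L L' α (m + 1)) (m + 1) j E := by
  have hg : droopGrid L L' α (m + 1) = landGrid L L' (m + 1) j r := by
    rw [droopGrid, landGrid, ha, hH, hj]
  rw [hg]
  have hp0 := hs.pos
  refine loop_iff_of_jturn (hs.isMinDroop (by omega)) (hs.droop_eq hp hb hi)
    (by rw [hs.land_corner hp hi, if_pos h0]) ⟨⟨by omega, ?_⟩, fun y hy => ?_⟩
  · have hb := hs.base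
    have hw := hs.top_eq hp hi
    have hne := hs.ne
    obtain ⟨j, rfl⟩ : ∃ m, j = m + 1 := ⟨j - 1, by omega⟩
    rw [landGrid, stGrid_eq, tileOf_eq_rturn, upd_same, hw, swp_left]
    omega
  · have := hy.1
    omega

/-- The tile `(m + 1, j)` was a `jturn`, so the pipe continues to the left. Being small it passes
only empty columns, and the nearest `rturn` is its own, in column `c`. -/
theorem Shaft.loop_turn (hp : InsPath k b L L' α β) (hs : Shaft L L' α β i (m + 1) j r)
    (hinc : L.Inc k) (hb : 1 ≤ b) (hi : b ≤ i) (h0 : L.V (m + 1) (j + 1) = 0) {c : ℕ}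
    (hc : L.V (m + 1) c = r)
    (hcj : c < j) (ha : α (m + 1) = c) (hH : L'.H (m + 1) = upd (upd (L.H (m + 1)) j r) c 0)
    (E : Grid) :
    Loop k (droopGrid L L' α i) i j E ↔ Loop k (droopGrid L L' α (m + 1)) (m + 1) c E := by
  have hbs := hs.base
  have hp0 := hs.pos
  have hne := hs.ne
  have hlt := hs.lt
  have hmv := ((L.row m).move_to (L.word m).zero (L.word _) hbs.1 hc hne).resolve_left (by omega)
  obtain ⟨_, huc, hvj, hhj, hc0, hhc, hcar⟩ := hmv
  have hsm : r ≤ k := by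
    have h1 := hp.hop m (by omega)
    have h2 := hs.stay m (by omega) (by omega)
    have h3 := h1.small
    rw [h2.1, h2.2.2.1] at h3
    exact h3
  have hg : droopGrid L L' α (m + 1) = landGrid L L' (m + 1) j r := by
    rw [droopGrid, landGrid, ha, hH, hc]
    congr 1
    funext e
    have h4 := hcar c le_rfl hcj
    unfold upd
    split_ifs <;> first | rfl | (subst_vars; omega)
  rw [hg]
  have hw := hs.top_eq hp hi
  refine loop_iff_of_jturn (hs.isMinDroop (by omega)) (hs.droop_eq hp hb hi)
    (by rw [hs.land_corner hp hi, if_pos h0]) ⟨⟨by omega, ?_⟩, fun y hy => ?_⟩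
  · have h4 := hcar c le_rfl hcj
    obtain ⟨c, rfl⟩ : ∃ m, c = m + 1 := ⟨c - 1, by omega⟩
    rw [landGrid, stGrid_eq, tileOf_eq_rturn, upd_of_ne _ (by omega), hw,
      swp_of_ne _ (by omega) (by omega)]
    omega
  · by_contra hlt'
    obtain ⟨hy1, hy2⟩ := hy
    obtain ⟨y, rfl⟩ : ∃ m, y = m + 1 := ⟨y - 1, by omega⟩
    rw [landGrid, stGrid_eq, tileOf_eq_rturn] at hy2
    refine hy2.1 ?_
    rcases (by omega : y + 1 = j ∨ y + 1 < j) with h5 | h5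
    · rw [h5]; exact hvj
    · exact ((L.row m).small_carry (hinc _) hne hsm hcar (by omega) h5).2

/-- Both labels of the bump are `≤ k`, and a crossing of `L` or of `L'` has a horizontal label `>
k`. So the pipes have no crossing and the algorithm goes on with the other pipe. -/
theorem Shaft.loop_bumpSmall (hp : InsPath k b L L' α β) (hs : Shaft L L' α β i (m + 1) j r)
    (hinc : L.Inc k) (hb : 1 ≤ b) (hi : b ≤ i) {q : ℕ} (hq : L.V (m + 1) (j + 1) = q)
    (hq0 : q ≠ 0) (hqk : q ≤ k)
    (ha : α (m + 1) = j + 1) (hH : L'.H (m + 1) = upd (upd (L.H (m + 1)) j r) (j + 1) 0)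
    (E : Grid) :
    Loop k (droopGrid L L' α i) i j E ↔ Loop k (droopGrid L L' α (m + 1)) (m + 1) (j + 1) E := by
  have hbs := hs.base
  have hlt := hs.lt
  have hsm : r ≤ k := by
    have h1 := hp.hop m (by omega)
    have h2 := hs.stay m (by omega) (by omega)
    have h3 := h1.small
    rw [h2.1, h2.2.2.1] at h3
    exact h3
  have hg : droopGrid L L' α (m + 1) = landGrid L L' (m + 1) j r := by
    rw [droopGrid, landGrid, ha, hH, hq]
    congr 1
    funext e
    unfold upd
    split_ifs <;> first | rfl | (subst_vars; omega)
  rw [hg]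
  refine loop_iff_of_bump (hs.isMinDroop (by omega)) (hs.droop_eq hp hb hi)
    (by rw [hs.land_corner hp hi, if_neg (by omega)]) ?_ (hs.exitsRow hp hi hq hq0) hqk
  rintro ⟨x, y, hc⟩
  obtain ⟨x', y', rfl, rfl, h | h⟩ := hs.crossAt hp hi hq hq0 hc
  · have := (hp.inc hinc).cross h.2.1
    omega
  · have := hinc.cross h.2.1
    omega

end path

/-! ### Bumps with a large label, and the end of the loop -/

/-- Exchange two labels. -/
def relabel (r q e : ℕ) : ℕ := if e = r then q else if e = q then r else e

section relabel
variable {r q : ℕ}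

theorem relabel_eq_zero (hr : r ≠ 0) (hq : q ≠ 0) {e : ℕ} : relabel r q e = 0 ↔ e = 0 := by
  unfold relabel; split_ifs <;> omega

theorem relabel_inj {e f : ℕ} : relabel r q e = relabel r q f ↔ e = f := by
  unfold relabel; split_ifs <;> omega

theorem swp_eq_relabel {n a b : ℕ} {u : ℕ → ℕ} (hu : IsWord n u) (ha : u a = r) (hb : u b = q)
    (hr : r ≠ 0) (hq : q ≠ 0) (c : ℕ) : swp u a b c = relabel r q (u c) := by
  unfold swp relabel
  have h1 := hu.inj c a
  have h2 := hu.inj c b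
  split_ifs <;> subst_vars <;> omega

end relabel

section path
variable {k b : ℕ} {L L' : LPD} {α β : ℕ → ℕ} {i m j r : ℕ}

/-- As long as the right entry of the hop is not a hole, only `keep` can have been applied, so the
same two pipes are renamed in each row. -/
theorem InsPath.track (hp : InsPath k b L L' α β) {n q : ℕ} (hn : b ≤ n) (hr : L.V n (α n) = r)
    (hq : L.V n (β n) = q) (hq0 : q ≠ 0) {x : ℕ} (hx : n ≤ x)
    (hne : ∀ x', n ≤ x' → x' ≤ x → L.V x' (β x') ≠ 0) :
    L.V x (α x) = r ∧ L.V x (β x) = q ∧ (n < x → ∀ e, L'.H x e = relabel r q (L.H x e)) := by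
  induction x, hx using Nat.le_induction with
  | base => exact ⟨hr, hq, fun h => absurd h (lt_irrefl _)⟩
  | succ x hx ih =>
    obtain ⟨h1, h2, _⟩ := ih fun x' h3 h4 => hne x' h3 (by omega)
    have hrule := hp.rule x (by omega)
    rcases hrule.of_label (by omega) with ⟨h3, h4, _, h5⟩ | ⟨e, _, _, _, h3, h4, h5, _⟩
    · refine ⟨h3.trans h1, h4.trans h2, fun _ e => ?_⟩
      rw [h5, h1, h2]
      rfl
    · exact absurd (h5 ▸ h3) (hne (x + 1) (by omega) le_rfl)

theorem InsPath.grid_eq_of_relabel (hp : InsPath k b L L' α β) {x q : ℕ} (hb : b ≤ x)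
    (hr : r ≠ 0) (hq : q ≠ 0) (h1 : L.V x (α x) = r ∧ L.V x (β x) = q)
    (h2 : L.V (x + 1) (α (x + 1)) = r ∧ L.V (x + 1) (β (x + 1)) = q)
    (h3 : ∀ e, L'.H (x + 1) e = relabel r q (L.H (x + 1) e)) (y : ℕ) :
    L'.grid (x + 1) y = L.grid (x + 1) y := by
  obtain _ | y := y
  · simp [LPD.grid, grid_zero_right]
  rw [grid_succ, grid_succ, hp.word x hb, hp.word (x + 1) (by omega), h3,
    swp_eq_relabel (L.word _) h1.1 h1.2 hr hq, swp_eq_relabel (L.word _) h2.1 h2.2 hr hq]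
  exact tileOf_congr (relabel_eq_zero hr hq) (relabel_eq_zero hr hq) (relabel_eq_zero hr hq)
    relabel_inj

/-- A crossing higher up would put `q` to the left of `r` in the word `m` of `L'`, where `r` is in
column `j + 1`. But labels only move left on the way down, and `q` is in column `j + 1` one row
below. -/
theorem Shaft.not_cross_top (hp : InsPath k b L L' α β) (hs : Shaft L L' α β i (m + 1) j r)
    (hi : b ≤ i) {q : ℕ} (hq : L.V (m + 1) (j + 1) = q) (hrq : r < q) {x y : ℕ} (hx : x < m)
    (hc : L'.grid (x + 1) (y + 1) = .cross) (h : (L'.V (x + 1) (y + 1) = q ∧ L'.H (x + 1) y = r) ∨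
      (L'.V (x + 1) (y + 1) = r ∧ L'.H (x + 1) y = q)) : False := by
  have hne := hs.ne
  have hbs := hs.base
  have h1 := LPD.cross_spec hc
  obtain ⟨h2, h3⟩ := h.resolve_left (by omega)
  obtain ⟨c, h4, h5⟩ := LPD.cross_below hc
  obtain ⟨cb, ct, h6, h7, h8⟩ := LPD.inversion_mono (m := m) (h5.trans h3) h2 hne hrq h4 hx
  have hw := hs.top_eq hp hi
  have h9 : ct = j + 1 := (L'.word m).inj _ _ (by rw [h7, hw, swp_right]; exact hbs.1.symm)
    (by omega)
  rw [hw] at h6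
  have h10 : cb ≠ j := by
    rintro rfl
    rw [swp_left] at h6
    omega
  rw [swp_of_ne _ h10 (by omega)] at h6
  have := (L.row m).move_le (L.word m).zero (L.word _) h6 hq (by omega)
  omega

theorem Shaft.small (hp : InsPath k b L L' α β) (hs : Shaft L L' α β i (m + 1) j r)
    (hi : b ≤ i) : r ≤ k := by
  have hlt := hs.lt
  have h1 := hp.hop m (by omega)
  have h2 := hs.stay m (by omega) (by omega)
  have h3 := h1.small
  rw [h2.1, h2.2.2.1] at h3
  exact h3

/-- A droop that ends in a bump whose right pipe has a label `> k`. -/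
structure Shaft.LargeBump (k : ℕ) (L L' : LPD) (α β : ℕ → ℕ) (m j r q c : ℕ) : Prop where
  label : L.V (m + 1) (j + 1) = q
  large : k < q
  foot : L.V (m + 1) c = r
  le : c ≤ j
  alpha : α (m + 1) = c
  beta : β (m + 1) = j + 1
  horiz : L'.H (m + 1) = fun e => if c ≤ e ∧ e ≤ j then q else L.H (m + 1) e

/-- Once the bump is replaced by a crossing, the rows up to `m + 1` are final. In the columns from
`c` to `j` the labels of `L'` have `q` where the landing tiling has `r`, which the tiles do not
notice. -/
theorem Shaft.settled (hp : InsPath k b L L' α β) (hs : Shaft L L' α β i (m + 1) j r)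
    (hinc : L.Inc k) (hi : b ≤ i) {q c : ℕ} (hl : Shaft.LargeBump k L L' α β m j r q c) {x : ℕ}
    (hx : x ≤ m + 1) (y : ℕ) :
    setTile (landGrid L L' (m + 1) j r) (m + 1) (j + 1) .cross x y = L'.grid x y := by
  have hlt := hs.lt
  have hbs := hs.base
  have hw := hs.top_eq hp hi
  have hsm := hs.small hp hi
  have hne := hs.ne
  have hw1 := hp.word (m + 1) (by omega)
  rw [hl.alpha, hl.beta] at hw1
  have hle := hl.le
  have hlab := hl.label
  have hlarge := hl.large
  have hfoot := hl.foot
  rcases (by omega : x < m + 1 ∨ x = m + 1) with hx | rfl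
  · rw [setTile, if_neg (by omega), landGrid, stGrid_lt hx]
  obtain _ | y := y
  · simp [setTile, LPD.grid, landGrid, stGrid, grid_zero_right]
  by_cases hy : y = j
  · subst hy
    rw [setTile, if_pos ⟨rfl, rfl⟩, grid_succ, hw, swp_right, hw1, swp_right, hl.horiz]
    rw [eq_comm, tileOf_eq_cross]
    simp only [show ¬ (y + 1 ≤ y) by omega, and_false, if_false]
    omega
  · rw [setTile, if_neg (by omega), landGrid, stGrid_eq, grid_succ, hw1, hl.horiz]
    have hmv := (L.row m).move_to (L.word m).zero (L.word _) hbs.1 hfoot hne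
    by_cases h1 : y + 1 = c
    · have h2 : upd (L.H (m + 1)) j r (y + 1) = r := by
        by_cases h3 : y + 1 = j
        · rw [h3, upd_same]
        · rw [upd_of_ne _ h3]
          exact (hmv.resolve_left (by omega)).2.2.2.2.2.2 _ (by omega) (by omega)
      rw [h1] at h2 ⊢
      rw [h2, swp_left, hfoot, hlab]
      simp only [le_refl, hle, and_self, if_true]
      apply tileOf_congr <;> omega
    · rw [swp_of_ne _ h1 (by omega)]
      by_cases h2 : c < y + 1 ∧ y + 1 ≤ j
      · have h3 : L.V (m + 1) (y + 1) = 0 := by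
          have hmv' := hmv.resolve_left (by omega)
          rcases (by omega : y + 1 = j ∨ y + 1 < j) with h4 | h4
          · rw [h4]; exact hmv'.2.2.1
          · exact ((L.row m).small_carry (hinc _) hne hsm hmv'.2.2.2.2.2.2 h2.1 h4).2
        have h4 : upd (L.H (m + 1)) j r (y + 1) = r := by
          by_cases h3 : y + 1 = j
          · rw [h3, upd_same]
          · rw [upd_of_ne _ h3]
            exact (hmv.resolve_left (by omega)).2.2.2.2.2.2 _ (by omega) (by omega)
        rw [h3, h4]
        simp only [h2.1.le, h2.2, and_self, if_true]
        apply tileOf_congr <;> omega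
      · rw [upd_of_ne _ (by omega)]
        simp only [show ¬ (c ≤ y + 1 ∧ y + 1 ≤ j) by omega, if_false]

/-- If no hole is met any more, everything below is pure renaming and the tiling is already that of
`L'`. The two pipes do not cross below, because `α x < β x` keeps their order in every word. -/
theorem Shaft.loop_terminate (hp : InsPath k b L L' α β) (hs : Shaft L L' α β i (m + 1) j r)
    (hinc : L.Inc k) (hb : 1 ≤ b) (hi : b ≤ i) {q c : ℕ}
    (hl : Shaft.LargeBump k L L' α β m j r q c)
    (hne : ∀ x, m + 1 ≤ x → L.V x (β x) ≠ 0) (E : Grid) :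
    Loop k (droopGrid L L' α i) i j E ↔ E = L'.grid := by
  have hlt := hs.lt
  have hsm := hs.small hp hi
  have hr0 := hs.ne
  have hlab := hl.label
  have hlarge := hl.large
  have htr := fun x (hx : m + 1 ≤ x) => hp.track (n := m + 1) (r := r) (q := q) (by omega)
    (by rw [hl.alpha]; exact hl.foot) (by rw [hl.beta]; exact hl.label) (by omega) hx
    (fun x' h1 h2 => hne x' h1)
  have hg : setTile (landGrid L L' (m + 1) j r) (m + 1) (j + 1) .cross = L'.grid := by
    funext x y
    rcases Nat.lt_or_ge (m + 1) x with hx | hx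
    · rw [setTile, if_neg (by omega), landGrid, stGrid_gt hx]
      obtain ⟨x, rfl⟩ : ∃ z, x = z + 1 := ⟨x - 1, by omega⟩
      have h1 := htr x (by omega)
      have h2 := htr (x + 1) (by omega)
      exact (hp.grid_eq_of_relabel (by omega) hr0 (by omega) ⟨h1.1, h1.2.1⟩ ⟨h2.1, h2.2.1⟩
        (h2.2.2 hx) y).symm
    · exact hs.settled hp hinc hi hl hx y
  rw [loop_iff_of_terminate (hs.isMinDroop (by omega)) (hs.droop_eq hp hb hi)
    (by rw [hs.land_corner hp hi, if_neg (by omega)]) ?_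
    (hs.exitsRow hp hi hlab (by omega)) hlarge, hg]
  rintro ⟨x, y, hc⟩
  obtain ⟨x', y', rfl, rfl, h | h⟩ := hs.crossAt hp hi hlab (by omega) hc
  · exact hs.not_cross_top hp hi hlab (by omega) h.1 h.2.1 h.2.2
  · have h1 := LPD.cross_spec h.2.1
    obtain ⟨d, h2, h3⟩ := LPD.cross_below h.2.1
    have h4 := htr (x' + 1) (by omega)
    have h5 := (hp.hop (x' + 1) (by omega)).lt
    have h6 := (L.word (x' + 1)).inj d (β (x' + 1)) (by omega) (by omega)
    have h7 := (L.word (x' + 1)).inj (y' + 1) (α (x' + 1)) (by omega) (by omega)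
    omega

/-- Row `n + 1` is the first one where the exchange again faces a hole. The rule there must be
`cross`, so the two pipes of the bump cross in that row, in column `α n`; in between there is only
renaming. -/
theorem Shaft.loop_swap (hp : InsPath k b L L' α β) (hs : Shaft L L' α β i (m + 1) j r)
    (hinc : L.Inc k) (hb : 1 ≤ b) (hi : b ≤ i) {q c : ℕ}
    (hl : Shaft.LargeBump k L L' α β m j r q c) {n : ℕ} (hn : m + 1 ≤ n)
    (hne : ∀ x, m + 1 ≤ x → x ≤ n → L.V x (β x) ≠ 0) (h0 : L.V (n + 1) (β (n + 1)) = 0) :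
    DroopAt b L L' α β (n + 1) ∧ ∀ E : Grid,
    (Loop k (droopGrid L L' α i) i j E ↔
      Loop k (droopGrid L L' α (n + 1)) (n + 1) (α (n + 1)) E) := by
  have hlt := hs.lt
  have hsm := hs.small hp hi
  have hr0 := hs.ne
  have hlab := hl.label
  have hlarge := hl.large
  have htr := fun x (hx : m + 1 ≤ x) (hx' : x ≤ n) =>
    hp.track (n := m + 1) (r := r) (q := q) (by omega)
    (by rw [hl.alpha]; exact hl.foot) (by rw [hl.beta]; exact hl.label) (by omega) hx
    (fun x' h1 h2 => hne x' h1 (by omega))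
  have hn1 := htr n hn le_rfl
  have hhop := hp.hop n (by omega)
  have hw := hp.word n (by omega)
  have hw' := hp.word (n + 1) (by omega)
  obtain ⟨e, he, hea, hva, hva1, hα, hβ, hH⟩ : ∃ e, L.V (n + 1) e = L.V n (β n) ∧ e < α n ∧
      L.V (n + 1) (α n) = L.V n (α n) ∧ L.V (n + 1) (α n + 1) = 0 ∧ α (n + 1) = α n ∧
      β (n + 1) = α n + 1 ∧ L'.H (n + 1) = fun e =>
        if e = α n then 0 else if α n < e ∧ e < β n then L.V n (α n) else L.H (n + 1) e := by
    rcases (hp.rule n (by omega)).of_label (by omega) with h1 | h1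
    · omega
    · exact h1
  have ha0 := hhop.pos_left (L.word n).zero
  have hlt2 := hhop.lt
  have hmid : ∀ y, α n < y → y < β n → L.V n y = 0 ∨ (k < L.V n y ∧ L.V n (β n) < L.V n y) :=
    fun y h1 h2 => hhop.mid h1 h2
  generalize α n = a at *
  generalize β n = d at *
  rw [hn1.1] at hva hH
  rw [hn1.2.1] at he hmid
  have hmv := ((L.row n).move_to (L.word n).zero (L.word _) hn1.2.1 he (by omega)).resolve_left
    (by omega)
  obtain ⟨_, _, hvd, hhd, _, _, hcar⟩ := hmv
  obtain ⟨a, rfl⟩ : ∃ z, a = z + 1 := ⟨a - 1, by omega⟩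
  have hcross : L.grid (n + 1) (a + 1) = .cross := by
    rw [LPD.cross_iff, hcar a (by omega) (by omega), hcar (a + 1) (by omega) (by omega)]
    omega
  have hpass : ∀ y, a + 1 < y → y < d → L.V n y = 0 ∧ L.V (n + 1) y = 0 := fun y h1 h2 => by
    obtain ⟨y, rfl⟩ : ∃ z, y = z + 1 := ⟨y - 1, by omega⟩
    have h3 := hcar y (by omega) (by omega)
    have h4 := hcar (y + 1) (by omega) h2
    have h5 := (L.row n).pass (c := y) (by omega) (by omega)
    have h6 := hmid (y + 1) h1 h2
    omega
  refine ⟨⟨by omega, by rw [hβ, hα], by rw [hα]; exact hva1, by rw [hα, hH]; simp⟩, fun E => ?_⟩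
  have hg : setTile (setTile (landGrid L L' (m + 1) j r) (m + 1) (j + 1) .cross) (n + 1) (a + 1)
      .bump = droopGrid L L' α (n + 1) := by
    funext x y
    rcases Nat.lt_or_ge (m + 1) x with hx | hx
    · have h1 : ¬ (x = m + 1 ∧ y = j + 1) := by omega
      obtain ⟨x, rfl⟩ : ∃ z, x = z + 1 := ⟨x - 1, by omega⟩
      rcases lt_trichotomy x n with h2 | rfl | h2
      · rw [setTile, if_neg (by omega), setTile, if_neg h1, landGrid, stGrid_gt hx, droopGrid,
          stGrid_lt (by omega)]
        have h1 := htr x (by omega) (by omega)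
        have h2 := htr (x + 1) (by omega) (by omega)
        exact (hp.grid_eq_of_relabel (by omega) hr0 (by omega) ⟨h1.1, h1.2.1⟩ ⟨h2.1, h2.2.1⟩
          (h2.2.2 hx) y).symm
      · obtain _ | y := y
        · simp [setTile, landGrid, droopGrid, stGrid, grid_zero_right]
        rw [droopGrid, stGrid_eq, hα, hva, hw]
        by_cases h3 : y = a
        · subst h3
          rw [setTile, if_pos ⟨rfl, rfl⟩, eq_comm, tileOf_eq_bump, upd_same, swp_left, hva]
          omega
        · rw [setTile, if_neg (by omega), setTile, if_neg h1, landGrid, stGrid_gt hx, grid_succ,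
            upd_of_ne _ (by omega), hH]
          simp only [show ¬ (y + 1 = a + 1) by omega, if_false]
          by_cases h4 : y + 1 = d
          · rw [h4, swp_right, hhd, hvd, hn1.1, hn1.2.1]
            simp only [lt_irrefl, and_false, if_false]
            apply tileOf_congr <;> omega
          · rw [swp_of_ne _ (by omega) h4]
            by_cases h5 : a + 1 < y + 1 ∧ y + 1 < d
            · rw [if_pos h5]
              have h6 := hpass _ h5.1 h5.2
              have h7 := hcar (y + 1) (by omega) h5.2
              apply tileOf_congr <;> omega
            · rw [if_neg h5]
      · rw [setTile, if_neg (by omega), setTile, if_neg h1, landGrid, stGrid_gt hx, droopGrid,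
          stGrid_gt (by omega)]
    · rw [setTile, if_neg (by omega), hs.settled hp hinc hi hl hx y, droopGrid,
        stGrid_lt (by omega)]
  rw [hα, ← hg]
  refine loop_iff_of_swap (hs.isMinDroop (by omega)) (hs.droop_eq hp hb hi)
    (by rw [hs.land_corner hp hi, if_neg (by omega)]) fun x y => ⟨fun hc => ?_, ?_⟩
  · obtain ⟨x', y', rfl, rfl, h | h⟩ := hs.crossAt hp hi hlab (by omega) hc
    · exact (hs.not_cross_top hp hi hlab (by omega) h.1 h.2.1 h.2.2).elim
    · have h1 := LPD.cross_spec h.2.1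
      have h2 := hcar a (by omega) (by omega)
      have := LPD.cross_unique h.2.1 hcross (by omega) (by omega)
      omega
  · rintro ⟨rfl, rfl⟩
    exact hs.crossAt_of hp hi hlab (by omega) (by omega) hcross hva (hcar a (by omega) (by omega))

theorem InsPath.loop_iff (hp : InsPath k b L L' α β) (hinc : L.Inc k) (hb : 1 ≤ b)
    (hi : DroopAt b L L' α β i) (E : Grid) :
    Loop k (droopGrid L L' α i) i (α i) E ↔ E = L'.grid := by
  obtain ⟨M, hM⟩ : ∃ M, ∀ x, M ≤ x → L.V x (β x) ≠ 0 := by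
    obtain ⟨n, hn⟩ := L.fin
    refine ⟨n + k + b + 1, fun x hx => ?_⟩
    obtain ⟨x, rfl⟩ : ∃ y, x = y + 1 := ⟨x - 1, by omega⟩
    exact (L.rule_final (hn.mono (by omega : n ≤ n + k)) (by omega) (x := x) (by omega)
      (hp.hop x (by omega)) (hp.rule x (by omega))).1
  have hDM : ∀ i, DroopAt b L L' α β i → i < M := fun i h => by
    by_contra h1
    refine hM i (by omega) ?_
    rw [h.beta]; exact h.hole
  -- Droops continue in strictly lower rows and occur only above row `M`, so the distance to `M` is
  -- a termination measure.
  generalize hd : M - i = d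
  induction d using Nat.strong_induction_on generalizing i with
  | _ d ih =>
  have hnext : ∀ x, i < x → DroopAt b L L' α β x →
      (Loop k (droopGrid L L' α x) x (α x) E ↔ E = L'.grid) := fun x hx hD => by
    have := hDM i hi
    exact ih (M - x) (by omega) hD rfl
  have hge := hi.ge
  obtain ⟨i₁, hs⟩ := hp.exists_shaft hi
  obtain ⟨m, rfl⟩ : ∃ m, i₁ = m + 1 := ⟨i₁ - 1, by have := hs.lt; omega⟩
  have hlt := hs.lt
  have hst := hs.stay m (by omega) (by omega)
  have hrule := hp.rule m (by omega)
  have hhop := hp.hop (m + 1) (by omega)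
  rw [hst.1, hst.2.1] at hrule
  generalize hj : α i = j at *
  generalize hr : L.V i j = r at *
  obtain ⟨_, h1 | h1 | h1 | h1⟩ := hrule.of_hole hst.2.2.2
  · obtain ⟨h2, h3, h4, h5, h6⟩ := h1
    rw [hs.loop_straight hp hb hge h2 (h3.trans hst.2.2.1) h4 h6, ← h4]
    exact hnext _ hlt ⟨by omega, by rw [h5, h4], by rw [h4]; exact h2,
      by rw [h4, h6]; exact hs.foot⟩
  · obtain ⟨h2, h3, h4, h5, h6⟩ := h1
    rw [hst.2.2.1] at h3 h6
    rw [hs.loop_turn hp hinc hb hge h2 h3 h4 rfl h6]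
    refine hnext _ hlt ⟨by omega, h5, ?_, by rw [h6, upd_same]⟩
    rcases hhop.big with h7 | h7
    · rw [← h5]; exact h7.1
    · have := hs.base
      have hmv := ((L.row m).move_to (L.word m).zero (L.word _) this.1 h3 hs.ne).resolve_left
        (by omega)
      rcases (by omega : α (m + 1) + 1 = j ∨ α (m + 1) + 1 < j) with h8 | h8
      · rw [h8]; exact hmv.2.2.1
      · exact ((L.row m).small_carry (hinc _) hs.ne (hs.small hp hge) hmv.2.2.2.2.2.2
          (by omega) h8).2
  · obtain ⟨h2, h3, h4, h5, h6⟩ := h1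
    rw [hst.2.2.1] at h6
    rw [hs.loop_bumpSmall hp hinc hb hge rfl h2 h3 h4 h6, ← h4]
    refine hnext _ hlt ⟨by omega, by rw [h5, h4], ?_, by rw [h4, h6, upd_same]⟩
    rcases hhop.big with h7 | h7
    · rw [h4, show j + 1 + 1 = β (m + 1) by omega]; exact h7.1
    · have h8 := hs.base
      rw [h5] at h7
      have hf := hs.foot
      have ht := (L.row m).tile (j + 1)
      by_cases h9 : L.H (m + 1) (j + 2) = 0
      · rw [h4]
        unfold TileOK at ht
        simp only [add_assoc, Nat.reduceAdd] at ht h8 h7 ⊢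
        omega
      · have := (L.row m).small_pass (hinc (m + 1)) (c := j + 1) (by omega) h9 (by omega)
        rw [h4]
        exact this.2
  · obtain ⟨h2, h3, h5, h6⟩ := h1
    have hlt2 := hhop.lt
    have hl : Shaft.LargeBump k L L' α β m j r (L.V (m + 1) (j + 1)) (α (m + 1)) :=
      ⟨rfl, h2, h3.trans hst.2.2.1, by omega, rfl, h5, h6⟩
    by_cases hall : ∀ x, m + 1 ≤ x → L.V x (β x) ≠ 0
    · exact hs.loop_terminate hp hinc hb hge hl hall E
    · classical
      have hex : ∃ x, m + 1 ≤ x ∧ L.V x (β x) = 0 := by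
        push Not at hall; exact hall
      obtain ⟨h7, h8⟩ := Nat.find_spec hex
      have hmin : ∀ x, m + 1 ≤ x → x < Nat.find hex → L.V x (β x) ≠ 0 := fun x h9 h10 h11 =>
        Nat.find_min hex h10 ⟨h9, h11⟩
      generalize Nat.find hex = x at *
      obtain ⟨n, rfl⟩ : ∃ y, x = y + 1 := ⟨x - 1, by omega⟩
      have hmn : m + 1 ≠ n + 1 := by
        intro h9
        rw [← h9, h5] at h8
        omega
      obtain ⟨h9, h10⟩ := hs.loop_swap hp hinc hb hge hl (n := n) (by omega)
        (fun x h9 h10 => hmin x h9 (by omega)) h8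
      rw [h10]
      exact hnext _ (by omega) h9

/-- From its `rturn` the pipe of `b` runs right through empty columns, so that `rturn` is the
rightmost of the row. Restoring its removed right edge turns the initial state into `L.grid`. -/
theorem InsPath.droopAt_start (hp : InsPath k b L L' α β) (hinc : L.Inc k) :
    DroopAt b L L' α β b ∧ droopGrid L L' α b = L.grid ∧
      IsGreatest {y | L.grid b y = .rturn} (α b) := by
  obtain ⟨h1, h2, h3⟩ := hp.start
  have hh := hp.hop b le_rfl
  have ha0 := hh.pos_left (L.word b).zero
  have hpos := hh.pos
  obtain ⟨b, rfl⟩ : ∃ y, b = y + 1 := ⟨b - 1, by omega⟩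
  have hu : ∀ c, L.V b c ≠ b + 1 := fun c => by have := (L.word b).le c; omega
  generalize hα : α (b + 1) = a at *
  obtain ⟨a, rfl⟩ : ∃ y, a = y + 1 := ⟨a - 1, by omega⟩
  have ht := (L.row b).tile a
  have hua := hu (a + 1)
  have h4 : L.H (b + 1) (a + 1) = b + 1 ∧ L.V b (a + 1) = 0 := by unfold TileOK at ht; omega
  have h5 : ∀ e, a + 1 ≤ e → L.H (b + 1) e = b + 1 := by
    rcases (L.row b).carry_right h4.1 (by omega) with h5 | ⟨d, _, h5, _⟩
    · exact h5.2
    · exact absurd h5 (hu d)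
  have hsm := hh.small
  rw [h1] at hsm
  have h6 : ∀ e, a + 1 < e → L.V (b + 1) e = 0 := fun e he => by
    obtain ⟨e, rfl⟩ : ∃ y, e = y + 1 := ⟨e - 1, by omega⟩
    have h7 := h5 e (by omega)
    exact ((L.row b).small_pass (hinc _) (c := e) (by omega) (by rw [h5 _ (by omega)]; omega)
      (by omega)).2
  refine ⟨⟨le_rfl, by rw [h2, hα], by rw [hα]; exact h6 _ (by omega), by rw [hα, h3, upd_same]⟩,
    ?_, ?_, fun y hy => ?_⟩
  · have hg : upd (L'.H (b + 1)) (α (b + 1)) (L.V (b + 1) (α (b + 1))) = L.H (b + 1) := by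
      rw [hα, h1, h3]
      funext e
      unfold upd
      split_ifs with h7
      · rw [h7]; exact h4.1.symm
      · rfl
    rw [droopGrid, hg]
    funext x y
    obtain _ | x := x
    · simp [stGrid, LPD.grid, grid_zero_left]
    obtain _ | y := y
    · simp [stGrid, LPD.grid, grid_zero_right]
    rcases lt_trichotomy x b with hx | rfl | hx
    · rw [stGrid_lt (by omega), grid_succ, grid_succ, (hp.lo x (by omega)).1,
        (hp.lo (x + 1) (by omega)).1, (hp.lo (x + 1) (by omega)).2]
    · rw [stGrid_eq, grid_succ, (hp.lo x (by omega)).1]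
    · rw [stGrid_gt (by omega)]
  · rw [Set.mem_ofPred_eq, grid_succ, tileOf_eq_rturn]
    omega
  · by_contra hlt
    rw [Set.mem_ofPred_eq] at hy
    obtain _ | y := y
    · omega
    rw [grid_succ, tileOf_eq_rturn] at hy
    exact hy.1 (h6 _ (by omega))

theorem InsPath.rightInsert_iff (hp : InsPath k b L L' α β) (hinc : L.Inc k) (hb : 1 ≤ b)
    (E : Grid) : RightInsert L.grid b k E ↔ E = L'.grid := by
  obtain ⟨h1, h2, h3⟩ := hp.droopAt_start hinc
  have h4 := hp.loop_iff hinc hb h1 E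
  rw [h2] at h4
  rw [← h4]
  constructor
  · rintro ⟨j, hj, h⟩
    rwa [h3.unique hj]
  · exact fun h => ⟨_, h3, h⟩

end path

/-! ### Coupled words and hops of the same letter -/

/-- What a row tells about the words at its top and at its bottom. -/
structure RowWords (k : ℕ) (u v : ℕ → ℕ) : Prop where
  inj_top : ∀ c d, u c = u d → u c ≠ 0 → c = d
  inj_bot : ∀ c d, v c = v d → v c ≠ 0 → c = d
  inc_top : SmallInc k u
  inc_bot : SmallInc k v
  move : ∀ c d, u c ≠ 0 → v d = u c → d = c ∨ (d < c ∧ u d = 0 ∧ v c = 0 ∧ d ≠ 0 ∧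
    ∀ e, d < e → e < c → u e = v e ∧ (u c ≤ k → u e = 0))
  ex : ∀ c, u c ≠ 0 → ∃ d, v d = u c

/-- A hop at the top of a row and the hop at its bottom. -/
def WordHop (k : ℕ) (u v : ℕ → ℕ) (a b c d : ℕ) : Prop :=
  (u b = 0 ∧ b = a + 1 ∧ v (a + 1) = 0 ∧ v c = u a ∧ d = c + 1 ∧ v d = 0) ∨
  (u b = 0 ∧ b = a + 1 ∧ v (a + 1) ≠ 0 ∧ v (a + 1) ≤ k ∧ c = a + 1 ∧ d = a + 2 ∧ v d = 0) ∨
  (u b = 0 ∧ b = a + 1 ∧ k < v (a + 1) ∧ v c = u a ∧ d = a + 1) ∨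
  (u b ≠ 0 ∧ v c = u a ∧ v d = u b ∧ c < d) ∨
  (u b ≠ 0 ∧ c = a ∧ d = a + 1 ∧ v a = u a ∧ v (a + 1) = 0 ∧ ∃ e, v e = u b ∧ e < a)

theorem IsRow.rowWords {k x : ℕ} {u v h : ℕ → ℕ} (hr : IsRow x u v h) (hu : IsWord (x - 1) u)
    (hv : IsWord x v) (hsu : SmallInc k u) (hsv : SmallInc k v) : RowWords k u v where
  inj_top := hu.inj
  inj_bot := hv.inj
  inc_top := hsu
  inc_bot := hsv
  move c d hc hd := by
    rcases hr.move_to hu.zero hv rfl hd hc with h1 | h1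
    · exact .inl h1.1
    · refine .inr ⟨h1.1, h1.2.1, h1.2.2.1, h1.2.2.2.2.1, fun e h2 h3 => ?_⟩
      have h4 := h1.2.2.2.2.2.2
      obtain ⟨e, rfl⟩ : ∃ z, e = z + 1 := ⟨e - 1, by omega⟩
      have h5 := h4 e (by omega) (by omega)
      have h6 := h4 (e + 1) (by omega) h3
      exact ⟨(hr.pass (c := e) (by omega) (by omega)).1, fun hk =>
        (hr.small_pass hsv (c := e) (by omega) (by omega) (by omega)).1⟩
  ex c hc := by
    rcases hr.move hu.zero rfl hc with h | ⟨d, _, h, _⟩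
    exacts [⟨_, h.1⟩, ⟨_, h⟩]

theorem RowHop.wordHop {k x a b c d : ℕ} {u v h h' : ℕ → ℕ} (hr : IsRow x u v h)
    (hu : IsWord (x - 1) u) (hv : IsWord x v) (hsv : SmallInc k v) (hh : Hop k u a b)
    (hrule : RowHop k u v h a b c d h') : WordHop k u v a b c d := by
  have hpos := hh.pos
  have hsm := hh.small
  cases hrule with
  | straight hb hq hv => exact .inl ⟨hb, rfl, hq, hv, rfl, hq⟩
  | turn hb hq hvc hc =>
    refine .inl ⟨hb, rfl, hq, hvc, rfl, ?_⟩
    have hmv := (hr.move_to hu.zero hv rfl hvc hpos).resolve_left (by omega)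
    rcases (by omega : c + 1 = a ∨ c + 1 < a) with h8 | h8
    · rw [h8]; exact hmv.2.2.1
    · exact (hr.small_carry hsv hpos hsm hmv.2.2.2.2.2.2 (by omega) h8).2
  | bumpSmall hb hq hk =>
    refine .inr (.inl ⟨hb, rfl, hq, hk, rfl, rfl, ?_⟩)
    have ht := hr.tile a
    have ht' := hr.tile (a + 1)
    have h1 : h (a + 1) = v (a + 1) := by unfold TileOK at ht; omega
    by_cases h2 : h (a + 2) = 0
    · unfold TileOK at ht'
      simp only [add_assoc, Nat.reduceAdd] at ht'
      omega
    · exact (hr.small_pass hsv (c := a + 1) (by omega) h2 (by omega)).2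
  | bumpLarge hb hk hv => exact .inr (.inr (.inl ⟨hb, rfl, hk, hv, rfl⟩))
  | keep hb hc hd hcd => exact .inr (.inr (.inr (.inl ⟨hb, hc, hd, hcd⟩)))
  | cross hb he hea hv hq => exact .inr (.inr (.inr (.inr ⟨hb, rfl, rfl, hv, hq, _, he, hea⟩)))

/-- The word `u'` is obtained from `u` by exchanging the increasing neighbours in the columns `a`
and `a + 1` (where holes count as infinite). -/
structure Coupled (u u' : ℕ → ℕ) (a : ℕ) : Prop where
  left : u' a = u (a + 1)
  right : u' (a + 1) = u a
  other : ∀ c, c ≠ a → c ≠ a + 1 → u' c = u c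
  pos : u a ≠ 0
  lt : u (a + 1) = 0 ∨ u a < u (a + 1)

/-- How the exchanged columns change from one row to the next. -/
def Slide (u v : ℕ → ℕ) (a a' : ℕ) : Prop :=
  (a' = a ∧ v a = u a) ∨
  (a < a' ∧ (∀ c, a < c → c ≤ a' → u c = 0) ∧ (∀ c, a < c → c < a' → v c = 0) ∧ v a' ≠ 0 ∧
    v (a' + 1) = 0)

/-- `c'` is the image of `c` under the transposition of `a` and `a + 1`. -/
def Swapped (a c c' : ℕ) : Prop :=
  (c = a ∧ c' = a + 1) ∨ (c = a + 1 ∧ c' = a) ∨ (c ≠ a ∧ c ≠ a + 1 ∧ c' = c)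

/-- How the hops of the same letter in two coupled words are related: either they do not interfere
with the coupling, or the hop in the upper word takes the place of the coupling. Here `s` is the
new place of the coupling. -/
def HopsRel (k : ℕ) (u' : ℕ → ℕ) (a c d c' d' s : ℕ) : Prop :=
  (¬ (c = a ∧ d = a + 1) ∧ Swapped a c c' ∧ Swapped a d d' ∧ s = a) ∨
  (c = a ∧ d = a + 1 ∧ d' = c' + 1 ∧ a + 1 ≤ c' ∧ (∀ e, a < e → e ≤ c' → u' e ≠ 0 ∧ u' e ≤ k) ∧
    s = c')

section
variable {k : ℕ} {u u' v v' : ℕ → ℕ} {a a' : ℕ}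

theorem Coupled.swapped (h : Coupled u u' a) {c c' : ℕ} (hs : Swapped a c c') : u' c' = u c := by
  rcases hs with ⟨rfl, rfl⟩ | ⟨rfl, rfl⟩ | ⟨h1, h2, rfl⟩
  exacts [h.right, h.left, h.other _ h1 h2]

theorem Coupled.exists_swapped (a c : ℕ) : ∃ c', Swapped a c c' := by
  by_cases h1 : c = a
  · exact ⟨a + 1, .inl ⟨h1, rfl⟩⟩
  by_cases h2 : c = a + 1
  · exact ⟨a, .inr (.inl ⟨h2, rfl⟩)⟩
  · exact ⟨c, .inr (.inr ⟨h1, h2, rfl⟩)⟩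

theorem Coupled.swapped_of_eq (h : Coupled u u' a)
    (hi : ∀ c d, u' c = u' d → u' c ≠ 0 → c = d) {c c' : ℕ}
    (he : u' c' = u c) (h0 : u c ≠ 0) : Swapped a c c' := by
  obtain ⟨e, hs⟩ := Coupled.exists_swapped a c
  have := hi c' e (he.trans (h.swapped hs).symm) (by omega)
  exact this ▸ hs

/-- The right one of the two exchanged labels is not small. -/
theorem Coupled.large (h : Coupled u u' a) (hs : SmallInc k u') :
    u (a + 1) = 0 ∨ k < u (a + 1) := by
  by_contra h1
  have h2 := hs a (a + 1) (by omega) (by rw [h.left]; omega) (by rw [h.right]; exact h.pos)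
    (by rw [h.left]; omega) (by rw [h.right]; have := h.lt; omega)
  rw [h.left, h.right] at h2
  have := h.lt
  omega

/-- After the insertion the words are still coupled. -/
theorem HopsRel.coupled {c d c' d' s : ℕ} (hr : HopsRel k u' a c d c' d' s) (hc : Coupled u u' a)
    (hs' : SmallInc k u') (hh : Hop k u c d) (hh' : Hop k u' c' d') :
    Coupled (swp u c d) (swp u' c' d') s := by
  have hl := hc.large hs'
  have hlt := hc.lt
  have hpos := hc.pos
  have hcd := hh.lt
  have hsm := hh.small
  have hcp := hh.pos
  have hmid := fun e => hh.mid (c := e)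
  rcases hr with ⟨hn, h1, h2, rfl⟩ | ⟨rfl, rfl, rfl, h1, h2, rfl⟩
  · have hc1 : c ≠ s + 1 := by rintro rfl; omega
    -- Such a hop would start to the left of `s` and jump over the entry at `s`, which is no hole
    -- and is smaller than the one at `s + 1` unless that is a hole.
    have hd1 : d ≠ s + 1 := by
      rintro rfl
      have h3 := hmid s (by omega) (by omega)
      have h4 := hh.big
      omega
    have hbig := hh.big
    have hneq : ∀ e e', Swapped s e e' → swp u' c' d' e' = swp u c d e := by
      intro e e' he
      have h3 := hc.swapped he
      have h4 := hc.swapped h1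
      have h5 := hc.swapped h2
      unfold Swapped at h1 h2 he
      unfold swp
      split_ifs <;> omega
    refine ⟨hneq _ _ (.inr (.inl ⟨rfl, rfl⟩)), hneq _ _ (.inl ⟨rfl, rfl⟩),
      fun e h3 h4 => hneq _ _ (.inr (.inr ⟨h3, h4, rfl⟩)), ?_, ?_⟩
    · unfold swp
      split_ifs with h3 h4
      · subst h3
        rcases hbig with h4 | h4 <;> omega
      · exact hcp
      · exact hpos
    · rw [swp_of_ne u (c := s + 1) (by omega) (by omega)]
      unfold swp
      split_ifs with h3 h4
      · subst h3
        have := hmid (s + 1) (by omega) (by omega)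
        omega
      · subst h4; omega
      · exact hlt
  · have he : swp u c (c + 1) = u' := by
      funext e
      unfold swp
      split_ifs with h3 h4
      · rw [h3]; exact hc.left.symm
      · rw [h4]; exact hc.right.symm
      · exact (hc.other e h3 h4).symm
    rw [he]
    have h3 := h2 s (by omega) le_rfl
    refine ⟨swp_left .., swp_right .., fun e h4 h5 => swp_of_ne _ h4 h5, h3.1, ?_⟩
    rcases hh'.big with h4 | h4 <;> omega

end

section step
variable {k : ℕ} {u u' v v' : ℕ → ℕ} {a a' : ℕ}

theorem Slide.ne_zero (hs : Slide u v a a') (h : u a ≠ 0) : v a' ≠ 0 := by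
  rcases hs with ⟨rfl, h1⟩ | ⟨_, _, _, h1, _⟩
  · omega
  · exact h1

theorem Slide.le (hs : Slide u v a a') : a ≤ a' := by
  rcases hs with ⟨rfl, h1⟩ | ⟨h1, _⟩ <;> omega

theorem WordHop.of_label {b c d : ℕ} (h : WordHop k u v a b c d) (h0 : u b ≠ 0) :
    (v c = u a ∧ v d = u b ∧ c < d) ∨
      (c = a ∧ d = a + 1 ∧ v a = u a ∧ v (a + 1) = 0 ∧ ∃ e, v e = u b ∧ e < a) := by
  rcases h with h | h | h | h | h
  exacts [absurd h.1 h0, absurd h.1 h0, absurd h.1 h0, .inl h.2, .inr h.2]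

theorem WordHop.of_hole {b c d : ℕ} (h : WordHop k u v a b c d) (h0 : u b = 0) :
    (v (a + 1) = 0 ∧ v c = u a ∧ d = c + 1 ∧ v d = 0) ∨
    (v (a + 1) ≠ 0 ∧ v (a + 1) ≤ k ∧ c = a + 1 ∧ d = a + 2 ∧ v d = 0) ∨
    (k < v (a + 1) ∧ v c = u a ∧ d = a + 1) := by
  rcases h with h | h | h | h | h
  exacts [.inl h.2.2, .inr (.inl h.2.2), .inr (.inr h.2.2), absurd h0 h.1, absurd h0 h.1]

/-- Two coupled rows with hops of the same letter. -/
structure CoupledHops (k : ℕ) (u u' v v' : ℕ → ℕ) (a a' γ δ γ' δ' c d c' d' : ℕ) : Prop where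
  row : RowWords k u v
  row' : RowWords k u' v'
  top : Coupled u u' a
  bot : Coupled v v' a'
  slide : Slide u v a a'
  hop_top : Hop k u γ δ
  hop_top' : Hop k u' γ' δ'
  hop_bot : Hop k v c d
  rule : WordHop k u v γ δ c d
  rule' : WordHop k u' v' γ' δ' c' d'

variable {γ δ γ' δ' c d c' d' : ℕ}

/-- The two hops exchange the same labels, so injectivity fixes their columns up to the coupling. If
the two pipes cross only in the second row, the hop in `v` is exactly the coupled pair and the
coupling moves one column to the right; a crossing only in the first row is impossible. The second
part records what is needed to show that the new coupling slides. -/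
theorem CoupledHops.rel_label (h : CoupledHops k u u' v v' a a' γ δ γ' δ' c d c' d')
    (h1 : Swapped a γ γ') (h2 : Swapped a δ δ') (h0 : u δ ≠ 0) :
    (∃ s, HopsRel k v' a' c d c' d' s) ∧
    (c = a' → d = a' + 1 → γ' = a' + 1 ∧ v' (a' + 2) = 0 ∧
      ((v a' = u γ ∧ v (a' + 1) = u δ) ∨ (γ = a' ∧ ∃ e, v e = u δ ∧ e < γ ∧ v (γ + 1) = 0))) := by
  have ht := h.top.swapped h1
  have ht' := h.top.swapped h2
  have hpos := h.hop_top.pos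
  have hsm := h.hop_top.small
  have hlt := h.hop_top.lt
  have hva := h.slide.ne_zero h.top.pos
  have hE := h.rule.of_label h0
  have hD := h.rule'.of_label (ht'.trans_ne h0)
  rw [ht, ht'] at hD
  have hsw := fun {c c'} => h.bot.swapped_of_eq (c := c) (c' := c') h.row'.inj_bot
  rcases hE with ⟨e1, e2, e3⟩ | ⟨rfl, rfl, e1, e2, e, e3, e4⟩ <;>
  rcases hD with ⟨f1, f2, f3⟩ | ⟨rfl, rfl, f1, f2, f, f3, f4⟩
  · have g1 := hsw (c := c) (c' := c') (by omega) (by omega)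
    have g2 := hsw (c := d) (c' := d') (by omega) (by omega)
    have hn : ¬ (c = a' ∧ d = a' + 1) := by unfold Swapped at g1 g2; omega
    exact ⟨⟨a', .inl ⟨hn, g1, g2, rfl⟩⟩, fun h3 h4 => absurd ⟨h3, h4⟩ hn⟩
  · have g1 := hsw (c := c) (c' := c') (by omega) (by omega)
    have g2 := hsw (c := d) (c' := f) (by omega) (by omega)
    have hc : c = a' ∧ d = a' + 1 ∧ c' = a' + 1 := by unfold Swapped at g1 g2; omega
    obtain ⟨rfl, rfl, rfl⟩ := hc
    refine ⟨⟨c + 1, .inr ⟨rfl, rfl, rfl, by omega, fun e h3 h4 => ?_, rfl⟩⟩, fun _ _ => ?_⟩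
    · obtain rfl : e = c + 1 := by omega
      omega
    · exact ⟨rfl, f2, .inl ⟨e1, e2⟩⟩
  · exfalso
    have g1 := hsw (c := c) (c' := c') (by omega) (by omega)
    have g2 := hsw (c := e) (c' := d') (by omega) (by omega)
    obtain ⟨rfl, rfl, rfl, rfl⟩ : c = a' + 1 ∧ e = a' ∧ c' = a' ∧ d' = a' + 1 := by
      unfold Swapped at g1 g2; omega
    rcases h.slide with ⟨rfl, h4⟩ | ⟨h4, h5, _⟩
    · have := h.row.inj_top δ c' (by omega) (by omega)
      omega
    · have h6 : γ' = c' + 1 := by unfold Swapped at h1; omega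
      subst h6
      have h7 := h.row'.move (c' + 1) c' (by omega) (by omega)
      omega
  · have g1 := hsw (c := c) (c' := c') (by omega) (by omega)
    have h3 : c ≠ a' + 1 := by
      intro h3
      obtain rfl : c' = a' := by unfold Swapped at g1; omega
      have := h.bot.right
      omega
    have h4 : c + 1 ≠ a' := by
      rintro rfl; omega
    by_cases h5 : c = a'
    · obtain rfl : c' = a' + 1 := by unfold Swapped at g1; omega
      subst h5
      refine ⟨⟨c + 1, .inr ⟨rfl, rfl, rfl, by omega, fun e h3 h4 => ?_, rfl⟩⟩, fun _ _ => ?_⟩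
      · obtain rfl : e = c + 1 := by omega
        omega
      · exact ⟨rfl, f2, .inr ⟨rfl, e, e3, e4, e2⟩⟩
    · obtain rfl : c' = c := by unfold Swapped at g1; omega
      exact ⟨⟨a', .inl ⟨by omega, g1, .inr (.inr ⟨by omega, by omega, rfl⟩), rfl⟩⟩,
        fun h6 _ => absurd h6 h5⟩

/-- Column `a` is occupied and column `a + 1` contains a hole or a label `> k`. So a hop into a hole
that is not the coupled pair is disjoint from it. -/
theorem CoupledHops.away (h : CoupledHops k u u' v v' a a' γ δ γ' δ' c d c' d')
    (hn : ¬ (γ = a ∧ δ = a + 1)) (h1 : Swapped a γ γ') (h2 : Swapped a δ δ') (h0 : u δ = 0) :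
    γ' = γ ∧ δ' = γ + 1 ∧ δ = γ + 1 ∧ (γ + 1 < a ∨ a + 1 < γ) := by
  have hpos := h.hop_top.pos
  have hsm := h.hop_top.small
  have hap := h.top.pos
  have h3 : δ = γ + 1 := by rcases h.hop_top.big with h3 | h3 <;> omega
  have h4 : u' δ' = 0 := (h.top.swapped h2).trans h0
  have h5 : δ' = γ' + 1 := by rcases h.hop_top'.big with h3 | h3 <;> omega
  have hl := h.top.large h.row'.inc_top
  have h6 : γ ≠ a + 1 := by rintro rfl; omega
  have h7 : γ + 1 ≠ a := by rintro rfl; subst h3; omega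
  unfold Swapped at h1 h2
  omega

theorem CoupledHops.rel_hole (h : CoupledHops k u u' v v' a a' γ δ γ' δ' c d c' d')
    (hn : ¬ (γ = a ∧ δ = a + 1)) (h1 : Swapped a γ γ') (h2 : Swapped a δ δ') (h0 : u δ = 0) :
    (∃ s, HopsRel k v' a' c d c' d' s) ∧
    (c = a' → d = a' + 1 → a < a' ∧ v a' = u γ ∧ v' (a' + 2) = 0 ∧ δ = γ + 1) := by
  obtain ⟨rfl, rfl, rfl, hap⟩ := h.away hn h1 h2 h0
  have ht := h.top.swapped h1
  have ht' := h.top.swapped h2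
  have hpos := h.hop_top.pos
  have hsm := h.hop_top.small
  have hE := h.rule.of_hole h0
  have hD := h.rule'.of_hole (ht'.trans h0)
  have hva := h.slide.ne_zero h.top.pos
  have hap0 := h.top.pos
  have hbl := h.bot.left
  have hbr := h.bot.right
  have hsw := fun {c c'} => h.bot.swapped_of_eq (c := c) (c' := c') h.row'.inj_bot
  have hfar : γ' + 1 < a' ∨ a' < γ' := by
    rcases h.slide with ⟨rfl, h4⟩ | ⟨h4, h5, h6, h7, h8⟩
    · omega
    · rcases hap with h9 | h9
      · omega
      · right
        by_contra h10
        exact hpos (h5 γ' (by omega) (by omega))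
  have hq : v' (γ' + 1) = v (γ' + 1) := h.bot.other _ (by omega) (by omega)
  rw [hq, ht] at hD
  rcases hE with ⟨e1, e2, e3, e4⟩ | ⟨e1, e2, e3, e4, e5⟩ | ⟨e1, e2, e3⟩
  · rcases hD with ⟨f1, f2, f3, f4⟩ | ⟨f1, f2⟩ | ⟨f1, f2⟩
    rotate_left
    · exact absurd e1 f1
    · omega
    have g1 := hsw (c := c) (c' := c') (by omega) (by omega)
    subst e3 f3
    have h3 : c + 1 ≠ a' := by rintro rfl; omega
    have h4 : c ≠ a' + 1 := by
      rintro rfl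
      obtain rfl : c' = a' := by unfold Swapped at g1; omega
      rw [hbr] at f4; omega
    by_cases h5 : c = a'
    · obtain rfl : c' = a' + 1 := by unfold Swapped at g1; omega
      subst h5
      refine ⟨⟨c + 1, .inr ⟨rfl, rfl, rfl, by omega, fun e h3 h4 => ?_, rfl⟩⟩, fun _ _ => ?_⟩
      · obtain rfl : e = c + 1 := by omega
        omega
      · refine ⟨?_, e2, f4, rfl⟩
        rcases h.slide with ⟨rfl, h4⟩ | ⟨h4, _⟩
        · have := h.row.inj_top c γ' (by omega) (by omega)
          omega
        · exact h4
    · obtain rfl : c' = c := by unfold Swapped at g1; omega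
      exact ⟨⟨a', .inl ⟨by omega, g1, .inr (.inr ⟨by omega, by omega, rfl⟩), rfl⟩⟩,
        fun h6 _ => absurd h6 h5⟩
  · rcases hD with ⟨f1, f2, f3, f4⟩ | ⟨f1, f2, f3, f4, f5⟩ | ⟨f1, f2⟩
    · exact absurd f1 e1
    · subst e3 e4 f3 f4
      have h3 : γ' + 2 ≠ a' := by rintro rfl; omega
      exact ⟨⟨a', .inl ⟨by omega, .inr (.inr ⟨by omega, by omega, rfl⟩),
        .inr (.inr ⟨by omega, by omega, rfl⟩), rfl⟩⟩, fun _ _ => by omega⟩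
    · omega
  · rcases hD with ⟨f1, f2, f3, f4⟩ | ⟨f1, f2, f3, f4, f5⟩ | ⟨f1, f2, f3⟩
    · omega
    · omega
    · have g1 := hsw (c := c) (c' := c') (by omega) (by omega)
      subst e3 f3
      exact ⟨⟨a', .inl ⟨by omega, g1, .inr (.inr ⟨by omega, by omega, rfl⟩), rfl⟩⟩,
        fun _ _ => by omega⟩

end step

section step
variable {k : ℕ} {u u' v v' : ℕ → ℕ} {a a' : ℕ} {γ δ γ' δ' c d c' d' : ℕ}

theorem Coupled.swp_eq (h : Coupled u u' a) : swp u a (a + 1) = u' := by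
  funext e
  unfold swp
  split_ifs with h3 h4
  · rw [h3]; exact h.left.symm
  · rw [h4]; exact h.right.symm
  · exact (h.other e h3 h4).symm

theorem CoupledHops.slide_of_ne (h : CoupledHops k u u' v v' a a' γ δ γ' δ' c d c' d')
    (hn : ¬ (γ = a ∧ δ = a + 1)) (h1 : Swapped a γ γ') (h2 : Swapped a δ δ')
    (hn' : ¬ (c = a' ∧ d = a' + 1)) : Slide (swp u γ δ) (swp v c d) a a' := by
  have hpos := h.hop_top.pos
  have hlt := h.hop_top.lt
  have hap := h.top.pos
  have hcpos := h.hop_bot.pos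
  have hdz : v d = 0 → d = c + 1 := fun h0 => by
    rcases h.hop_bot.big with h3 | h3 <;> omega
  have hib := h.row.inj_bot
  have hit := h.row.inj_top
  rcases h.slide with ⟨rfl, h3⟩ | ⟨h3, h4, h5, h6, h7⟩
  · refine .inl ⟨rfl, ?_⟩
    by_cases h0 : u δ = 0
    · obtain ⟨rfl, rfl, rfl, haw⟩ := h.away hn h1 h2 h0
      rw [swp_of_ne u (c := a') (by omega) (by omega)]
      have hac : a' ≠ c := by
        rintro rfl
        rcases h.rule.of_hole h0 with e | e | e
        · have := hit a' γ' (by omega) (by omega); omega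
        · omega
        · have := hit a' γ' (by omega) (by omega); omega
      have had : a' ≠ d := by
        rintro rfl
        rcases h.rule.of_hole h0 with e | e | e <;> omega
      rw [swp_of_ne v hac had, h3]
    · rcases h.rule.of_label h0 with ⟨e1, e2, e3⟩ | ⟨rfl, rfl, e1, e2, e, e3, e4⟩
      · by_cases h4 : a' = γ
        · subst h4
          obtain rfl := hib c a' (by omega) (by omega)
          rw [swp_left, swp_left, e2]
        by_cases h5 : a' = δ
        · subst h5
          obtain rfl := hib d a' (by omega) (by omega)
          rw [swp_right, swp_right, e1]
        have hac : a' ≠ c := fun h6 => h4 (hit _ _ (by rw [← h3, h6, e1]) (by omega))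
        have had : a' ≠ d := fun h6 => h5 (hit _ _ (by rw [← h3, h6, e2]) (by omega))
        rw [swp_of_ne u h4 h5, swp_of_ne v hac had, h3]
      · have h4 : a' ≠ c := by rintro rfl; exact hn' ⟨rfl, rfl⟩
        have h5 : a' ≠ δ := by
          rintro rfl
          have := hib e a' (by omega) (by omega)
          omega
        have h6 : a' ≠ c + 1 := by rintro rfl; omega
        rw [swp_of_ne u h4 h5, swp_of_ne v h4 h6, h3]
  · refine .inr ⟨h3, fun e h8 h9 => ?_, fun e h8 h9 => ?_, ?_, ?_⟩
    · have h10 : e ≠ γ := by rintro rfl; exact hpos (h4 _ h8 h9)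
      have h11 : e ≠ δ := by
        rintro rfl
        obtain ⟨_, _, rfl, haw⟩ := h.away hn h1 h2 (h4 _ h8 h9)
        rcases Nat.lt_or_ge a γ with h12 | h12
        · exact hpos (h4 γ h12 (by omega))
        · omega
      rw [swp_of_ne u h10 h11]
      exact h4 e h8 h9
    · have h10 : e ≠ c := by rintro rfl; exact hcpos (h5 _ h8 h9)
      have h11 : e ≠ d := by
        rintro rfl
        have hv0 := h5 _ h8 h9
        have hd := hdz hv0
        subst hd
        obtain rfl : c = a := by
          by_contra h12
          exact hcpos (h5 c (by omega) (by omega))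
        by_cases h0 : u δ = 0
        · obtain ⟨rfl, rfl, rfl, haw⟩ := h.away hn h1 h2 h0
          rcases h.rule.of_hole h0 with e | e | e
          · rcases h.row.move _ _ hpos e.2.1 with h12 | h12 <;> omega
          · omega
          · omega
        · rcases h.rule.of_label h0 with ⟨e1, e2, e3⟩ | ⟨rfl, _, e1, e2, e, e3, e4⟩
          · omega
          have ht := h.top.swapped h1
          have ht' := h.top.swapped h2
          have hsw := fun {c c'} => h.bot.swapped_of_eq (c := c) (c' := c') h.row'.inj_bot
          have hg : γ' = c + 1 := by unfold Swapped at h1; omega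
          rcases h.rule'.of_label (ht'.trans_ne h0) with ⟨f1, f2, f3⟩ | ⟨_, _, f1, f2, f, f3, f4⟩
          · have g1 := hsw (c := c) (c' := c') (by omega) (by omega)
            have g2 := hsw (c := e) (c' := d') (by omega) (by omega)
            unfold Swapped at g1 g2
            omega
          · have g1 := hsw (c := c) (c' := γ') (by omega) (by omega)
            unfold Swapped at g1
            omega
      rw [swp_of_ne v h10 h11]
      exact h5 e h8 h9
    · unfold swp
      split_ifs with h8 h9
      · intro h10
        exact hn' ⟨h8.symm, by have := hdz h10; omega⟩
      · exact hcpos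
      · exact h6
    · have h8 : a' + 1 ≠ c := by rintro rfl; exact hcpos h7
      have h9 : a' + 1 ≠ d := by
        rintro rfl
        have := hdz h7
        exact hn' ⟨by omega, rfl⟩
      rw [swp_of_ne v h8 h9]
      exact h7

theorem CoupledHops.step_of_ne (h : CoupledHops k u u' v v' a a' γ δ γ' δ' c d c' d')
    (hn : ¬ (γ = a ∧ δ = a + 1)) (h1 : Swapped a γ γ') (h2 : Swapped a δ δ') :
    ∃ s, HopsRel k v' a' c d c' d' s ∧ Slide (swp u γ δ) (swp v c d) a s := by
  by_cases hn' : c = a' ∧ d = a' + 1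
  swap
  · have hr : ∃ s, HopsRel k v' a' c d c' d' s := by
      by_cases h0 : u δ = 0
      · exact (h.rel_hole hn h1 h2 h0).1
      · exact (h.rel_label h1 h2 h0).1
    obtain ⟨s, hr⟩ := hr
    have hs : s = a' := by
      rcases hr with hr | hr
      · exact hr.2.2.2
      · exact absurd ⟨hr.1, hr.2.1⟩ hn'
    subst hs
    exact ⟨s, hr, h.slide_of_ne hn h1 h2 hn'⟩
  obtain ⟨rfl, rfl⟩ := hn'
  have hpos := h.hop_top.pos
  have hsm := h.hop_top.small
  have hlt := h.hop_top.lt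
  have hap := h.top.pos
  have hcpos := h.hop_bot.pos
  have hit := h.row.inj_top
  have hoth := h.bot.other (c + 2) (by omega) (by omega)
  -- The columns from `c + 1` to `s` of `v'` are filled, so a hole in column `c + 2` leaves only `s
  -- = c + 1`.
  have hs : ∀ s, HopsRel k v' c c (c + 1) c' d' s → v' (c + 2) = 0 → s = c + 1 := by
    rintro s (hr | ⟨_, _, h3, h4, h5, rfl⟩) h6
    · exact absurd ⟨rfl, rfl⟩ hr.1
    · by_contra h7
      exact (h5 (c + 2) (by omega) (by omega)).1 h6
  by_cases h0 : u δ = 0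
  · obtain ⟨⟨s, hr⟩, hx⟩ := h.rel_hole hn h1 h2 h0
    obtain ⟨h3, h4, h5, h6⟩ := hx rfl rfl
    have := hs s hr h5
    subst this
    obtain ⟨h7, h8, h9, h10⟩ : (∀ e, a < e → e ≤ c → u e = 0) ∧ (∀ e, a < e → e < c → v e = 0) ∧
        v c ≠ 0 ∧ v (c + 1) = 0 := by
      rcases h.slide with ⟨rfl, _⟩ | h7
      · omega
      · exact h7.2
    have hmv := h.row.move _ _ hpos h4
    have hcg : c < γ := by
      rcases hmv with h11 | h11
      · have := h7 c h3 le_rfl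
        rw [h11] at this
        omega
      · exact h11.1
    refine ⟨c + 1, hr, .inr ⟨by omega, fun e h11 h12 => ?_, fun e h11 h12 => ?_, ?_, ?_⟩⟩
    · by_cases h13 : e = γ
      · subst h13; rw [swp_left]; exact h0
      have h14 : e ≠ δ := by omega
      rw [swp_of_ne u h13 h14]
      rcases (by omega : e ≤ c ∨ e = c + 1) with h15 | rfl
      · exact h7 e h11 h15
      · exact ((hmv.resolve_left (by omega)).2.2.2.2 _ (by omega) (by omega)).2 hsm
    · rcases (by omega : e < c ∨ e = c) with h13 | rfl
      · rw [swp_of_ne v (by omega) (by omega)]; exact h8 e h11 h13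
      · rw [swp_left]; exact h10
    · rw [swp_right]; exact hcpos
    · rw [swp_of_ne v (by omega) (by omega), ← hoth]; exact h5
  · obtain ⟨⟨s, hr⟩, hx⟩ := h.rel_label h1 h2 h0
    obtain ⟨h3, h4, h5⟩ := hx rfl rfl
    have := hs s hr h4
    subst this
    rcases h.slide with ⟨rfl, h7⟩ | ⟨h6, h7, h8, h9, h10⟩
    · obtain rfl : γ = c := by
        rcases h5 with h5 | h5
        · exact hit _ _ (by omega) (by omega)
        · exact h5.1
      have hd : γ + 1 < δ := by omega
      refine ⟨γ + 1, hr, .inr ⟨by omega, fun e h11 h12 => ?_, fun e h11 h12 => by omega, ?_, ?_⟩⟩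
      · obtain rfl : e = γ + 1 := by omega
        rw [swp_of_ne u (by omega) (by omega)]
        rcases h5 with h5 | ⟨_, e, h5, h8, h9⟩
        · rcases h.row.move _ _ h0 h5.2 with h8 | h8
          · omega
          · exact h8.2.1
        · rcases h.row.move _ _ h0 h5 with h10 | h10
          · omega
          · rw [(h10.2.2.2.2 _ (by omega) hd).1]; exact h9
      · rw [swp_right]; exact hcpos
      · rw [swp_of_ne v (by omega) (by omega), ← hoth]; exact h4
    · exfalso
      rcases h5 with h5 | h5
      · omega
      · have := h7 c h6 le_rfl
        rw [← h5.1] at this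
        exact hpos this

/-- Small labels in adjacent columns stay in their columns if the first one does. -/
theorem RowWords.stay (hr : RowWords k u v) {m : ℕ} (hs : ∀ e, a < e → e ≤ m → u e ≠ 0 ∧ u e ≤ k)
    (h0 : v (a + 1) = u (a + 1)) {e : ℕ} (h1 : a + 1 ≤ e) (h2 : e ≤ m) : v e = u e := by
  induction e, h1 using Nat.le_induction with
  | base => exact h0
  | succ e he ih =>
    have h3 := hs e (by omega) (by omega)
    have h4 := hs (e + 1) (by omega) (by omega)
    obtain ⟨d, hd⟩ := hr.ex _ h4.1
    rcases hr.move _ _ h4.1 hd with rfl | ⟨h5, h6, _, _, h7⟩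
    · exact hd
    · exfalso
      rcases (by omega : d = e ∨ d < e) with rfl | h8
      · exact h3.1 h6
      · exact h3.1 ((h7 e h8 (by omega)).2 h4.2)

/-- A run of small labels in adjacent columns stays in place. A hop at its right end remains there,
or extends the run by one when the next column receives a small label. -/
theorem RowWords.packed_step (hr : RowWords k u v) {m : ℕ} (ha : a < m)
    (hs : ∀ e, a < e → e ≤ m → u e ≠ 0 ∧ u e ≤ k) (h0 : v m = u m)
    (h0' : ∀ e, a < e → e ≤ m → v e ≠ 0 ∧ v e ≤ k)
    (hrule : WordHop k u v m (m + 1) c d) :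
    d = c + 1 ∧ m ≤ c ∧ (∀ e, a < e → e ≤ c → v e ≠ 0 ∧ v e ≤ k) ∧ Slide u v m c := by
  have hm := hs m ha le_rfl
  by_cases h1 : u (m + 1) = 0
  · rcases hrule.of_hole h1 with e | e | e
    · obtain rfl := hr.inj_bot c m (by omega) (by omega)
      exact ⟨e.2.2.1, le_rfl, h0', .inl ⟨rfl, h0⟩⟩
    · obtain ⟨e1, e2, rfl, rfl, e3⟩ := e
      refine ⟨rfl, by omega, fun e h2 h3 => ?_, .inr ⟨by omega, fun e h2 h3 => ?_,
        fun e h2 h3 => by omega, e1, e3⟩⟩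
      · rcases (by omega : e ≤ m ∨ e = m + 1) with h4 | rfl
        · exact h0' e h2 h4
        · exact ⟨e1, e2⟩
      · obtain rfl : e = m + 1 := by omega
        exact h1
    · obtain rfl := hr.inj_bot c m (by omega) (by omega)
      exact ⟨e.2.2, le_rfl, h0', .inl ⟨rfl, h0⟩⟩
  · rcases hrule.of_label h1 with e | e
    · obtain rfl := hr.inj_bot c m (by omega) (by omega)
      have := hr.move _ _ h1 e.2.1
      exact ⟨by omega, le_rfl, h0', .inl ⟨rfl, h0⟩⟩
    · obtain ⟨rfl, rfl, _⟩ := e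
      exact ⟨rfl, le_rfl, h0', .inl ⟨rfl, h0⟩⟩

/-- The hop in `u` is the coupling itself, so `u` becomes `u'`, and the new coupling is the hop in
`u'`, at the right end of a run of small labels. -/
theorem CoupledHops.step_of_eq (h : CoupledHops k u u' v v' a a' γ δ γ' δ' c d c' d')
    (h1 : γ = a) (h2 : δ = a + 1) (h3 : δ' = γ' + 1) (h4 : a + 1 ≤ γ')
    (h5 : ∀ e, a < e → e ≤ γ' → u' e ≠ 0 ∧ u' e ≤ k) :
    ∃ s, HopsRel k v' a' c d c' d' s ∧ Slide u' (swp v c d) γ' s := by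
  subst h1 h2 h3
  have hbl := h.bot.left
  have hbr := h.bot.right
  have htl := h.top.left
  have htr := h.top.right
  have hpos := h.hop_top.pos
  have hsm := h.hop_top.small
  have hlarge := h.bot.large h.row'.inc_bot
  have hrule' := h.rule'
  have hinj := h.row.inj_bot
  have hmove := fun d => h.row.move (γ + 1) d
  rcases h.slide with ⟨rfl, h6⟩ | ⟨h6, h7, h8, h9, h10⟩
  · have hcd : c = a' ∧ d = a' + 1 := by
      by_cases h0 : u (a' + 1) = 0
      · rcases h.rule.of_hole h0 with e | e | e
        · have := hinj c a' (by omega) (by omega)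
          omega
        · omega
        · have := hinj c a' (by omega) (by omega)
          omega
      · rcases h.rule.of_label h0 with e | e
        · have := hinj c a' (by omega) (by omega)
          have := hmove d h0 e.2.1
          omega
        · exact ⟨e.1, e.2.1⟩
    obtain ⟨rfl, rfl⟩ := hcd
    have hst := fun e => h.row'.stay (e := e) h5 (by omega)
    obtain ⟨e1, e2, e3, e4⟩ := h.row'.packed_step (a := c) (by omega) h5
      (hst _ (by omega) le_rfl)
      (fun e h11 h12 => by rw [hst e h11 h12]; exact h5 e h11 h12) hrule'
    exact ⟨c', .inr ⟨rfl, rfl, e1, by omega, e3, rfl⟩, by rw [h.bot.swp_eq]; exact e4⟩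
  have h0 := h7 (γ + 1) (by omega) (by omega)
  have hu2 := h.top.other (γ + 2) (by omega) (by omega)
  have hsw := fun {c c'} => h.bot.swapped_of_eq (c := c) (c' := c') h.row'.inj_bot
  -- If the coupling slides beyond `γ + 1`, the run consists of column `γ + 1` alone; both hops move
  -- into holes, and the coupling separates from the hops again. If it slides by one, the label in
  -- `v (γ + 1)` decides: for a small one the hop follows the coupling, for a large one they
  -- separate.
  rcases (by omega : γ + 1 < a' ∨ a' = γ + 1) with h11 | rfl
  · have h12 := h7 (γ + 2) (by omega) (by omega)
    obtain rfl : γ' = γ + 1 := by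
      by_contra h13
      exact (h5 (γ + 2) (by omega) (by omega)).1 (by omega)
    have h13 := h8 (γ + 1) (by omega) h11
    have h14 : v' (γ + 1 + 1) = 0 := by
      rcases (by omega : γ + 2 < a' ∨ a' = γ + 2) with h14 | rfl
      · rw [h.bot.other _ (by omega) (by omega)]
        exact h8 _ (by omega) h14
      · rw [hbl]; exact h10
    rcases h.rule.of_hole h0 with e | e | e
    · obtain ⟨_, e1, rfl, e2⟩ := e
      rcases hrule'.of_hole (hu2.trans h12) with f | f | f
      · obtain ⟨_, f1, rfl, f2⟩ := f
        have hmv := h.row.move γ c hpos e1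
        have g1 := hsw (c := c) (c' := c') (by omega) (by omega)
        obtain rfl : c' = c := by unfold Swapped at g1; omega
        refine ⟨a', .inl ⟨by omega, g1, .inr (.inr ⟨by omega, by omega, rfl⟩), rfl⟩,
          .inr ⟨h11, fun e h15 h16 => ?_, fun e h15 h16 => ?_, ?_, ?_⟩⟩
        · rw [h.top.other e (by omega) (by omega)]
          exact h7 e (by omega) h16
        · rw [swp_of_ne v (by omega) (by omega)]
          exact h8 e (by omega) h16
        · rw [swp_of_ne v (by omega) (by omega)]; exact h9
        · rw [swp_of_ne v (by omega) (by omega)]; exact h10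
      · exact absurd h14 f.1
      · omega
    · exact absurd h13 e.1
    · omega
  · have h10' : v (γ + 2) = 0 := h10
    have h12 : ∀ e, γ + 2 ≤ e → e ≤ γ' → v' e = u' e := by
      intro e h13 h14
      refine h.row'.stay (a := γ + 1) (fun e h15 => h5 e (by omega)) ?_ (by omega) h14
      have h15 := h5 (γ + 2) (by omega) (by omega)
      rw [hu2] at h15
      obtain ⟨d, hd⟩ := h.row.ex _ h15.1
      have h16 : d = γ + 1 := by
        rcases h.row.move _ _ h15.1 hd with rfl | h16
        · omega
        · by_contra h17
          have := h16.2.2.2.2 (γ + 1) (by omega) (by omega)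
          omega
      rw [show γ + 1 + 1 = γ + 2 from rfl] at hbr ⊢
      rw [hbr, hu2, ← hd, h16]
    rcases h.rule.of_hole h0 with e | e | e
    · omega
    · obtain ⟨_, e1, rfl, rfl, e2⟩ := e
      have hgoal : d' = c' + 1 ∧ γ + 2 ≤ c' ∧ (∀ e, γ + 1 < e → e ≤ c' → v' e ≠ 0 ∧ v' e ≤ k) ∧
          Slide u' v' γ' c' := by
        rcases (by omega : γ' = γ + 1 ∨ γ + 2 ≤ γ') with rfl | h13
        · have hp : u' (γ + 1 + 1) = 0 := by
            by_contra hp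
            rw [show γ + 1 + 1 = γ + 2 from rfl, hu2] at hp
            obtain ⟨d, hd⟩ := h.row.ex _ hp
            rcases h.row.move _ _ hp hd with rfl | h16
            · omega
            · rcases (by omega : d = γ + 1 ∨ d < γ + 1) with rfl | h17
              · have h18 := h.top.large h.row'.inc_top
                have h19 := h.hop_top'.big
                simp only [add_assoc, Nat.reduceAdd] at *
                omega
              · have := h16.2.2.2.2 (γ + 1) (by omega) (by omega)
                omega
          rcases hrule'.of_hole hp with f | f | f
          · omega
          · obtain ⟨f1, f2, rfl, rfl, f3⟩ := f
            refine ⟨rfl, by omega, fun e h2 h3 => ?_, .inr ⟨by omega, fun e h2 h3 => ?_,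
              fun e h2 h3 => by omega, f1, f3⟩⟩
            · obtain rfl : e = γ + 1 + 1 := by omega
              exact ⟨f1, f2⟩
            · obtain rfl : e = γ + 1 + 1 := by omega
              exact hp
          · omega
        · obtain ⟨e1, e2, e3, e4⟩ := h.row'.packed_step (a := γ + 1) (by omega)
            (fun e h15 => h5 e (by omega)) (h12 _ h13 le_rfl)
            (fun e h14 h15 => by rw [h12 e h14 h15]; exact h5 e (by omega) h15) hrule'
          exact ⟨e1, by omega, e3, e4⟩
      obtain ⟨f1, f2, f3, f4⟩ := hgoal
      refine ⟨c', .inr ⟨rfl, rfl, f1, f2, f3, rfl⟩, ?_⟩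
      rw [h.bot.swp_eq]
      exact f4
    · obtain ⟨e1, e2, rfl⟩ := e
      obtain rfl : γ' = γ + 1 := by
        by_contra h13
        have h14 := h12 (γ + 2) le_rfl (by omega)
        have h15 := h5 (γ + 2) (by omega) (by omega)
        rw [show γ + 1 + 1 = γ + 2 from rfl] at hbr
        omega
      have hmv := h.row.move γ c hpos e2
      have hc : v' c' = u γ ∧ d' = γ + 2 := by
        by_cases hp : u' (γ + 1 + 1) = 0
        · rcases hrule'.of_hole hp with f | f | f
          · omega
          · omega
          · exact ⟨f.2.1.trans htr, f.2.2⟩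
        · have hp' := hp
          rw [show γ + 1 + 1 = γ + 2 from rfl, hu2] at hp'
          obtain ⟨d, hd⟩ := h.row.ex _ hp'
          have hd1 : d = γ + 1 := by
            rcases h.row.move _ _ hp' hd with rfl | h16
            · simp only [add_assoc, Nat.reduceAdd] at h10
              omega
            · by_contra h17
              have := h16.2.2.2.2 (γ + 1) (by omega) (by omega)
              omega
          subst hd1
          rcases hrule'.of_label hp with f | ⟨f1, f2, f3, f4, e, f5, f6⟩
          · refine ⟨f.1.trans htr, ?_⟩
            have := h.row'.inj_bot d' (γ + 1 + 1) (by
              rw [f.2.1, hbr, hd, ← hu2]) (by omega)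
            omega
          · rw [hbr] at f4
            exact absurd f4 h9
      have g1 := hsw (c := c) (c' := c') (by omega) (by omega)
      obtain rfl : c' = c := by unfold Swapped at g1; omega
      refine ⟨γ + 1, .inl ⟨by omega, g1, .inl ⟨rfl, hc.2⟩, rfl⟩, .inl ⟨rfl, ?_⟩⟩
      rw [swp_right, htr, e2]

/-- Coupled rows remain coupled after the insertion of the same letter. -/
theorem CoupledHops.step (h : CoupledHops k u u' v v' a a' γ δ γ' δ' c d c' d') {s₀ : ℕ}
    (hr : HopsRel k u' a γ δ γ' δ' s₀) :
    ∃ s, HopsRel k v' a' c d c' d' s ∧ Slide (swp u γ δ) (swp v c d) s₀ s := by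
  rcases hr with ⟨hn, h1, h2, rfl⟩ | ⟨rfl, rfl, h3, h4, h5, rfl⟩
  · exact h.step_of_ne hn h1 h2
  · rw [h.top.swp_eq]
    exact h.step_of_eq rfl rfl h3 h4 h5

/-- The first row of an insertion into two coupled rows. -/
theorem Coupled.start (ht : Coupled u u' a) (hb : Coupled v v' a') (hs : Slide u v a a')
    (h1 : v γ ≠ 0) (hk : v γ ≤ k) (h2 : ∀ e, γ < e → v e = 0) (h3 : ∀ e, γ ≤ e → u e = 0)
    (h4 : v' γ' = v γ) (h5 : ∀ e, γ' < e → v' e = 0)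
    (hi : ∀ c d, v' c = v' d → v' c ≠ 0 → c = d) :
    ∃ s, HopsRel k v' a' γ (γ + 1) γ' (γ' + 1) s ∧ Slide u (swp v γ (γ + 1)) a s := by
  have hbl := hb.left
  have hbr := hb.right
  have hpos := ht.pos
  have hva := hs.ne_zero ht.pos
  have g := hb.swapped_of_eq hi h4 h1
  have h6 : a < γ := by
    by_contra h6
    exact hpos (h3 a (by omega))
  have h7 : a' ≤ γ := by
    by_contra h7
    exact hva (h2 a' (by omega))
  have h8 : γ ≠ a' + 1 := by
    rintro rfl
    obtain rfl : γ' = a' := by unfold Swapped at g; omega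
    have := h5 (γ' + 1) (by omega)
    omega
  by_cases h9 : γ = a'
  · subst h9
    obtain rfl : γ' = γ + 1 := by unfold Swapped at g; omega
    have h10 := h2 (γ + 1) (by omega)
    have h11 := h2 (γ + 2) (by omega)
    refine ⟨γ + 1, .inr ⟨rfl, rfl, rfl, le_rfl, fun e h12 h13 => ?_, rfl⟩,
      .inr ⟨by omega, fun e h12 h13 => ?_, fun e h12 h13 => ?_, ?_, ?_⟩⟩
    · obtain rfl : e = γ + 1 := by omega
      omega
    · rcases (by omega : e < γ ∨ γ ≤ e) with h14 | h14
      · rcases hs with hs | hs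
        · omega
        · exact hs.2.1 e h12 h14.le
      · exact h3 e h14
    · rcases (by omega : e < γ ∨ e = γ) with h14 | rfl
      · rw [swp_of_ne v (by omega) (by omega)]
        rcases hs with hs | hs
        · omega
        · exact hs.2.2.1 e h12 h14
      · rw [swp_left]; exact h10
    · rw [swp_right]; exact h1
    · rw [swp_of_ne v (by omega) (by omega)]; exact h11
  · obtain rfl : γ' = γ := by unfold Swapped at g; omega
    refine ⟨a', .inl ⟨by omega, g, .inr (.inr ⟨by omega, by omega, rfl⟩), rfl⟩, ?_⟩
    rcases hs with ⟨rfl, hs⟩ | ⟨e1, e2, e3, e4, e5⟩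
    · exact .inl ⟨rfl, by rw [swp_of_ne v (by omega) (by omega)]; exact hs⟩
    · refine .inr ⟨e1, e2, fun e h12 h13 => ?_, ?_, ?_⟩
      · rw [swp_of_ne v (by omega) (by omega)]; exact e3 e h12 h13
      · rw [swp_of_ne v (by omega) (by omega)]; exact e4
      · rw [swp_of_ne v (by omega) (by omega)]; exact e5

end step

/-! ### Couplings of pipe dreams -/

/-- `D` is obtained from `E` by exchanging, in each row `x ≥ i`, the labels in the columns `a x` and
`a x + 1`. -/
structure Coupling (i : ℕ) (E D : LPD) (a : ℕ → ℕ) : Prop where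
  lo : ∀ x, x < i → D.V x = E.V x
  word : ∀ x, i ≤ x → Coupled (E.V x) (D.V x) (a x)
  start : E.V i (a i) = i
  slide : ∀ x, i ≤ x → Slide (E.V x) (E.V (x + 1)) (a x) (a (x + 1))

theorem exists_chain_from {α : Type*} (n : ℕ) (P : ℕ → α → Prop) (R : ℕ → α → α → Prop) (a₀ : α)
    (h₀ : P n a₀) (hs : ∀ x a, n ≤ x → P x a → ∃ a', P (x + 1) a' ∧ R x a a') :
    ∃ f : ℕ → α, f n = a₀ ∧ ∀ x, n ≤ x → P x (f x) ∧ R x (f x) (f (x + 1)) := by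
  obtain ⟨f, h1, h2⟩ := exists_chain (fun m => P (n + m)) (fun m => R (n + m)) a₀ h₀
    (fun m a h => hs (n + m) a (by omega) h)
  refine ⟨fun x => f (x - n), by simp [h1], fun x hx => ?_⟩
  have := h2 (x - n)
  rwa [show n + (x - n) = x by omega, show x - n + 1 = x + 1 - n by omega] at this

section path
variable {k b i : ℕ} {L L' E D E' D' : LPD} {α β α' β' a a' : ℕ → ℕ}

theorem LPD.rowWords (hL : L.Inc k) (x : ℕ) : RowWords k (L.V x) (L.V (x + 1)) :=
  (L.row x).rowWords (L.word x) (L.word _) (hL _) (hL _)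

theorem InsPath.wordHop (hp : InsPath k b L L' α β) (hL : L.Inc k) {x : ℕ} (hx : b ≤ x) :
    WordHop k (L.V x) (L.V (x + 1)) (α x) (β x) (α (x + 1)) (β (x + 1)) :=
  (hp.rule x hx).wordHop (L.row x) (L.word x) (L.word _) (hL _) (hp.hop x hx)

theorem InsPath.start_zero (hp : InsPath k b L L' α β) (hL : L.Inc k) (hb : 1 ≤ b) :
    (∀ e, α b < e → L.V b e = 0) ∧ ∀ e, α b ≤ e → L.V (b - 1) e = 0 := by
  have h1 := hp.start.1
  have hh := hp.hop b le_rfl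
  have ha0 := hh.pos_left (L.word b).zero
  have hsm := hh.small
  rw [h1] at hsm
  obtain ⟨b, rfl⟩ : ∃ y, b = y + 1 := ⟨b - 1, by omega⟩
  have hu : ∀ c, L.V b c ≠ b + 1 := fun c => by have := (L.word b).le c; omega
  generalize α (b + 1) = a at *
  obtain ⟨a, rfl⟩ : ∃ y, a = y + 1 := ⟨a - 1, by omega⟩
  have ht := (L.row b).tile a
  have hua := hu (a + 1)
  have h4 : L.H (b + 1) (a + 1) = b + 1 ∧ L.V b (a + 1) = 0 := by unfold TileOK at ht; omega
  have h5 : ∀ e, a + 1 ≤ e → L.H (b + 1) e = b + 1 := by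
    rcases (L.row b).carry_right h4.1 (by omega) with h5 | ⟨d, _, h5, _⟩
    · exact h5.2
    · exact absurd h5 (hu d)
  have h6 : ∀ e, a + 1 < e → L.V b e = 0 ∧ L.V (b + 1) e = 0 := fun e he => by
    obtain ⟨e, rfl⟩ : ∃ y, e = y + 1 := ⟨e - 1, by omega⟩
    have h7 := h5 e (by omega)
    exact (L.row b).small_pass (hL _) (c := e) (by omega) (by rw [h5 _ (by omega)]; omega)
      (by omega)
  refine ⟨fun e he => (h6 e he).2, fun e he => ?_⟩
  rcases he.eq_or_lt with rfl | he
  · exact h4.2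
  · exact (h6 e he).1

theorem Coupling.coupledHops (hc : Coupling i E D a) (hE : InsPath k b E E' α β)
    (hD : InsPath k b D D' α' β') (hEi : E.Inc k) (hDi : D.Inc k) (hib : i ≤ b) {x : ℕ}
    (hx : b ≤ x) : CoupledHops k (E.V x) (D.V x) (E.V (x + 1)) (D.V (x + 1)) (a x) (a (x + 1))
      (α x) (β x) (α' x) (β' x) (α (x + 1)) (β (x + 1)) (α' (x + 1)) (β' (x + 1)) where
  row := LPD.rowWords hEi x
  row' := LPD.rowWords hDi x
  top := hc.word x (by omega)
  bot := hc.word (x + 1) (by omega)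
  slide := hc.slide x (by omega)
  hop_top := hE.hop x hx
  hop_top' := hD.hop x hx
  hop_bot := hE.hop _ (by omega)
  rule := hE.wordHop hEi hx
  rule' := hD.wordHop hDi hx

/-- The insertion of the same letter into coupled pipe dreams yields coupled pipe dreams. -/
theorem Coupling.insert (hc : Coupling i E D a) (hE : InsPath k b E E' α β)
    (hD : InsPath k b D D' α' β') (hEi : E.Inc k) (hDi : D.Inc k) (hi : 1 ≤ i) (hib : i ≤ b) :
    ∃ s, Coupling i E' D' s ∧
      ∀ x, b ≤ x → HopsRel k (D.V x) (a x) (α x) (β x) (α' x) (β' x) (s x) := by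
  have hEs := hE.start
  have hDs := hD.start
  have hEz := hE.start_zero hEi (by omega)
  have hDz := hD.start_zero hDi (by omega)
  -- The initial place of the new coupling. If `b = i`, the hop of `E` is the coupling itself, and
  -- the letter moves it one column to the right.
  obtain ⟨s₀, hs₀, hs₁, hs₂⟩ : ∃ s₀, HopsRel k (D.V b) (a b) (α b) (β b) (α' b) (β' b) s₀ ∧
      (i = b → E'.V i s₀ = i) ∧ (i < b → Slide (E.V (b - 1)) (E'.V b) (a (b - 1)) s₀) := by
    have hk := (hE.hop b le_rfl).small
    rw [hEs.1] at hk
    rw [hE.word b le_rfl, hEs.2.1, hDs.2.1]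
    rcases hib.eq_or_lt with rfl | hib
    · have hw := hc.word i le_rfl
      have h1 : α i = a i := (E.word i).inj _ _ (hEs.1.trans hc.start.symm) (by omega)
      have h2 : α' i = a i + 1 := (D.word i).inj _ _
        (hDs.1.trans (hw.right.trans hc.start).symm) (by omega)
      refine ⟨a i + 1, .inr ⟨h1, by rw [h1], rfl, by omega, fun e h3 h4 => ?_, h2.symm⟩,
        fun _ => ?_, fun h => absurd h (lt_irrefl _)⟩
      · obtain rfl : e = a i + 1 := by omega
        rw [hw.right, hc.start]
        omega
      · rw [hE.word i le_rfl, hEs.2.1, h1, swp_right, hc.start]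
    · obtain ⟨b, rfl⟩ : ∃ y, b = y + 1 := ⟨b - 1, by omega⟩
      obtain ⟨s, h1, h2⟩ := (hc.word b (by omega)).start (hc.word (b + 1) (by omega))
        (hc.slide b (by omega)) (γ := α (b + 1)) (γ' := α' (b + 1)) (k := k) (by omega) (by omega)
        hEz.1 hEz.2 (hDs.1.trans hEs.1.symm) hDz.1 (D.word _).inj
      exact ⟨s, h1, fun h => by omega, fun _ => h2⟩
  obtain ⟨f, hf0, hf⟩ := exists_chain_from b
    (fun x s => HopsRel k (D.V x) (a x) (α x) (β x) (α' x) (β' x) s)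
    (fun x s s' => Slide (E'.V x) (E'.V (x + 1)) s s') s₀ hs₀ (fun x s hx hs => by
      obtain ⟨s', h1, h2⟩ := (hc.coupledHops hE hD hEi hDi hib hx).step hs
      rw [hE.word x hx, hE.word _ (by omega)]
      exact ⟨s', h1, h2⟩)
  refine ⟨fun x => if x < b then a x else f x, ⟨fun x hx => ?_, fun x hx => ?_, ?_,
    fun x hx => ?_⟩, fun x hx => ?_⟩
  · rw [(hD.lo x (by omega)).1, (hE.lo x (by omega)).1, hc.lo x hx]
  · split_ifs with h
    · rw [(hD.lo x h).1, (hE.lo x h).1]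
      exact hc.word x hx
    · rw [hD.word x (by omega), hE.word x (by omega)]
      exact (hf x (by omega)).1.coupled (hc.word x hx) (hDi x) (hE.hop x (by omega))
        (hD.hop x (by omega))
  · split_ifs with h
    · rw [(hE.lo i h).1]
      exact hc.start
    · obtain rfl : i = b := by omega
      rw [hf0]
      exact hs₁ rfl
  · split_ifs with h h' h'
    · rw [(hE.lo x h).1, (hE.lo _ h').1]
      exact hc.slide x hx
    · obtain rfl : b = x + 1 := by omega
      rw [(hE.lo x h).1, hf0]
      exact hs₂ (by omega)
    · omega
    · exact (hf x (by omega)).2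
  · dsimp only
    rw [if_neg (by omega)]
    exact (hf x hx).1

/-- The insertion of a letter that is smaller than all other ones. -/
theorem InsPath.coupling (hE : InsPath k i E E' α β) (hEi : E.Inc k) (hi : 1 ≤ i)
    (hid : ∀ c, 1 ≤ c → c ≤ i → E.V i c = c) : Coupling i E E' α ∧
      ∀ x, i ≤ x → β x = α x + 1 ∧ ∀ e, 0 < e → e ≤ α x → E.V x e ≠ 0 ∧ E.V x e ≤ k := by
  have hk := (hE.hop i le_rfl).small
  rw [hE.start.1] at hk
  -- The columns `1, …, α x` form a run of small labels with the hop at its end, so `packed_step`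
  -- with `a = 0` applies in every row. Column `1` cannot change, as labels only move left.
  have hstep : ∀ x, i ≤ x → β x = α x + 1 →
      (∀ e, 0 < e → e ≤ α x → E.V x e ≠ 0 ∧ E.V x e ≤ k) →
      β (x + 1) = α (x + 1) + 1 ∧
        (∀ e, 0 < e → e ≤ α (x + 1) → E.V (x + 1) e ≠ 0 ∧ E.V (x + 1) e ≤ k) ∧
        Slide (E.V x) (E.V (x + 1)) (α x) (α (x + 1)) := by
    intro x hx h1 h2
    have hr := LPD.rowWords hEi x
    have hpos := (hE.hop x hx).pos_left (E.word x).zero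
    have hrule := hE.wordHop hEi hx
    rw [h1] at hrule
    have h3 : E.V (x + 1) (0 + 1) = E.V x (0 + 1) := by
      have h4 := (h2 1 (by omega) (by omega)).1
      obtain ⟨d, hd⟩ := hr.ex _ h4
      rcases hr.move _ _ h4 hd with rfl | h5
      · exact hd
      · omega
    have hst := fun e => hr.stay (e := e) h2 h3
    obtain ⟨e1, _, e3⟩ := hr.packed_step (a := 0) (by omega) h2 (hst _ (by omega) le_rfl)
      (fun e h11 h12 => by rw [hst e h11 h12]; exact h2 e h11 h12) hrule
    exact ⟨e1, e3⟩
  have key : ∀ x, i ≤ x → β x = α x + 1 ∧ ∀ e, 0 < e → e ≤ α x → E.V x e ≠ 0 ∧ E.V x e ≤ k := by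
    intro x hx
    induction x, hx using Nat.le_induction with
    | base =>
      have h1 : α i = i := (E.word i).inj _ _ (by rw [hE.start.1, hid i hi le_rfl])
        (by rw [hE.start.1]; omega)
      refine ⟨hE.start.2.1, fun e h2 h3 => ?_⟩
      rw [hid e h2 (by omega)]
      omega
    | succ x hx ih =>
      have := hstep x hx ih.1 ih.2
      exact ⟨this.1, this.2.1⟩
  refine ⟨⟨fun x hx => (hE.lo x hx).1, fun x hx => ?_, hE.start.1, fun x hx =>
    (hstep x hx (key x hx).1 (key x hx).2).2.2⟩, key⟩
  have hh := hE.hop x hx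
  rw [hE.word x hx, (key x hx).1]
  rw [(key x hx).1] at hh
  have h1 := hh.big
  have h2 := hh.small
  exact ⟨swp_left .., swp_right .., fun e h4 h5 => swp_of_ne _ h4 h5, hh.pos, by omega⟩

/-- If the first coupling slides to or past `d`, it slides through holes, which forces `d = c + 1`.
Then `v'` has holes in all columns from `c + 1` to `c'`, and the second coupling must end on an
occupied column beyond them. -/
theorem Slide.lt {u v u' v' : ℕ → ℕ} {c c' d d' : ℕ} (hu : Coupled u u' c) (hv : Coupled v v' c')
    (h : Slide u v c c') (h' : Slide u' v' d d') (hd : u' d ≠ 0) (hcd : c < d) : c' < d' := by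
  have hle := h'.le
  rcases h with ⟨rfl, _⟩ | ⟨h1, h2, h3, h4, h5⟩
  · omega
  rcases Nat.lt_or_ge c' d with h6 | h6
  · omega
  have h7 : d = c + 1 := by
    by_contra h7
    rw [hu.other d (by omega) h7] at hd
    exact hd (h2 d hcd h6)
  have h8 : ∀ e, c < e → e ≤ c' → v' e = 0 := fun e h9 h10 => by
    rcases h10.eq_or_lt with rfl | h10
    · rw [hv.left]; exact h5
    · rw [hv.other e (by omega) (by omega)]; exact h3 e h9 h10
  rcases h' with ⟨rfl, h9⟩ | ⟨h9, _, _, h10, _⟩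
  · rw [← h9] at hd
    exact absurd (h8 _ (by omega) h6) hd
  · by_contra h11
    exact h10 (h8 _ (by omega) (by omega))

/-- In row `i` the first coupling moves the label `i` one column to the right, and this is where the
second coupling starts. -/
theorem Coupling.lt {F : LPD} (h : Coupling i E D a) (h' : Coupling i D F a') (hi : 1 ≤ i) {x : ℕ}
    (hx : i ≤ x) : a x < a' x := by
  induction x, hx using Nat.le_induction with
  | base =>
    have h1 := (h.word i le_rfl).right.trans h.start
    have := (D.word i).inj _ _ (h1.trans h'.start.symm) (by omega)
    omega
  | succ x hx ih =>
    exact (h.slide x hx).lt (h.word x hx) (h.word _ (by omega)) (h'.slide x hx)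
      (h'.word x hx).pos ih

/-- Below the finite square there are no holes to slide through, so the place of the coupling is
eventually constant. -/
theorem Coupling.hasPerm (h : Coupling i E D a) {π : Equiv.Perm ℕ} (hπ : E.HasPerm π) :
    ∃ A n, A ≠ 0 ∧ (∀ x, n ≤ x → a x = A ∧ A + 1 ≤ x) ∧
      D.HasPerm (Equiv.swap A (A + 1) * π) ∧ π.symm A < π.symm (A + 1) := by
  obtain ⟨n₁, hn₁⟩ := E.fin
  obtain ⟨n₂, hn₂⟩ := D.fin
  obtain ⟨h0, n₃, hn₃⟩ := hπ
  let n := n₁ + n₂ + n₃ + i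
  have hpos : ∀ x, n ≤ x → 1 ≤ a x ∧ a x + 1 ≤ x := fun x hx => by
    have hw := h.word x (by omega)
    have h1 := (hn₁.1 x (by omega) _).1 hw.pos
    have h2 := (hn₂.1 x (by omega) _).1 (by rw [hw.right]; exact hw.pos)
    omega
  have hnz : ∀ x, n ≤ x → ∀ c, 1 ≤ c → c ≤ x → E.V x c ≠ 0 := fun x hx c h1 h2 =>
    (hn₁.1 x (by omega) c).2 ⟨h1, h2⟩
  have hst : ∀ x, n ≤ x → a (x + 1) = a x := fun x hx => by
    rcases h.slide x (by omega) with h1 | ⟨h1, h2, _⟩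
    · exact h1.1
    · have h3 := hpos x hx
      exact absurd (h2 (a x + 1) (by omega) (by omega)) (hnz x hx _ (by omega) h3.2)
  have hc : ∀ x, n ≤ x → a x = a n := fun x hx => by
    induction x, hx using Nat.le_induction with
    | base => rfl
    | succ x hx ih => rw [hst x hx, ih]
  have hp := hpos n le_rfl
  refine ⟨a n, n, by omega, fun x hx => ⟨hc x hx, by omega⟩, ⟨?_, n, fun x hx c h1 h2 => ?_⟩, ?_⟩
  · rw [Equiv.Perm.mul_apply, h0, Equiv.swap_apply_of_ne_of_ne] <;> omega
  · have hw := h.word x (by omega)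
    rw [hc x hx] at hw
    have h3 : (Equiv.swap (a n) (a n + 1) * π).symm c = π.symm (Equiv.swap (a n) (a n + 1) c) := rfl
    rw [h3]
    by_cases h4 : c = a n
    · subst h4
      rw [Equiv.swap_apply_left, hw.left]
      exact hn₃ x (by omega) _ (by omega) (by omega)
    by_cases h5 : c = a n + 1
    · subst h5
      rw [Equiv.swap_apply_right, hw.right]
      exact hn₃ x (by omega) _ (by omega) (by omega)
    · rw [Equiv.swap_apply_of_ne_of_ne h4 h5, hw.other c h4 h5]
      exact hn₃ x (by omega) _ h1 h2
  · have h1 := (h.word n (by omega)).lt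
    have h2 := hnz n le_rfl (a n + 1) (by omega) (by omega)
    rw [← hn₃ n (by omega) _ hp.1 (by omega), ← hn₃ n (by omega) _ (by omega) hp.2]
    omega

end path

/-! ### The local rule on permutations -/

/-- `c < d` are the first two neighbouring elements of `A` with `w c ≤ k < w d`. -/
structure IsFirst (A : Set ℕ) (k : ℕ) (w : ℕ → ℕ) (c d : ℕ) : Prop where
  left : c ∈ A
  right : d ∈ A
  lt : c < d
  gap : ∀ m ∈ A, c < m → d ≤ m
  small : w c ≤ k
  large : k < w d
  mono : ∀ m ∈ A, ∀ m' ∈ A, m < m' → m' ≤ c → w m ≤ k → w m' ≤ k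

/-- By `IsFirst.mono`, once a value along `A` is `≤ k`, all later ones up to `c` are; so there is no
earlier change from `≤ k` to `> k`. -/
theorem IsFirst.firstSwap {A : Set ℕ} {k c d : ℕ} {μ : Equiv.Perm ℕ}
    (h : IsFirst A k μ.symm c d) (hA : A.Infinite) :
    FirstSwap A k μ (Equiv.swap c d * μ) := by
  classical
  have hinf : (Set.ofPred (· ∈ A)).Infinite := hA
  have hmono := Nat.nth_strictMono hinf
  have hc : Nat.nth (· ∈ A) (Nat.count (· ∈ A) c) = c := Nat.nth_count h.left
  have hd : Nat.nth (· ∈ A) (Nat.count (· ∈ A) d) = d := Nat.nth_count h.right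
  have hd' : Nat.nth (· ∈ A) (Nat.count (· ∈ A) c + 1) = d := by
    apply le_antisymm
    · rw [← hd]
      apply hmono.monotone
      by_contra h1
      have := hmono.monotone (show Nat.count (· ∈ A) d ≤ Nat.count (· ∈ A) c by omega)
      rw [hc, hd] at this
      have := h.lt
      omega
    · refine h.gap _ (Nat.nth_mem_of_infinite hinf _) ?_
      have := hmono (Nat.lt_succ_self (Nat.count (· ∈ A) c))
      rwa [hc] at this
  refine ⟨Nat.count (· ∈ A) c, ⟨⟨by rw [hc]; exact h.small, by rw [hd']; exact h.large⟩,
    fun l hl => ?_⟩, by rw [hc, hd']⟩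
  by_contra hlt
  have h1 := hmono.monotone (show l + 1 ≤ Nat.count (· ∈ A) c by omega)
  rw [hc] at h1
  have h2 := h.mono _ (Nat.nth_mem_of_infinite hinf l) _ (Nat.nth_mem_of_infinite hinf (l + 1))
    (hmono (Nat.lt_succ_self l)) h1 hl.1
  have := hl.2
  omega

/-- The function `w'` is `w` with the increasing values at `a` and `a + 1` exchanged, where the
larger value is `> k`. -/
structure Exchanged (k : ℕ) (w w' : ℕ → ℕ) (a : ℕ) : Prop where
  left : w' a = w (a + 1)
  right : w' (a + 1) = w a
  other : ∀ c, c ≠ a → c ≠ a + 1 → w' c = w c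
  lt : w a < w (a + 1)
  large : k < w (a + 1)

section
variable {k a c d c' d' s : ℕ} {w w' : ℕ → ℕ}

/-- Since `A` contains everything from `a` on, reading `w'` along `A \ {a}` is reading `w` along `A`
with the large value `w (a + 1)` deleted. The first step from small to large survives this, except
when its large end is the deleted value, that is, when `(c, d) = (a, a + 1)`. Then `HopsRel` says
that the values up to `c'` are small, and `hd'` that the next one is large. -/
theorem IsFirst.step {A : Set ℕ} (h : IsFirst A k w c d) (he : Exchanged k w w' a)
    (ha : ∀ y, a ≤ y → y ∈ A) (hr : HopsRel k w' a c d c' d' s) (hd' : k < w' d') :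
    IsFirst (A \ {a}) k w' c' d' := by
  have hl := he.left
  have hrr := he.right
  have hlarge := he.large
  have h0 := h.small
  have h1 := h.large
  have h2 := h.lt
  have haA := ha a le_rfl
  have haA' := ha (a + 1) (by omega)
  have hlow : ∀ m, m < a → w' m = w m := fun m hm => he.other m (by omega) (by omega)
  have hne : ∀ {m}, m ∈ A \ {a} → m ∈ A ∧ m ≠ a := fun hm => ⟨hm.1, hm.2⟩
  rcases hr with ⟨hn, e1, e2, rfl⟩ | ⟨rfl, rfl, rfl, e1, e2, rfl⟩
  · by_cases hf : w s ≤ k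
    · have hcs : c < s := by
        by_contra hcs
        rcases (by omega : c = s ∨ c = s + 1 ∨ s + 1 < c) with rfl | rfl | h3
        · have := h.gap _ haA' (by omega); omega
        · omega
        · have := h.mono _ haA _ haA' (by omega) (by omega) hf; omega
      have hds : d < s := by
        have := h.gap _ haA hcs
        rcases this.eq_or_lt with rfl | h3
        · omega
        · exact h3
      obtain rfl : c' = c := by unfold Swapped at e1; omega
      obtain rfl : d' = d := by unfold Swapped at e2; omega
      refine ⟨⟨h.left, by simp; omega⟩, ⟨h.right, by simp; omega⟩, h2,
        fun m hm hlt => h.gap m hm.1 hlt, by rw [hlow _ hcs]; exact h0, hd',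
        fun m hm m' hm' h3 h4 h5 => ?_⟩
      rw [hlow _ (by omega)] at h5 ⊢
      exact h.mono m hm.1 m' hm'.1 h3 h4 h5
    · have hcs : c ≠ s := by rintro rfl; omega
      have hcs' : c ≠ s + 1 := by rintro rfl; omega
      obtain rfl : c' = c := by unfold Swapped at e1; omega
      rcases Nat.lt_or_ge c' s with h3 | h3
      · have h4 := h.gap _ haA h3
        have hmono : ∀ m ∈ A \ {s}, ∀ m' ∈ A \ {s}, m < m' → m' ≤ c' → w' m ≤ k → w' m' ≤ k := by
          intro m hm m' hm' h6 h7 h8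
          rw [hlow _ (by omega)] at h8 ⊢
          exact h.mono m hm.1 m' hm'.1 h6 h7 h8
        rcases h4.eq_or_lt with rfl | h5
        · obtain rfl : d' = d + 1 := by unfold Swapped at e2; omega
          refine ⟨⟨h.left, by simp; omega⟩, ⟨haA', by simp⟩, by omega, fun m hm hlt => ?_,
            by rw [hlow _ h3]; exact h0, hd', hmono⟩
          have := h.gap m hm.1 hlt
          have := (hne hm).2
          omega
        · obtain rfl : d' = d := by unfold Swapped at e2; omega
          exact ⟨⟨h.left, by simp; omega⟩, ⟨h.right, by simp; omega⟩, h2,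
            fun m hm hlt => h.gap m hm.1 hlt, by rw [hlow _ h3]; exact h0, hd', hmono⟩
      · obtain rfl : d' = d := by unfold Swapped at e2; omega
        refine ⟨⟨h.left, by simp; omega⟩, ⟨h.right, by simp; omega⟩, h2,
          fun m hm hlt => h.gap m hm.1 hlt, by rw [he.other _ hcs hcs']; exact h0, hd',
          fun m hm m' hm' h6 h7 h8 => ?_⟩
        have h9 := (hne hm).2
        have h10 := (hne hm').2
        have hms : m ≠ s + 1 := by rintro rfl; omega
        rw [he.other m h9 hms] at h8
        by_cases h11 : m' = s + 1
        · subst h11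
          rw [hrr]
          exact h.mono m hm.1 s haA (by omega) (by omega) h8
        · rw [he.other m' h10 h11]
          exact h.mono m hm.1 m' hm'.1 h6 h7 h8
  · refine ⟨⟨ha _ (by omega), by simp; omega⟩, ⟨ha _ (by omega), by simp; omega⟩, by omega,
      fun m hm hlt => by omega, (e2 _ (by omega) le_rfl).2, hd', fun m hm m' hm' h6 h7 h8 => ?_⟩
    have h10 := (hne hm').2
    rcases Nat.lt_or_ge c m' with h11 | h11
    · exact (e2 _ h11 h7).2
    · rw [hlow _ (by omega)] at h8 ⊢
      exact h.mono m hm.1 m' hm'.1 h6 h11 h8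

/-- The hop at a stage of the composition of the local rules: either all of `I` is to the left of
`β`, or the hop is the first swap in the rule set. -/
def RuleState (k α β : ℕ) (I : Finset ℕ) (w : ℕ → ℕ) (c d : ℕ) : Prop :=
  (d = β ∧ α ≤ c ∧ c < β ∧ (∀ y, α ≤ y → y < c → y ∈ I) ∧ (∀ y ∈ I, y + 1 < β) ∧ c ∉ I ∧
    w c ≤ k ∧ k < w β ∧ ∀ y, c < y → y < β → w β < w y) ∨
  (IsFirst (ruleSet I α β) k w c d ∧ ∃ z ∈ I, β ≤ z + 1)

variable {α β : ℕ} {I : Finset ℕ}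

theorem mem_ruleSet_of_least (h1 : α ≤ c) (h2 : c < β) (h3 : ∀ y, α ≤ y → y < c → y ∈ I)
    (h4 : c ∉ I) {m : ℕ} : m ∈ ruleSet I α β ↔ m = c ∨ (m ∉ I ∧ β ≤ m) := by
  have hl : IsLeast {m | m ∉ I ∧ α ≤ m ∧ m < β} c := ⟨⟨h4, h1, h2⟩, fun y hy => by
    by_contra h5
    exact hy.1 (h3 y hy.2.1 (by omega))⟩
  constructor
  · rintro (h | h)
    · exact .inr h
    · exact .inl (h.unique hl)
  · rintro (rfl | h)
    · exact .inr hl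
    · exact .inl h

theorem mem_ruleSet_of_forall (h : ∀ y, α ≤ y → y < β → y ∈ I) {m : ℕ} :
    m ∈ ruleSet I α β ↔ m ∉ I ∧ β ≤ m := by
  constructor
  · rintro (h' | h')
    · exact h'
    · exact absurd (h m h'.1.2.1 h'.1.2.2) h'.1.1
  · exact fun h' => .inl h'

theorem RuleState.isFirst (h : RuleState k α β I w c d) : IsFirst (ruleSet I α β) k w c d := by
  rcases h with ⟨rfl, h1, h2, h3, h4, h5, h6, h7, h8⟩ | h
  · have hm := fun m => mem_ruleSet_of_least h1 h2 h3 h5 (m := m)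
    refine ⟨(hm c).2 (.inl rfl), (hm d).2 (.inr ⟨fun h => ?_, le_rfl⟩), h2, fun m h9 h10 => ?_, h6,
      h7, fun m h9 m' h10 h11 h12 _ => ?_⟩
    · have := h4 d h
      omega
    · rcases (hm m).1 h9 with h11 | h11 <;> omega
    · rcases (hm m).1 h9 with h13 | h13 <;> omega
  · exact h.1

theorem ruleSet_insert (ha : β ≤ a) :
    ruleSet (insert a I) α β = ruleSet I α β \ {a} := by
  have h1 : {m | m ∉ insert a I ∧ α ≤ m ∧ m < β} = {m | m ∉ I ∧ α ≤ m ∧ m < β} := by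
    ext m
    simp only [Finset.mem_insert, Set.mem_ofPred_eq]
    constructor
    · rintro ⟨h1, h2⟩; exact ⟨fun h => h1 (.inr h), h2⟩
    · rintro ⟨h1, h2⟩; exact ⟨by rintro (h | h); exacts [by omega, h1 h], h2⟩
  unfold ruleSet
  rw [h1]
  ext m
  simp only [Finset.mem_insert, Set.mem_ofPred_eq, Set.mem_union, Set.mem_sdiff,
    Set.mem_singleton_iff]
  constructor
  · rintro (h | h)
    · exact ⟨.inl ⟨fun h' => h.1 (.inr h'), h.2⟩, fun h' => h.1 (.inl h')⟩
    · exact ⟨.inr h, by have := h.1.2.2; omega⟩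
  · rintro ⟨h | h, h'⟩
    · exact .inl ⟨by rintro (h'' | h''); exacts [h' h'', h.1 h''], h.2⟩
    · exact .inr h

/-- While the simple transpositions stay to the left of `β`, the large end remains `β`, and the
small end moves one to the right exactly when `a = c`; so `c` is always the least element of `[α,
β)` outside `I`. Once `β ≤ a + 1`, the description by `IsFirst` takes over; if `a = c` and `a + 1 =
β`, the interval `[α, β)` is used up and the rule set loses its extra element. -/
theorem RuleState.step (h : RuleState k α β I w c d) (he : Exchanged k w w' a)
    (ha : ∀ y ∈ I, y < a) (hr : HopsRel k w' a c d c' d' s) (hd' : k < w' d') :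
    RuleState k α β (insert a I) w' c' d' := by
  have hl := he.left
  have hrr := he.right
  have hlarge := he.large
  have hlt := he.lt
  have hI : ∀ y, a ≤ y → y ∉ I := fun y h1 h2 => by
    have := ha y h2
    omega
  rcases h with ⟨rfl, h1, h2, h3, h4, h5, h6, h7, h8⟩ | ⟨h1, z, hz, hz'⟩
  swap
  · have := ha z hz
    refine .inr ⟨?_, z, Finset.mem_insert_of_mem hz, hz'⟩
    rw [ruleSet_insert (by omega)]
    exact h1.step he (fun y hy => .inl ⟨hI y hy, by omega⟩) hr hd'
  rcases Nat.lt_or_ge a d with hd | hd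
  swap
  · have hc' : c' = c := by
      rcases hr with ⟨_, e1, _⟩ | ⟨e1, _⟩
      · unfold Swapped at e1; omega
      · omega
    have hdd : (a = d ∧ d' = d + 1) ∨ (d < a ∧ d' = d) := by
      rcases hr with ⟨_, _, e1, _⟩ | ⟨e1, _⟩
      · unfold Swapped at e1; omega
      · omega
    subst hc'
    have hm := fun m => mem_ruleSet_of_least (I := insert a I) h1 h2
      (fun y h9 h10 => Finset.mem_insert_of_mem (h3 y h9 h10))
      (by rw [Finset.mem_insert]; rintro (h | h); exacts [by omega, h5 h]) (m := m)
    simp only [Finset.mem_insert, not_or] at hm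
    refine .inr ⟨⟨(hm _).2 (.inl rfl), (hm _).2 (.inr ⟨⟨by omega, fun h => ?_⟩, by omega⟩),
      by omega, fun m h9 h10 => ?_, by rw [he.other _ (by omega) (by omega)]; exact h6, hd',
      fun m h9 m' h10 h11 h12 _ => ?_⟩, a, Finset.mem_insert_self _ _, by omega⟩
    · have := h4 _ h
      omega
    · rcases (hm m).1 h9 with h11 | h11 <;> omega
    · rcases (hm m).1 h9 with h13 | h13 <;> omega
  have hbd : a + 1 < d → ∀ y ∈ insert a I, y + 1 < d := fun h9 y hy => by
    rcases Finset.mem_insert.1 hy with rfl | hy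
    exacts [h9, h4 y hy]
  rcases lt_trichotomy a c with hac | rfl | hac
  · have hac' : a + 1 ≠ c := by rintro rfl; omega
    have hcd : c' = c ∧ d' = d := by
      rcases hr with ⟨_, e1, e2, _⟩ | ⟨e1, _⟩
      · unfold Swapped at e1 e2; omega
      · omega
    obtain ⟨rfl, rfl⟩ := hcd
    refine .inl ⟨rfl, h1, h2, fun y h9 h10 => Finset.mem_insert_of_mem (h3 y h9 h10),
      hbd (by omega), by rw [Finset.mem_insert]; rintro (h | h); exacts [by omega, h5 h],
      by rw [he.other _ (by omega) (by omega)]; exact h6, hd', fun y h9 h10 => ?_⟩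
    rw [he.other _ (by omega) (by omega), he.other _ (by omega) (by omega)]
    exact h8 y h9 h10
  · by_cases hd1 : a + 1 = d
    · subst hd1
      rcases hr with ⟨e1, _⟩ | ⟨_, _, rfl, e1, e2, rfl⟩
      · exact absurd ⟨rfl, rfl⟩ e1
      have hm := fun m => mem_ruleSet_of_forall (I := insert a I) (α := α) (β := a + 1)
        (fun y h9 h10 => by
          rw [Finset.mem_insert]
          rcases (by omega : y = a ∨ y < a) with h11 | h11
          exacts [.inl h11, .inr (h3 y h9 h11)]) (m := m)
      simp only [Finset.mem_insert, not_or] at hm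
      refine .inr ⟨⟨(hm _).2 ⟨⟨by omega, hI _ (by omega)⟩, e1⟩,
        (hm _).2 ⟨⟨by omega, hI _ (by omega)⟩, by omega⟩, by omega, fun m _ h10 => h10,
        (e2 _ (by omega) le_rfl).2, hd', fun m h9 m' h10 h11 h12 _ => ?_⟩, a,
        Finset.mem_insert_self _ _, le_rfl⟩
      have := (hm m').1 h10
      exact (e2 m' (by omega) h12).2
    · have hcd : c' = a + 1 ∧ d' = d := by
        rcases hr with ⟨_, e1, e2, _⟩ | ⟨_, e1, _⟩
        · unfold Swapped at e1 e2; omega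
        · omega
      obtain ⟨rfl, rfl⟩ := hcd
      refine .inl ⟨rfl, by omega, by omega, fun y h9 h10 => ?_,
        hbd (by omega),
        by rw [Finset.mem_insert]; rintro (h | h); exacts [by omega, hI _ (by omega) h],
        by omega, hd', fun y h9 h10 => ?_⟩
      · rw [Finset.mem_insert]
        rcases (by omega : y = a ∨ y < a) with h11 | h11
        exacts [.inl h11, .inr (h3 y h9 h11)]
      · rw [he.other _ (by omega) (by omega), he.other _ (by omega) (by omega)]
        exact h8 y (by omega) h10
  -- The values strictly between `c` and `d` exceed the one at `d`, whereas `w a < w (a + 1)`.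
  · have hd1 : a + 1 ≠ d := by
      rintro rfl
      have := h8 a hac hd
      omega
    have hcd : c' = c ∧ d' = d := by
      rcases hr with ⟨_, e1, e2, _⟩ | ⟨e1, _⟩
      · unfold Swapped at e1 e2; omega
      · omega
    obtain ⟨rfl, rfl⟩ := hcd
    refine .inl ⟨rfl, h1, h2, fun y h9 h10 => Finset.mem_insert_of_mem (h3 y h9 h10),
      hbd (by omega), by rw [Finset.mem_insert]; rintro (h | h); exacts [by omega, h5 h],
      by rw [he.other _ (by omega) (by omega)]; exact h6, hd', fun y h9 h10 => ?_⟩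
    rw [he.other d' (by omega) (by omega)]
    have h11 := h8 a hac hd
    have h12 := h8 (a + 1) (by omega) (by omega)
    rcases (by omega : y = a ∨ y = a + 1 ∨ (y ≠ a ∧ y ≠ a + 1)) with rfl | rfl | h13
    · omega
    · omega
    · rw [he.other y h13.1 h13.2]; exact h8 y h9 h10

theorem ruleSet_infinite (I : Finset ℕ) (α β : ℕ) : (ruleSet I α β).Infinite := by
  refine Set.infinite_of_forall_exists_gt fun a => ⟨a + β + I.sup id + 1, .inl ⟨fun h => ?_,
    ?_⟩, ?_⟩
  · have := Finset.le_sup (f := id) h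
    simp only [id_eq] at this
    omega
  · omega
  · omega

theorem compl_infinite (I : Finset ℕ) : {m | 1 ≤ m ∧ m ∉ I}.Infinite := by
  refine Set.infinite_of_forall_exists_gt fun a => ⟨a + I.sup id + 1, ⟨by omega, fun h => ?_⟩, ?_⟩
  · have := Finset.le_sup (f := id) h
    simp only [id_eq] at this
    omega
  · omega

end

/-! ### Products of simple transpositions -/

theorem simpleProd_empty : simpleProd ∅ = 1 := by simp [simpleProd]

theorem simpleProd_insert {I : Finset ℕ} {a : ℕ} (ha : ∀ y ∈ I, y < a) :
    simpleProd (insert a I) = Equiv.swap a (a + 1) * simpleProd I := by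
  unfold simpleProd
  rw [Finset.sort_insert _ (fun b hb => (ha b hb).le) (fun h => lt_irrefl _ (ha a h))]
  simp

theorem simpleProd_symm_apply {I : Finset ℕ} : ∀ {y : ℕ}, (∀ z ∈ I, z + 1 < y) →
    (simpleProd I).symm y = y := by
  induction I using Finset.induction_on_max with
  | empty => intro y _; rw [simpleProd_empty]; rfl
  | insert a s ha ih =>
    intro y hy
    rw [simpleProd_insert ha]
    change (simpleProd s).symm ((Equiv.swap a (a + 1)).symm y) = y
    have h1 := hy a (Finset.mem_insert_self _ _)
    rw [Equiv.symm_swap, Equiv.swap_apply_of_ne_of_ne (by omega) (by omega)]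
    exact ih fun z hz => hy z (Finset.mem_insert_of_mem hz)

theorem simpleProd_insert_symm_ne {I : Finset ℕ} {a : ℕ} (ha : ∀ y ∈ I, y < a) :
    (simpleProd (insert a I)).symm (a + 1) ≠ a + 1 := by
  rw [simpleProd_insert ha]
  change (simpleProd I).symm ((Equiv.swap a (a + 1)).symm (a + 1)) ≠ a + 1
  rw [Equiv.symm_swap, Equiv.swap_apply_right]
  intro h
  have h1 : (simpleProd I).symm (a + 1) = a + 1 :=
    simpleProd_symm_apply fun z hz => by have := ha z hz; omega
  have := (simpleProd I).symm.injective (h.trans h1.symm)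
  omega

theorem exists_eq_insert_max {J : Finset ℕ} (hJ : J ≠ ∅) :
    ∃ m s, J = insert m s ∧ ∀ y ∈ s, y < m := by
  induction J using Finset.induction_on_max with
  | empty => exact absurd rfl hJ
  | insert a s ha _ => exact ⟨a, s, rfl, ha⟩

/-- The largest point moved by the inverse product is one more than the maximum of the set, so the
set can be read off from above. -/
theorem simpleProd_injective {I J : Finset ℕ} (h : simpleProd I = simpleProd J) : I = J := by
  induction I using Finset.induction_on_max generalizing J with
  | empty =>
    by_contra hJ
    obtain ⟨m, s, rfl, hs⟩ := exists_eq_insert_max (Ne.symm hJ)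
    apply simpleProd_insert_symm_ne hs
    rw [← h, simpleProd_empty]
    rfl
  | insert a s ha ih =>
    have hJ : J ≠ ∅ := by
      rintro rfl
      apply simpleProd_insert_symm_ne ha
      rw [h, simpleProd_empty]
      rfl
    obtain ⟨m, t, rfl, ht⟩ := exists_eq_insert_max hJ
    have hlt : ∀ {a m : ℕ} {s t : Finset ℕ}, (∀ y ∈ s, y < a) → (∀ y ∈ t, y < m) →
        simpleProd (insert a s) = simpleProd (insert m t) → ¬ a < m := by
      intro a m s t ha ht h hlt
      apply simpleProd_insert_symm_ne ht
      rw [← h]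
      refine simpleProd_symm_apply fun z hz => ?_
      rcases Finset.mem_insert.1 hz with rfl | hz
      · omega
      · have := ha z hz
        omega
    obtain rfl : a = m := by
      have := hlt ha ht h
      have := hlt ht ha h.symm
      omega
    rw [simpleProd_insert ha, simpleProd_insert ht] at h
    rw [ih (mul_left_cancel h)]

theorem swap_eq_swap {α β p q : ℕ} (h1 : α < β) (h2 : p < q)
    (h : Equiv.swap α β = Equiv.swap p q) : p = α ∧ q = β := by
  have h3 : Equiv.swap α β p = q := by rw [h, Equiv.swap_apply_left]
  rw [Equiv.swap_apply_def] at h3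
  split_ifs at h3 <;> omega

/-! ### Insertion into a chain of couplings -/

/-- A sequence of coupled pipe dreams that starts with `E`. -/
inductive Chain (i K : ℕ) (E : LPD) : LPD → (ℕ → ℕ) → Prop
  | nil (h : E.Inc K) : Chain i K E E fun _ => 0
  | snoc {D F : LPD} {a c : ℕ → ℕ} (h : Chain i K E D a) (hc : Coupling i D F c)
      (hF : F.Inc K) : Chain i K E F c

/-- The insertion that exchanges the labels in the columns `α x` and `β x` ends with the exchange of
the values `c < d` of the permutation `μ`. -/
structure FinalHop (k : ℕ) (D' : LPD) (α β : ℕ → ℕ) (μ : Equiv.Perm ℕ) (c d : ℕ) : Prop where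
  lt : c < d
  pos : c ≠ 0
  const : ∃ n, ∀ x, n ≤ x → α x = c ∧ β x = d ∧ d ≤ x
  perm : D'.HasPerm (Equiv.swap c d * μ)
  small : μ.symm c ≤ k
  large : k < μ.symm d

section
variable {i k K b : ℕ} {E D F E' D' : LPD} {a a' α β α' β' s : ℕ → ℕ} {π μ : Equiv.Perm ℕ}

theorem Chain.inc (h : Chain i K E D a) : D.Inc K := by
  cases h with
  | nil h => exact h
  | snoc _ _ h => exact h

theorem Chain.start_inc (h : Chain i K E D a) : E.Inc K := by
  induction h with
  | nil h => exact h
  | snoc _ _ _ ih => exact ih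

theorem Chain.mono (h : Chain i K E D a) (hk : k ≤ K) : Chain i k E D a := by
  induction h with
  | nil h => exact .nil (h.mono hk)
  | snoc _ hc hF ih => exact .snoc ih hc (hF.mono hk)

theorem Chain.lt (h : Chain i K E D a) (hc : Coupling i D F a') (hi : 1 ≤ i) {x : ℕ}
    (hx : i ≤ x) : a x < a' x := by
  cases h with
  | nil h =>
    by_contra h1
    have h2 := (hc.word x hx).pos
    rw [show a' x = 0 by simpa using h1] at h2
    exact h2 (LPD.word _ x).zero
  | snoc _ hc' _ => exact hc'.lt hc hi hx

theorem Chain.hasPerm (h : Chain i K E D a) (hπ : E.HasPerm π) : ∃ μ, D.HasPerm μ := by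
  induction h with
  | nil h => exact ⟨π, hπ⟩
  | snoc _ hc _ ih =>
    obtain ⟨μ, hμ⟩ := ih
    obtain ⟨A, _, _, _, h, _⟩ := hc.hasPerm hμ
    exact ⟨_, h⟩

theorem InsPath.exists_finalHop (hp : InsPath k b D D' α β) (hμ : D.HasPerm μ) :
    ∃ c d, FinalHop k D' α β μ c d := by
  obtain ⟨c, d, n, h1, h2, h3, h4, h5, h6⟩ := hp.hasPerm hμ
  exact ⟨c, d, h1, h2, ⟨n, h3⟩, h4, h5, h6⟩

/-- This is the condition of the hop, read at the bottom, where the words have no holes. -/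
theorem FinalHop.between (hf : FinalHop k D' α β μ c d) (hp : InsPath k b D D' α β)
    (hμ : D.HasPerm μ) {y : ℕ} (h1 : c < y) (h2 : y < d) : μ.symm d < μ.symm y := by
  obtain ⟨n, hn⟩ := hf.const
  obtain ⟨_, m, hm⟩ := hμ
  have hx := hn (n + m + b) (by omega)
  have hh := hp.hop (n + m + b) (by omega)
  rw [hx.1, hx.2.1] at hh
  have e := fun y h1 h2 => hm (n + m + b) (by omega) y h1 h2
  have hl := hf.large
  have hs := hh.mid h1 h2
  have hne : μ.symm y ≠ 0 := by
    intro h0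
    have h3 : μ.symm 0 = 0 := (Equiv.symm_apply_eq μ).2 (by assumption : μ 0 = 0).symm
    have := μ.symm.injective (h0.trans h3.symm)
    omega
  rw [e y (by omega) (by omega), e d (by omega) (by omega)] at hs
  omega

/-- The coupling at the bottom. -/
theorem Coupling.final (hc : Coupling i E D a) (hπ : E.HasPerm π) (hD : D.Inc k) :
    ∃ A n, A ≠ 0 ∧ (∀ x, n ≤ x → a x = A) ∧ D.HasPerm (Equiv.swap A (A + 1) * π) ∧
      Exchanged k π.symm (Equiv.swap A (A + 1) * π).symm A := by
  obtain ⟨A, n, h1, h2, h3, h4⟩ := hc.hasPerm hπ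
  have happ : ∀ y, (Equiv.swap A (A + 1) * π).symm y = π.symm (Equiv.swap A (A + 1) y) :=
    fun y => rfl
  refine ⟨A, n, h1, fun x hx => (h2 x hx).1, h3, ⟨?_, ?_, fun y h5 h6 => ?_, h4, ?_⟩⟩
  · rw [happ, Equiv.swap_apply_left]
  · rw [happ, Equiv.swap_apply_right]
  · rw [happ, Equiv.swap_apply_of_ne_of_ne h5 h6]
  · obtain ⟨_, m, hm⟩ := hπ
    have h5 := h2 (n + m + i) (by omega)
    have h6 := (hc.word (n + m + i) (by omega)).large (hD _)
    rw [h5.1, hm _ (by omega) _ (by omega) h5.2] at h6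
    omega

theorem HopsRel.final {A c d c' d' : ℕ}
    (hr : ∀ x, b ≤ x → HopsRel k (D.V x) (a x) (α x) (β x) (α' x) (β' x) (s x))
    (ha : ∃ n, ∀ x, n ≤ x → a x = A) (hf : FinalHop k E' α β π c d)
    (hf' : FinalHop k D' α' β' μ c' d') (hμ : D.HasPerm μ) :
    ∃ t, HopsRel k μ.symm A c d c' d' t := by
  obtain ⟨n₁, h1⟩ := ha
  obtain ⟨n₂, h2⟩ := hf.const
  obtain ⟨n₃, h3⟩ := hf'.const
  obtain ⟨h0, n₄, h4⟩ := hμ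
  let x := n₁ + n₂ + n₃ + n₄ + b
  have e := hr x (by omega)
  have e3 := h3 x (by omega)
  have hlt := hf'.lt
  rw [h1 x (by omega), (h2 x (by omega)).1, (h2 x (by omega)).2.1, e3.1, e3.2.1] at e
  refine ⟨s x, ?_⟩
  rcases e with e | ⟨e1, e2, e3', e4, e5, e6⟩
  · exact .inl e
  · refine .inr ⟨e1, e2, e3', e4, fun y h5 h6 => ?_, e6⟩
    have := e5 y h5 h6
    rwa [h4 x (by omega) y (by omega) (by omega)] at this

/-- The result of the insertion of a biletter into all members of a chain from `E` to `D`: the chain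
of the new pipe dreams, which starts with `E₀`, and the last transposition. -/
def Inserted (k b i : ℕ) (E E₀ : LPD) (π : Equiv.Perm ℕ)
    (S : Finset ℕ → (ℕ → ℕ) → ℕ → ℕ → Prop) (D : LPD) (a : ℕ → ℕ) : Prop :=
  ∃ (D' : LPD) (α β a' : ℕ → ℕ) (I : Finset ℕ) (μ : Equiv.Perm ℕ) (c d : ℕ),
    InsPath k b D D' α β ∧ Chain i k E₀ D' a' ∧ 0 ∉ I ∧ D.HasPerm μ ∧ μ = simpleProd I * π ∧
    FinalHop k D' α β μ c d ∧ (∃ n, ∀ x, n ≤ x → ∀ y ∈ I, y ≤ a x) ∧ S I μ.symm c d ∧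
    (I = ∅ → D = E)

/-- The states `S` of the composition are compatible with the local rule. -/
def IsInvariant (k : ℕ) (S : Finset ℕ → (ℕ → ℕ) → ℕ → ℕ → Prop) : Prop :=
  ∀ {I : Finset ℕ} {w w' : ℕ → ℕ} {A c d c' d' t : ℕ}, S I w c d → (∀ y ∈ I, y < A) → A ≠ 0 →
    Exchanged k w w' A → HopsRel k w' A c d c' d' t → k < w' d' → S (insert A I) w' c' d'

variable {E₀ : LPD} {S : Finset ℕ → (ℕ → ℕ) → ℕ → ℕ → Prop}

/-- The chain grows by the coupling from `D'` to the new pipe dream, and `I` by the final column `A`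
of the coupling from `D` to `F`. As couplings move strictly right along the chain, `A` exceeds all
of `I`. -/
theorem Inserted.step (h : Inserted k b i E E₀ π S D a) (hc : Coupling i D F a')
    (hlt : ∀ x, i ≤ x → a x < a' x) (hD : D.Inc k) (hF : F.Inc k) (hi : 1 ≤ i) (hib : i ≤ b)
    (hbk : b ≤ k) (hS : IsInvariant k S) : Inserted k b i E E₀ π S F a' := by
  obtain ⟨D', α, β, a₁, I, μ, c, d, h1, h2, h3, h4, h5, h6, ⟨n, h7⟩, h8, h9⟩ := h
  obtain ⟨F', α', β', hF'⟩ := F.exists_insPath (by omega : 1 ≤ b) hbk hF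
  obtain ⟨s, hs, hr⟩ := hc.insert h1 hF' hD hF hi hib
  obtain ⟨A, m, e1, e2, e3, e4⟩ := hc.final h4 hF
  obtain ⟨c', d', hf⟩ := hF'.exists_finalHop e3
  obtain ⟨t, ht⟩ := HopsRel.final hr ⟨m, e2⟩ h6 hf e3
  have hI : ∀ y ∈ I, y < A := fun y hy => by
    have f1 := h7 (n + m + i) (by omega) y hy
    have f2 := hlt (n + m + i) (by omega)
    rw [e2 _ (by omega)] at f2
    omega
  refine ⟨F', α', β', s, insert A I, _, c', d', hF', .snoc h2 hs (hF'.inc hF), ?_, e3, ?_, hf,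
    ⟨m, fun x hx y hy => ?_⟩, hS h8 hI e1 e4 ht hf.large,
    fun h => absurd h (Finset.insert_ne_empty _ _)⟩
  · rw [Finset.mem_insert]
    rintro (h | h)
    exacts [e1 h.symm, h3 h]
  · rw [simpleProd_insert hI, h5, mul_assoc]
  · rw [e2 x hx]
    rcases Finset.mem_insert.1 hy with rfl | hy
    exacts [le_rfl, (hI y hy).le]

theorem Chain.inserted (h : Chain i K E D a) (hk : k ≤ K) (hi : 1 ≤ i) (hib : i ≤ b)
    (hbk : b ≤ k) (hS : IsInvariant k S) (h0 : Inserted k b i E E₀ π S E fun _ => 0) :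
    Inserted k b i E E₀ π S D a := by
  induction h with
  | nil h => exact h0
  | snoc h hc hF ih =>
    exact ih.step hc (fun x hx => h.lt hc hi hx) (h.inc.mono hk) (hF.mono hk) hi hib hbk hS

/-- The composition starts with `I = ∅` and the swap of `E` itself; the new chain starts with `E'`.
-/
theorem Chain.inserted_large (h : Chain i K E D a) (hk : k ≤ K) (hi : 1 ≤ i) (hib : i ≤ b)
    (hbk : b ≤ k) (hE : E.Inc k) (hπ : E.HasPerm π) (hp : InsPath k b E E' α β) {p q : ℕ}
    (hf : FinalHop k E' α β π p q) : Inserted k b i E E' π (RuleState k p q) D a := by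
  refine h.inserted hk hi hib hbk (fun h1 h2 _ h4 h5 h6 => h1.step h4 h2 h5 h6)
    ⟨E', α, β, _, ∅, π, p, q, hp, .nil (hp.inc hE), Finset.notMem_empty _, hπ,
      by rw [simpleProd_empty, one_mul], hf, ⟨0, by simp⟩, .inl ⟨rfl, le_rfl, hf.lt,
      fun y h1 h2 => by omega, by simp, Finset.notMem_empty _, hf.small, hf.large,
      fun y h1 h2 => hf.between hp hπ h1 h2⟩, fun _ => rfl⟩

/-- `E` itself remains the start of the chain, and its insertion `E'` becomes an additional second
member. The composition starts with the adjacent swap `(p, p + 1)`, which is the first one because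
all values up to `p` have positions `≤ k`. -/
theorem Chain.inserted_new (h : Chain i K E D a) (hk : k ≤ K) (hi : 1 ≤ i) (hik : i ≤ k)
    (hE : E.Inc k) (hπ : E.HasPerm π) (hid : ∀ c, 1 ≤ c → c ≤ i → E.V i c = c) :
    Inserted k i i E E π (fun I w c d => IsFirst {m | 1 ≤ m ∧ m ∉ I} k w c d) D a := by
  obtain ⟨E', α, β, hp⟩ := E.exists_insPath hi hik hE
  obtain ⟨p, q, hf⟩ := hp.exists_finalHop hπ
  obtain ⟨hc, hr⟩ := hp.coupling hE hi hid
  have hpq : q = p + 1 ∧ ∀ y, 1 ≤ y → y ≤ p → π.symm y ≤ k := by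
    obtain ⟨n, hn⟩ := hf.const
    obtain ⟨_, m, hm⟩ := hπ
    have e1 := hn (n + m + i) (by omega)
    have e2 := hr (n + m + i) (by omega)
    have := hf.lt
    rw [e1.1, e1.2.1] at e2
    refine ⟨e2.1, fun y h1 h2 => ?_⟩
    rw [← hm (n + m + i) (by omega) y h1 (by omega)]
    exact (e2.2 y h1 h2).2
  have hp0 := hf.pos
  refine h.inserted hk hi le_rfl hik
    (fun {I} {w} {w'} {A} {c} {d} {c'} {d'} {t} h1 h2 h3 h4 h5 h6 => ?_)
    ⟨E', α, β, α, ∅, π, p, q, hp, .snoc (.nil hE) hc (hp.inc hE), Finset.notMem_empty _, hπ,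
      by rw [simpleProd_empty, one_mul], hf, ⟨0, by simp⟩, ⟨⟨by omega, Finset.notMem_empty _⟩,
      ⟨by have := hf.lt; omega, Finset.notMem_empty _⟩, hf.lt, fun m _ h1 => by omega, hf.small,
      hf.large, fun m _ m' h2 _ h4 _ => hpq.2 m' h2.1 h4⟩, fun _ => rfl⟩
  have hset : {m | 1 ≤ m ∧ m ∉ insert A I} = {m | 1 ≤ m ∧ m ∉ I} \ {A} := by
    ext m
    simp only [Finset.mem_insert, Set.mem_ofPred_eq, Set.mem_sdiff, Set.mem_singleton_iff]
    tauto
  rw [hset]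
  refine IsFirst.step h1 h4 (fun y hy => ⟨by omega, fun hyI => ?_⟩) h5 h6
  have := h2 y hyI
  omega

end

/-! ### Columns of the growth diagram and the theorem -/

theorem LPD.id_grid : LPD.id.grid = idGrid := by
  funext x y
  obtain _ | x := x
  · simp [LPD.grid, gridOf, idGrid]
  obtain _ | y := y
  · simp [LPD.grid, gridOf, idGrid]
  · unfold LPD.grid
    rw [gridOf_succ]
    simp only [LPD.id, tileOf, idGrid]
    grind

theorem insertWord_append_singleton {w : List (ℕ × ℕ)} {p : ℕ × ℕ} {D E : Grid} :
    InsertWord D (w ++ [p]) E ↔ ∃ D', InsertWord D w D' ∧ RightInsert D' p.1 p.2 E := by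
  induction w generalizing D with
  | nil =>
    obtain ⟨b, k⟩ := p
    simp [InsertWord]
  | cons q w ih =>
    obtain ⟨b, k⟩ := q
    simp only [List.cons_append, InsertWord, ih]
    constructor
    · rintro ⟨F, h1, G, h2, h3⟩
      exact ⟨G, ⟨F, h1, h2⟩, h3⟩
    · rintro ⟨G, ⟨F, h1, h2⟩, h3⟩
      exact ⟨F, h1, G, h2, h3⟩

section
variable {Q : List (ℕ × ℕ)} {i j b k K : ℕ} {L L' : LPD} {α β : ℕ → ℕ} {π μ : Equiv.Perm ℕ}

theorem subword_zero : subword Q i 0 = [] := by simp [subword]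

theorem subword_succ_of_lt (h : Q[j]? = some (b, k)) (hi : i < b) :
    subword Q i (j + 1) = subword Q i j ++ [(b, k)] := by
  simp [subword, List.take_add_one, h, hi]

theorem subword_succ_of_le (h : Q[j]? = some (b, k)) (hi : b ≤ i) :
    subword Q i (j + 1) = subword Q i j := by
  simp [subword, List.take_add_one, h, hi]

theorem subword_succ_of_none (h : Q[j]? = none) : subword Q i (j + 1) = subword Q i j := by
  simp [subword, List.take_add_one, h]

/-- The insertion of `w(i, j)` into the pipe dream of the identity gives `L`. -/
def Reached (Q : List (ℕ × ℕ)) (i j : ℕ) (L : LPD) : Prop :=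
  ∀ E, InsertWord idGrid (subword Q i j) E ↔ E = L.grid

theorem Reached.zero : Reached Q i 0 LPD.id := by
  intro E
  rw [subword_zero, LPD.id_grid]
  exact Iff.rfl

theorem Reached.of_eq (h : Reached Q i j L) (he : subword Q i (j + 1) = subword Q i j) :
    Reached Q i (j + 1) L := by
  intro E
  rw [he]
  exact h E

theorem Reached.succ (h : Reached Q i j L) (hQ : Q[j]? = some (b, k)) (hi : i < b)
    (hp : InsPath k b L L' α β) (hinc : L.Inc k) : Reached Q i (j + 1) L' := by
  intro E
  rw [subword_succ_of_lt hQ hi, insertWord_append_singleton]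
  constructor
  · rintro ⟨D', h1, h2⟩
    rw [(h D').1 h1] at h2
    exact (hp.rightInsert_iff hinc (by omega) E).1 h2
  · intro h1
    exact ⟨_, (h _).2 rfl, (hp.rightInsert_iff hinc (by omega) E).2 h1⟩

theorem Reached.eq {P : ℕ → ℕ → Equiv.Perm ℕ} (h : Reached Q i j L) (hP : IsGrowthDiagram Q P)
    (hμ : L.HasPerm μ) : P i j = μ := by
  obtain ⟨D, h1, h2⟩ := hP i j
  rw [(h D).1 h1] at h2
  exact h2.perm_unique (L.isBPD hμ)

/-- The state of the growth diagram in the column `j`. -/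
def ColumnState (Q : List (ℕ × ℕ)) (i j : ℕ) (E D : LPD) (a : ℕ → ℕ) (K : ℕ)
    (π : Equiv.Perm ℕ) : Prop :=
  Reached Q (i + 1) j E ∧ Reached Q i j D ∧ Chain (i + 1) K E D a ∧ (∀ p ∈ Q.drop j, p.2 ≤ K) ∧
    E.HasPerm π ∧ ∀ c, 1 ≤ c → c ≤ i + 1 → E.V (i + 1) c = c

theorem IsPlactic.drop_succ (hQ : IsPlactic Q) (h : Q[j]? = some (b, k)) :
    ∀ p ∈ Q.drop (j + 1), p.2 ≤ k := by
  obtain ⟨hj, h1⟩ := List.getElem?_eq_some_iff.1 h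
  have h2 := hQ.2.sublist (List.drop_sublist j Q)
  rw [List.drop_eq_getElem_cons hj, List.pairwise_cons, h1] at h2
  exact h2.1

theorem IsPlactic.biletter (hQ : IsPlactic Q) (h : Q[j]? = some (b, k)) : 1 ≤ b ∧ b ≤ k :=
  hQ.1 (b, k) (List.mem_of_getElem? h)

section
variable {E D : LPD} {a : ℕ → ℕ}

theorem ColumnState.le (h : ColumnState Q i j E D a K π)
    (hbk : Q[j]? = some (b, k)) : k ≤ K := by
  obtain ⟨hj, hb⟩ := List.getElem?_eq_some_iff.1 hbk
  exact h.2.2.2.1 (b, k) (by rw [List.drop_eq_getElem_cons hj, hb]; simp)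

theorem ColumnState.succ_of_small (h : ColumnState Q i j E D a K π) (hQ : IsPlactic Q)
    (hbk : Q[j]? = some (b, k)) (hb : b < i + 1) : ColumnState Q i (j + 1) E D a k π :=
  ⟨h.1.of_eq (subword_succ_of_le hbk hb.le), h.2.1.of_eq (subword_succ_of_le hbk (by omega)),
    h.2.2.1.mono (h.le hbk), hQ.drop_succ hbk, h.2.2.2.2⟩

theorem ColumnState.succ_of_large (h : ColumnState Q i j E D a K π) (hQ : IsPlactic Q)
    (hbk : Q[j]? = some (b, k)) (hb : i + 1 < b) :
    ∃ (E' D' : LPD) (a' : ℕ → ℕ) (I : Finset ℕ) (μ : Equiv.Perm ℕ) (p q c d : ℕ),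
      ColumnState Q i (j + 1) E' D' a' k (Equiv.swap p q * π) ∧ p < q ∧ π.symm p ≤ k ∧
      k < π.symm q ∧ D.HasPerm μ ∧ D'.HasPerm (Equiv.swap c d * μ) ∧ 0 ∉ I ∧
      μ = simpleProd I * π ∧ IsFirst (ruleSet I p q) k μ.symm c d ∧
      (I = ∅ → Equiv.swap c d * μ = Equiv.swap p q * π) := by
  have hk := h.le hbk
  obtain ⟨h1, h2, h3, -, h5, h6⟩ := h
  obtain ⟨hb1, hb2⟩ := hQ.biletter hbk
  have hD := h3.inc.mono hk
  have hE : E.Inc k := h3.start_inc.mono hk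
  obtain ⟨E', α, β, hE'⟩ := E.exists_insPath hb1 hb2 hE
  obtain ⟨p, q, hf⟩ := hE'.exists_finalHop h5
  obtain ⟨D', α', β', a', I, μ, c, d, g1, g2, g3, g4, g5, g6, -, g8, g9⟩ :=
    h3.inserted_large hk (by omega) hb.le hb2 hE h5 hE' hf
  refine ⟨E', D', a', I, μ, p, q, c, d, ⟨h1.succ hbk hb hE' hE, h2.succ hbk (by omega) g1 hD, g2,
    hQ.drop_succ hbk, hf.perm, fun x hx hx' => ?_⟩, hf.lt, hf.small, hf.large, g4, g6.perm, g3, g5,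
    g8.isFirst, fun hI => ?_⟩
  · rw [(hE'.lo _ hb).1]
    exact h6 x hx hx'
  -- With `I = ∅` the same biletter is inserted twice into the same tiling. The results coincide by
  -- determinism, and a tiling determines its permutation.
  · obtain rfl := g9 hI
    have h7 := (g1.rightInsert_iff hE hb1 E'.grid).1 ((hE'.rightInsert_iff hE hb1 E'.grid).2 rfl)
    have h8 := E'.isBPD hf.perm
    rw [h7] at h8
    exact (D'.isBPD g6.perm).perm_unique h8

theorem ColumnState.succ_of_new (h : ColumnState Q i j E D a K π) (hQ : IsPlactic Q)
    (hbk : Q[j]? = some (b, k)) (hb : b = i + 1) :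
    ∃ (D' : LPD) (a' : ℕ → ℕ) (I : Finset ℕ) (μ : Equiv.Perm ℕ) (c d : ℕ),
      ColumnState Q i (j + 1) E D' a' k π ∧ D.HasPerm μ ∧ D'.HasPerm (Equiv.swap c d * μ) ∧
      0 ∉ I ∧ μ = simpleProd I * π ∧ IsFirst {m | 1 ≤ m ∧ m ∉ I} k μ.symm c d := by
  have hk := h.le hbk
  obtain ⟨h1, h2, h3, -, h5, h6⟩ := h
  subst hb
  obtain ⟨hb1, hb2⟩ := hQ.biletter hbk
  obtain ⟨D', α', β', a', I, μ, c, d, g1, g2, g3, g4, g5, g6, -, g8, -⟩ :=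
    h3.inserted_new hk hb1 hb2 (h3.start_inc.mono hk) h5 h6
  exact ⟨D', a', I, μ, c, d, ⟨h1.of_eq (subword_succ_of_le hbk le_rfl),
    h2.succ hbk (by omega) g1 (h3.inc.mono hk), g2, hQ.drop_succ hbk, h5, h6⟩, g4, g6.perm, g3, g5,
    g8⟩

end

theorem exists_columnState (hQ : IsPlactic Q) (i j : ℕ) :
    ∃ E D a K π, ColumnState Q i j E D a K π := by
  induction j with
  | zero =>
    -- The identity has no crossings, so any bound of the subscripts serves as the initial `K`;
    -- their sum is one.
    refine ⟨LPD.id, LPD.id, _, (Q.map Prod.snd).sum, 1, Reached.zero, Reached.zero,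
      .nil (LPD.id_inc _), fun p hp => ?_, LPD.id_hasPerm, fun c h1 h2 => ?_⟩
    · exact List.single_le_sum (by simp) _ (List.mem_map_of_mem (by simpa using hp))
    · simp [LPD.id, h1, h2]
  | succ j ih =>
    obtain ⟨E, D, a, K, π, h1, h2, h3, h4, h5, h6⟩ := ih
    rcases hbk : Q[j]? with _ | ⟨b, k⟩
    · refine ⟨E, D, a, K, π, h1.of_eq (subword_succ_of_none hbk),
        h2.of_eq (subword_succ_of_none hbk), h3, fun p hp => ?_, h5, h6⟩
      rw [List.getElem?_eq_none_iff] at hbk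
      rw [List.drop_eq_nil_of_le (by omega)] at hp
      simp at hp
    · have h : ColumnState Q i j E D a K π := ⟨h1, h2, h3, h4, h5, h6⟩
      rcases lt_trichotomy b (i + 1) with hb | hb | hb
      · exact ⟨_, _, _, _, _, h.succ_of_small hQ hbk hb⟩
      · obtain ⟨_, _, _, _, _, _, h', _⟩ := h.succ_of_new hQ hbk hb
        exact ⟨_, _, _, _, _, h'⟩
      · obtain ⟨_, _, _, _, _, _, _, _, _, h', _⟩ := h.succ_of_large hQ hbk hb
        exact ⟨_, _, _, _, _, h'⟩

theorem existsUnique_growthDiagram (hQ : IsPlactic Q) :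
    ∃! P : ℕ → ℕ → Equiv.Perm ℕ, IsGrowthDiagram Q P := by
  have h : ∀ i j, ∃ L μ, Reached Q i j L ∧ L.HasPerm μ := fun i j => by
    obtain ⟨E, D, a, K, π, _, h2, h3, _, h5, _⟩ := exists_columnState hQ i j
    obtain ⟨μ, hμ⟩ := h3.hasPerm h5
    exact ⟨D, μ, h2, hμ⟩
  choose L P hL hP using h
  refine ⟨P, fun i j => ⟨_, (hL i j _).2 rfl, (L i j).isBPD (hP i j)⟩, fun P' hP' => ?_⟩
  funext i j
  exact (hL i j).eq hP' (hP i j)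

theorem simpleProd_mul_cancel {I J : Finset ℕ} (h : simpleProd I * π = simpleProd J * π) : I = J :=
  simpleProd_injective (mul_right_cancel h)

section
variable {P : ℕ → ℕ → Equiv.Perm ℕ}

theorem local_rule_of_small (hQ : IsPlactic Q) (hP : IsGrowthDiagram Q P)
    (hbk : Q[j]? = some (b, k)) (hb : b < i + 1) :
    P (i + 1) (j + 1) = P (i + 1) j ∧ P i (j + 1) = P i j := by
  obtain ⟨E, D, a, K, π, h⟩ := exists_columnState hQ i j
  obtain ⟨μ, hμ⟩ := h.2.2.1.hasPerm h.2.2.2.2.1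
  have h' := h.succ_of_small hQ hbk hb
  rw [h.1.eq hP h.2.2.2.2.1, h'.1.eq hP h.2.2.2.2.1, h.2.1.eq hP hμ, h'.2.1.eq hP hμ]
  exact ⟨rfl, rfl⟩

theorem local_rule_of_large (hQ : IsPlactic Q) (hP : IsGrowthDiagram Q P)
    (hbk : Q[j]? = some (b, k)) (hb : i + 1 < b) :
    ∃ (I : Finset ℕ) (p q : ℕ), 0 ∉ I ∧ P i j = simpleProd I * P (i + 1) j ∧ p < q ∧
      P (i + 1) (j + 1) = Equiv.swap p q * P (i + 1) j ∧ (P (i + 1) j).symm p ≤ k ∧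
      k < (P (i + 1) j).symm q ∧ FirstSwap (ruleSet I p q) k (P i j) (P i (j + 1)) ∧
      (I = ∅ → P i (j + 1) = P (i + 1) (j + 1)) := by
  obtain ⟨E, D, a, K, π, h⟩ := exists_columnState hQ i j
  obtain ⟨E', D', a', I, μ, p, q, c, d, h', h1, h2, h3, h4, h5, h6, h7, h8, h9⟩ :=
    h.succ_of_large hQ hbk hb
  rw [h.1.eq hP h.2.2.2.2.1, h'.1.eq hP h'.2.2.2.2.1, h.2.1.eq hP h4, h'.2.1.eq hP h5]
  exact ⟨I, p, q, h6, h7, h1, rfl, h2, h3, h8.firstSwap (ruleSet_infinite I p q), h9⟩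

theorem local_rule_of_new (hQ : IsPlactic Q) (hP : IsGrowthDiagram Q P)
    (hbk : Q[j]? = some (b, k)) (hb : b = i + 1) :
    P (i + 1) (j + 1) = P (i + 1) j ∧ ∃ I : Finset ℕ, 0 ∉ I ∧
      P i j = simpleProd I * P (i + 1) j ∧
      FirstSwap {m | 1 ≤ m ∧ m ∉ I} k (P i j) (P i (j + 1)) := by
  obtain ⟨E, D, a, K, π, h⟩ := exists_columnState hQ i j
  obtain ⟨D', a', I, μ, c, d, h', h4, h5, h6, h7, h8⟩ := h.succ_of_new hQ hbk hb
  rw [h.1.eq hP h.2.2.2.2.1, h'.1.eq hP h'.2.2.2.2.1, h.2.1.eq hP h4, h'.2.1.eq hP h5]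
  exact ⟨rfl, I, h6, h7, h8.firstSwap (compl_infinite I)⟩

end

end

end PlacticGrowth

/-- The row `i` and the column `j` of the statement in words are `i + 1` and `j + 1` here, and
`Q[j]?` counts from `0`; hence the cross is at `b = i + 1`. -/
theorem mainTheorem2 (Q : List (ℕ × ℕ)) (hQ : PlacticGrowth.IsPlactic Q) :
    (∃! P : ℕ → ℕ → Equiv.Perm ℕ, PlacticGrowth.IsGrowthDiagram Q P) ∧
    ∀ P : ℕ → ℕ → Equiv.Perm ℕ, PlacticGrowth.IsGrowthDiagram Q P →
      ∀ (i j b k : ℕ) (π σ μ ρ : Equiv.Perm ℕ), Q[j]? = some (b, k) →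
        π = P (i + 1) j → σ = P (i + 1) (j + 1) → μ = P i j → ρ = P i (j + 1) →
        (b ≠ i + 1 →
          (π = σ → ρ = μ) ∧
          (π = μ → ρ = σ) ∧
          (π ≠ σ → π ≠ μ →
            (∃ I : Finset ℕ, 0 ∉ I ∧ μ = PlacticGrowth.simpleProd I * π) ∧
            (∃ α β : ℕ, α < β ∧ σ = Equiv.swap α β * π ∧ π.symm α ≤ k ∧ k < π.symm β) ∧
            ∀ (I : Finset ℕ) (α β : ℕ), 0 ∉ I → μ = PlacticGrowth.simpleProd I * π →
              α < β → σ = Equiv.swap α β * π →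
              PlacticGrowth.FirstSwap (PlacticGrowth.ruleSet I α β) k μ ρ)) ∧
        (b = i + 1 →
          π = σ ∧
          (∃ I : Finset ℕ, 0 ∉ I ∧ μ = PlacticGrowth.simpleProd I * π) ∧
          ∀ I : Finset ℕ, 0 ∉ I → μ = PlacticGrowth.simpleProd I * π →
            PlacticGrowth.FirstSwap {m | 1 ≤ m ∧ m ∉ I} k μ ρ) := by
  refine ⟨PlacticGrowth.existsUnique_growthDiagram hQ, ?_⟩
  rintro P hP i j b k π σ μ ρ hbk rfl rfl rfl rfl
  refine ⟨fun hb => ?_, fun hb => ?_⟩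
  · rcases lt_or_gt_of_ne hb with hb | hb
    · obtain ⟨h1, h2⟩ := PlacticGrowth.local_rule_of_small hQ hP hbk hb
      exact ⟨fun _ => h2, fun h => by rw [h1, h2, h], fun h => absurd h1.symm h⟩
    · obtain ⟨I, p, q, h1, h2, h3, h4, h5, h6, h7, h8⟩ :=
        PlacticGrowth.local_rule_of_large hQ hP hbk hb
      refine ⟨fun h => ?_, fun h => ?_, fun _ _ => ⟨⟨I, h1, h2⟩, ⟨p, q, h3, h4, h5, h6⟩, ?_⟩⟩
      -- A letter above `i + 1` really changes the permutation, as `p < q`; so the first case is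
      -- void here.
      · rw [← h, right_eq_mul, Equiv.swap_eq_one_iff] at h4
        omega
      · refine h8 (PlacticGrowth.simpleProd_mul_cancel (π := P (i + 1) j) ?_)
        rw [← h2, ← h, PlacticGrowth.simpleProd_empty, one_mul]
      · intro J α β _ hJ hαβ hσ
        -- Any given `J`, `α`, `β` are the constructed ones.
        obtain rfl := PlacticGrowth.simpleProd_mul_cancel (hJ.symm.trans h2)
        obtain ⟨rfl, rfl⟩ := PlacticGrowth.swap_eq_swap hαβ h3 (mul_right_cancel (hσ.symm.trans h4))
        exact h7
  · obtain ⟨h1, I, h2, h3, h4⟩ := PlacticGrowth.local_rule_of_new hQ hP hbk hb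
    refine ⟨h1.symm, ⟨I, h2, h3⟩, fun J _ hJ => ?_⟩
    obtain rfl := PlacticGrowth.simpleProd_mul_cancel (hJ.symm.trans h3)
    exact h4
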